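/- **Notation.** Write $\langle x\rangle=(1+x^2)^{1/2}$. Fix a smooth, even function $\rho:\mathbb R\to[0,1]$ with $\rho=1$ on $[-1,1]$ and $\rho=0$ outside $[-\tfrac98,\tfrac98]$. For $N>0$ let $P_{\le N}\varphi=K_N*\varphi$ with $K_N(x)=\frac1{2\pi}\int_{\mathbb R}\rho(\xi/N)e^{ix\xi}\,d\xi$ (the Fourier multiplier with symbol $\rho(\xi/N)$), and $P_{>N}=1-P_{\le N}$. For $R>0$ let $$\sigma_R(x)=e^{-\langle x/R\rangle},\qquad M_R(w)=\int_{\mathbb R}|P_{\le R}w(x)|^2\,\sigma_R(x)\,dx .$$ For $L>0$, a global $2\pi L$-periodic solution of the nonlinear Schrödinger equation with initial data $\varphi$ is a continuous function $u:\mathbb R_t\times\mathbb R_x\to\mathbb C$, $2\pi L$-periodic in $x$, with $u(0)=\varphi$, that satisfies $$i\partial_t u+\partial_x^2u=|u|^{p-1}u$$ in the sense of space-time distributions. Given $\delta>0$, $A_0\ge 1$, $T$ and $R$, a pair of functions $(u_L,u_{L/2})$ belongs to the good event if, for both $u=u_L$ and $u=u_{L/2}$, $$\big\|\log(T+R+\langle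 x\rangle)^{-\frac2{p+3}}u\big\|_{L^\infty_tL^\infty_x([-T,T]\times\mathbb R)}\le A_0,\qquad \sup_{N\in\{1,2,4,8,\dots\}}N^{\frac12-\delta}\big\|\log(T+R+\langle x\rangle)^{-\frac12}P_{>N}u\big\|_{L^\infty_tL^\infty_x([-T,T]\times\mathbb R)}\le A_0 .$$ **Proposition 5.3 (Difference estimate).** Let $p\ge3$ be real, let $\delta>0$ and let $A_0\ge1$. Then there is a constant $A_2\ge1$, depending only on $A_0$, $p$, $\delta$ and the fixed cutoff $\rho$, with the following property. Let $L\ge10$, $R\ge10$ and $T\ge1$ be real. Let $u_L$ be a global $2\pi L$-periodic solution and $u_{L/2}$ a global $\pi L$-periodic solution of the nonlinear Schrödinger equation above, with arbitrary initial data $\varphi_L$ and $\varphi_{L/2}$, and let $w_L=u_L-u_{L/2}$. If $(u_L,u_{L/2})$ belongs to the good event, then for all $t,t_0\in[-T,T]$ $$M_R(w_L(t))\le\exp\Big(A_2\log(T+R)^{\frac{2(p-1)}{p+3}}\,|t-t_0|\Big)\Big(M_R(w_L(t_0))+A_2\,R^{-1+8\delta}\log(T+R)^p\Big).$$ (In particular,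 the estimate holds on the good event, with the same $A_2$, for every realization of the random solutions $u_L$, $u_{L/2}$ whose initial data are sampled from the $2\pi L$- and $\pi L$-periodic Gibbs measures.) -/

import Mathlib

open scoped ContDiff

/-- The Japanese bracket `⟨x⟩ = (1 + x²)^{1/2}`. -/
noncomputable def japaneseBracket (x : ℝ) : ℝ := Real.sqrt (1 + x ^ 2)

/-- The admissible Littlewood-Paley cutoffs: smooth even functions `ρ : ℝ → [0,1]`, equal to `1` on
`[-1, 1]` and to `0` outside `[-9/8, 9/8]`. (Evenness says that the Littlewood-Paley operators
commute with complex conjugation.) -/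
structure IsLPCutoff (ρ : ℝ → ℝ) : Prop where
  smooth : ContDiff ℝ ∞ ρ
  nonneg : ∀ ξ, 0 ≤ ρ ξ
  le_one : ∀ ξ, ρ ξ ≤ 1
  eq_one : ∀ ξ ∈ Set.Icc (-1 : ℝ) 1, ρ ξ = 1
  eq_zero : ∀ ξ ∉ Set.Icc (-(9 / 8) : ℝ) (9 / 8), ρ ξ = 0
  even : ∀ ξ, ρ (-ξ) = ρ ξ

/-- The convolution kernel of the Fourier multiplier with symbol `ξ ↦ ρ (ξ / N)`, that is
`x ↦ (2π)⁻¹ ∫ ρ(ξ/N) e^{ixξ} dξ`. The factor `(2π)⁻¹` is the one for which convolution with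
the kernel multiplies the Fourier transform by exactly `ρ(ξ/N)`. -/
noncomputable def lpKernel (ρ : ℝ → ℝ) (N x : ℝ) : ℂ :=
  ((2 * Real.pi : ℝ) : ℂ)⁻¹ * ∫ ξ : ℝ, (ρ (ξ / N) : ℂ) * Complex.exp (Complex.I * (x * ξ : ℝ))

/-- The Littlewood-Paley operator `P_{≤N}`, the convolution with `lpKernel ρ N`. -/
noncomputable def lpLow (ρ : ℝ → ℝ) (N : ℝ) (φ : ℝ → ℂ) (x : ℝ) : ℂ :=
  ∫ y : ℝ, lpKernel ρ N (x - y) * φ y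

/-- The Littlewood-Paley operator `P_{>N} = 1 - P_{≤N}`. -/
noncomputable def lpHigh (ρ : ℝ → ℝ) (N : ℝ) (φ : ℝ → ℂ) (x : ℝ) : ℂ :=
  φ x - lpLow ρ N φ x

/-- `u = u(t,x)` is a global `2πL`-periodic solution of the defocusing nonlinear Schrödinger
equation `i ∂ₜ u + ∂ₓ² u = |u|^{p-1} u` with initial data `φ`: it is continuous on `ℝ × ℝ`,
`2πL`-periodic in `x`, equals `φ` at time zero, and solves the equation in the sense of space-time
distributions. -/
structure IsPeriodicNLSSolution (p L : ℝ) (φ : ℝ → ℂ) (u : ℝ → ℝ → ℂ) : Prop where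
  continuous : Continuous fun z : ℝ × ℝ => u z.1 z.2
  periodic : ∀ t, Function.Periodic (u t) (2 * Real.pi * L)
  initial : ∀ x, u 0 x = φ x
  equation : ∀ ψ : ℝ × ℝ → ℂ, ContDiff ℝ ∞ ψ → HasCompactSupport ψ →
    ∫ z : ℝ × ℝ, u z.1 z.2 * (-Complex.I * deriv (fun s : ℝ => ψ (s, z.2)) z.1
        + iteratedDeriv 2 (fun y : ℝ => ψ (z.1, y)) z.2)
      = ∫ z : ℝ × ℝ, (((‖u z.1 z.2‖ ^ (p - 1) : ℝ) : ℂ) * u z.1 z.2) * ψ z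

/-- The norm `‖ log(T + R + ⟨x⟩)^{-γ} f ‖` in `L_t^∞ L_x^∞([-T,T] × ℝ)`, with values in
`[0, ∞]`. -/
noncomputable def logWeightedNorm (T R γ : ℝ) (f : ℝ → ℝ → ℂ) : ENNReal :=
  MeasureTheory.eLpNorm
    (fun z : ℝ × ℝ => ((Real.log (T + R + japaneseBracket z.2) ^ (-γ) : ℝ) : ℂ) * f z.1 z.2) ⊤
    (MeasureTheory.volume.restrict (Set.Icc (-T) T ×ˢ Set.univ))

/-- The bounds which the good event imposes on one solution `u`:
`‖ log(T+R+⟨x⟩)^{-2/(p+3)} u ‖ ≤ A₀` and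
`N^{1/2-δ} ‖ log(T+R+⟨x⟩)^{-1/2} P_{>N} u ‖ ≤ A₀` for every dyadic `N = 2^k ≥ 1`,
both norms being taken in `L_t^∞ L_x^∞([-T,T] × ℝ)`. -/
def GoodBounds (ρ : ℝ → ℝ) (p δ A₀ T R : ℝ) (u : ℝ → ℝ → ℂ) : Prop :=
  logWeightedNorm T R (2 / (p + 3)) u ≤ ENNReal.ofReal A₀ ∧
  ⨆ k : ℕ, ENNReal.ofReal (((2 : ℝ) ^ k) ^ (1 / 2 - δ)) *
      logWeightedNorm T R (1 / 2) (fun t => lpHigh ρ (2 ^ k) (u t)) ≤ ENNReal.ofReal A₀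

/-- The good event, for one realization of the pair `(u_L, u_{L/2})`. -/
def GoodEvent (ρ : ℝ → ℝ) (p δ A₀ T R : ℝ) (uL uHalf : ℝ → ℝ → ℂ) : Prop :=
  GoodBounds ρ p δ A₀ T R uL ∧ GoodBounds ρ p δ A₀ T R uHalf

/-- The weight `σ_R(x) = e^{-⟨x/R⟩}`. -/
noncomputable def sigmaWeight (R x : ℝ) : ℝ := Real.exp (-japaneseBracket (x / R))

/-- The localized, frequency-truncated mass `M_R(w) = ∫ |P_{≤R} w|² σ_R dx`. -/
noncomputable def localMass (ρ : ℝ → ℝ) (R : ℝ) (w : ℝ → ℂ) : ℝ :=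
  ∫ x : ℝ, ‖lpLow ρ R w x‖ ^ 2 * sigmaWeight R x

open scoped ContDiff FourierTransform SchwartzMap Topology
open MeasureTheory

/-! Write `w = u - v`, `W = P_{≤R} w`, `M = M_R(w)`, `a = 2(p-1)/(p+3)`, `S = T + R`. The estimate
is Gronwall's inequality for `|M'| ≤ A₂ (log S)^a (M + E)` on `[-T,T]`, where `E = A₂ R^{-1+8δ} (log
S)^p`. By the equation, `M'` is a dispersive pairing minus a nonlinear one.

Dispersive pairing (`exists_dispersive_energy_bound`): an integration by parts puts one derivative
on `σ_R`. Since `|σ_R'| ≤ σ_R / R`, this compensates the factor `R` which the remaining derivative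
costs on the frequency-localized `W`.

Nonlinear pairing (`exists_nonlinear_energy_bound`): the difference of the nonlinearities is `V w`,
with `V` the real differential averaged over the segment from `v` to `u`, and `P_{≤R}(V w)` is `V W`
plus commutators. The term `V W` is bounded through `|V| ≲ log^a`. The high-frequency bounds make
`V` vary on the scale `1/R` by only `κ = R^{δ-1/2}`, up to logarithms
(`exists_potential_increment_bound`), so a commutator gains one `κ`. As `σ_R` has mass of order `R`,
Young's inequality needs a total gain of `κ²`, which leaves the error `κ⁴ R = R^{-1+4δ}`. Split `w =
w_l + w_h` at a dyadic frequency `N` comparable to `R`. The high part is itself `O(κ)`, so its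
commutator `Y` is `O(κ²)`. The commutator `X` with the low part gains only one `κ`, but `P_{≤N} X =
0`. Hence `W` may be replaced by `P_{>N} W = P_{≤R} w_h = O(κ)` in its pairing with `X`, up to a
commutator of `P_{≤N}` with `σ_R`, which is small because `σ_R` varies on the scale `R`
(`integral_inner_eq_of_kconv_eq_zero`, `abs_integral_weight_commutator_le`).

The operators are nonlocal and the a priori bounds grow logarithmically in `x`. The kernels are
therefore dominated by `R (1 + R|z|)^{-m}`, whose spare powers pay for comparing weights and
potentials at two points, while the decay of `σ_R` turns `log(S + ⟨x⟩)` into `log S`. The equation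
holds only in the sense of distributions; the time derivative of `P_{≤R} u` comes from test
functions `χ(t) k(x - y)`. Periodicity serves only to make each solution bounded in `x`, so that all
integrals converge; these bounds enter no constant. -/

/-! ### The Schwartz profile of the Littlewood-Paley kernels -/

/-- A Schwartz profile `g` of the Littlewood-Paley kernels: `lpKernel ρ N x = N g(Nx)`. -/
structure IsLPProfile (ρ : ℝ → ℝ) (g : 𝓢(ℝ, ℝ)) : Prop where
  kernel_eq : ∀ N x : ℝ, 0 < N → lpKernel ρ N x = ((N * g (N * x) : ℝ) : ℂ)
  even : ∀ x, g (-x) = g x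
  fourier : ∀ ξ : ℝ, ∫ x : ℝ, (g x : ℂ) * Complex.exp (-(Complex.I * (x * ξ : ℝ))) = ρ ξ

theorem lpKernel_eq_scale (ρ : ℝ → ℝ) {N : ℝ} (hN : 0 < N) (x : ℝ) :
    lpKernel ρ N x = (N : ℂ) * lpKernel ρ 1 (N * x) := by
  have h := Measure.integral_comp_mul_left
    (fun ξ : ℝ => (ρ (ξ / N) : ℂ) * Complex.exp (Complex.I * (x * ξ : ℝ))) N
  rw [abs_of_pos (inv_pos.2 hN)] at h
  have h2 : (fun ξ : ℝ => (ρ (N * ξ / N) : ℂ) * Complex.exp (Complex.I * (x * (N * ξ) : ℝ)))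
      = fun ξ : ℝ => (ρ (ξ / 1) : ℂ) * Complex.exp (Complex.I * ((N * x) * ξ : ℝ)) := by
    funext ξ
    rw [mul_div_cancel_left₀ _ hN.ne', div_one]
    congr 3
    push_cast
    ring
  rw [h2] at h
  unfold lpKernel
  rw [h, Complex.real_smul]
  have : (N : ℂ) ≠ 0 := by exact_mod_cast hN.ne'
  push_cast
  field_simp

/-- Evenness of `ρ` makes the kernel real, so that the profile can be a real Schwartz function. -/
theorem IsLPCutoff.conj_lpKernel {ρ : ℝ → ℝ} (hρ : IsLPCutoff ρ) (N x : ℝ) :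
    (starRingEnd ℂ) (lpKernel ρ N x) = lpKernel ρ N x := by
  unfold lpKernel
  rw [map_mul, ← integral_conj]
  congr 1
  · rw [map_inv₀, Complex.conj_ofReal]
  · rw [← integral_neg_eq_self]
    congr 1
    funext ξ
    rw [map_mul, Complex.conj_ofReal, ← Complex.exp_conj, map_mul, Complex.conj_I,
      Complex.conj_ofReal, neg_div, hρ.even]
    congr 2
    push_cast
    ring

theorem IsLPCutoff.lpKernel_neg {ρ : ℝ → ℝ} (hρ : IsLPCutoff ρ) (N x : ℝ) :
    lpKernel ρ N (-x) = lpKernel ρ N x := by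
  unfold lpKernel
  congr 1
  rw [← integral_neg_eq_self]
  congr 1
  funext ξ
  rw [neg_div, hρ.even, neg_mul_neg]

theorem IsLPCutoff.hasCompactSupport {ρ : ℝ → ℝ} (hρ : IsLPCutoff ρ) : HasCompactSupport ρ :=
  HasCompactSupport.intro isCompact_Icc hρ.eq_zero

/-- The profile is the inverse Fourier transform of `ρ`, which is Schwartz because `ρ` is smooth
with compact support. The dilation `e` by `(2π)⁻¹` converts the convention `e^{2πixξ}` of `𝓕` into
`e^{ixξ}`. -/
theorem IsLPCutoff.exists_profile {ρ : ℝ → ℝ} (hρ : IsLPCutoff ρ) :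
    ∃ g : 𝓢(ℝ, ℝ), IsLPProfile ρ g := by
  have hc : HasCompactSupport (fun ξ => (ρ ξ : ℂ)) :=
    hρ.hasCompactSupport.comp_left (g := fun r : ℝ => (r : ℂ)) (by simp)
  have hs : ContDiff ℝ ∞ (fun ξ => (ρ ξ : ℂ)) := Complex.ofRealCLM.contDiff.comp hρ.smooth
  set f : 𝓢(ℝ, ℂ) := hc.toSchwartzMap hs with hf
  have hfx : ∀ ξ, f ξ = (ρ ξ : ℂ) := fun ξ => rfl
  have hpi : (2 * Real.pi : ℝ) ≠ 0 := by positivity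
  set F : 𝓢(ℝ, ℂ) := 𝓕⁻ f with hF
  let e : ℝ ≃L[ℝ] ℝ := ContinuousLinearEquiv.smulLeft (Units.mk0 (2 * Real.pi)⁻¹ (inv_ne_zero hpi))
  let g : 𝓢(ℝ, ℝ) := (2 * Real.pi)⁻¹ •
    (SchwartzMap.postcompCLM Complex.reCLM (SchwartzMap.compCLMOfContinuousLinearEquiv ℝ e F))
  have he : ∀ x, e x = (2 * Real.pi)⁻¹ * x := fun x => rfl
  have hg : ∀ x, g x = (2 * Real.pi)⁻¹ * (F ((2 * Real.pi)⁻¹ * x)).re := fun x => by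
    simp [g, he]
  have hFk : ∀ x, ((2 * Real.pi : ℝ) : ℂ)⁻¹ * F ((2 * Real.pi)⁻¹ * x) = lpKernel ρ 1 x := by
    intro x
    rw [hF, SchwartzMap.fourierInv_coe, Real.fourierInv_eq']
    unfold lpKernel
    congr 2
    funext ξ
    rw [hfx, smul_eq_mul, mul_comm, div_one]
    congr 2
    simp only [RCLike.inner_apply, conj_trivial]
    push_cast
    field_simp
  have hgk : ∀ x, lpKernel ρ 1 x = (g x : ℂ) := by
    intro x
    have h1 := hρ.conj_lpKernel 1 x
    rw [Complex.conj_eq_iff_re] at h1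
    rw [← h1, ← hFk, hg, ← Complex.ofReal_inv, Complex.re_ofReal_mul]
  refine ⟨g, ?_, ?_, ?_⟩
  · intro N x hN
    rw [lpKernel_eq_scale ρ hN, hgk]
    push_cast
    rfl
  · intro x
    have := hρ.lpKernel_neg 1 x
    rw [hgk, hgk] at this
    exact_mod_cast this
  · intro ξ
    have h1 : 𝓕 F = f := by rw [hF]; exact FourierTransform.fourier_fourierInv_eq f
    have h2 : (𝓕 F) ξ = (ρ ξ : ℂ) := by rw [h1, hfx]
    rw [SchwartzMap.fourier_coe, Real.fourier_eq'] at h2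
    rw [← h2]
    have h3 := Measure.integral_comp_mul_left (fun v : ℝ =>
      Complex.exp (↑(-2 * Real.pi * inner ℝ v ξ) * Complex.I) • F v) (2 * Real.pi)⁻¹
    rw [inv_inv, abs_of_pos (by positivity : (0 : ℝ) < 2 * Real.pi)] at h3
    have h4 : ∀ a b : ℂ, a = ((2 * Real.pi : ℝ)) • b → ((2 * Real.pi : ℝ) : ℂ)⁻¹ * a = b := by
      intro a b h
      have : ((2 * Real.pi : ℝ) : ℂ) ≠ 0 := by exact_mod_cast hpi
      rw [h, Complex.real_smul]
      field_simp
    rw [← h4 _ _ h3, ← integral_const_mul]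
    congr 1
    funext x
    rw [← hgk, ← hFk, smul_eq_mul]
    have : Complex.exp (↑(-2 * Real.pi * inner ℝ ((2 * Real.pi)⁻¹ * x) ξ) * Complex.I) =
      Complex.exp (-(Complex.I * (x * ξ : ℝ))) := by
      congr 1
      simp only [RCLike.inner_apply, conj_trivial]
      push_cast
      field_simp
    rw [this]
    ring

/-! ### Convolution of an integrable kernel with bounded continuous functions -/

/-- Convolution of a real kernel with a vector-valued function. -/
noncomputable def kconv {E : Type*} [NormedAddCommGroup E] [NormedSpace ℝ E]
    (k : ℝ → ℝ) (f : ℝ → E) (x : ℝ) : E := ∫ y : ℝ, k (x - y) • f y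

/-- The rescaled kernel `N g(N x)`. -/
noncomputable def scaledKernel (g : ℝ → ℝ) (N x : ℝ) : ℝ := N * g (N * x)

/-- The polynomially decaying majorant `R (1 + R|z|)^{-m}`. -/
noncomputable def polyKernel (m : ℕ) (R z : ℝ) : ℝ := R * ((1 + R * |z|) ^ m)⁻¹

section Kconv
variable {E : Type*} [NormedAddCommGroup E] [NormedSpace ℝ E]

theorem integrable_kconv {k : ℝ → ℝ} {f : ℝ → E} (hk : Integrable k) (hf : Continuous f)
    {B : ℝ} (hB : ∀ y, ‖f y‖ ≤ B) (x : ℝ) : Integrable fun y => k (x - y) • f y :=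
  (hk.comp_sub_left x).smul_bdd B hf.aestronglyMeasurable (Filter.Eventually.of_forall hB)

theorem kconv_eq_integral_sub (k : ℝ → ℝ) (f : ℝ → E) (x : ℝ) :
    kconv k f x = ∫ z : ℝ, k z • f (x - z) := by
  unfold kconv
  rw [← integral_sub_left_eq_self (fun z => k z • f (x - z)) volume x]
  simp

theorem kconv_sub {k : ℝ → ℝ} {f g : ℝ → E} (hk : Integrable k) (hf : Continuous f)
    (hg : Continuous g) {B B' : ℝ} (hB : ∀ y, ‖f y‖ ≤ B) (hB' : ∀ y, ‖g y‖ ≤ B') (x : ℝ) :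
    kconv k (fun y => f y - g y) x = kconv k f x - kconv k g x := by
  unfold kconv
  rw [← integral_sub (integrable_kconv hk hf hB x) (integrable_kconv hk hg hB' x)]
  simp_rw [smul_sub]

theorem kconv_const_mul (c : ℝ) (k : ℝ → ℝ) (f : ℝ → E) (x : ℝ) :
    kconv (fun z => c * k z) f x = c • kconv k f x := by
  unfold kconv
  simp_rw [mul_smul]
  rw [integral_smul]

theorem norm_kconv_le {k : ℝ → ℝ} {f : ℝ → E} (hk : Integrable k)
    {B : ℝ} (hB : ∀ y, ‖f y‖ ≤ B) (x : ℝ) : ‖kconv k f x‖ ≤ (∫ z, |k z|) * B := by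
  rw [kconv_eq_integral_sub, ← integral_mul_const]
  refine norm_integral_le_of_norm_le (hk.abs.mul_const B) (Filter.Eventually.of_forall fun z => ?_)
  rw [norm_smul, Real.norm_eq_abs]
  exact mul_le_mul_of_nonneg_left (hB _) (abs_nonneg _)

/-- The parameter is time in the application, where bounds on the function are only locally uniform;
dominated convergence needs no more. -/
theorem continuous_kconv_param {X : Type*} [TopologicalSpace X] [FirstCountableTopology X]
    {k : ℝ → ℝ} {u : X → ℝ → E} (hk : Integrable k)
    (hu : Continuous fun p : X × ℝ => u p.1 p.2)
    (hb : ∀ x₀, ∃ B, ∀ᶠ x in 𝓝 x₀, ∀ y, ‖u x y‖ ≤ B) :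
    Continuous fun p : X × ℝ => kconv k (u p.1) p.2 := by
  simp_rw [kconv_eq_integral_sub]
  rw [continuous_iff_continuousAt]
  rintro ⟨x₀, y₀⟩
  obtain ⟨B, hB⟩ := hb x₀
  refine continuousAt_of_dominated (bound := fun z => |k z| * B) ?_ ?_ (hk.abs.mul_const B) ?_
  · refine Filter.Eventually.of_forall fun p => ?_
    refine hk.aestronglyMeasurable.smul (Continuous.aestronglyMeasurable ?_)
    exact hu.comp (f := fun z : ℝ => (p.1, p.2 - z)) (by fun_prop)
  · have : ∀ᶠ p : X × ℝ in 𝓝 (x₀, y₀), ∀ y, ‖u p.1 y‖ ≤ B :=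
      (continuous_fst.tendsto (x₀, y₀)).eventually hB
    filter_upwards [this] with p hp
    refine Filter.Eventually.of_forall fun z => ?_
    rw [norm_smul, Real.norm_eq_abs]
    exact mul_le_mul_of_nonneg_left (hp _) (abs_nonneg _)
  · refine Filter.Eventually.of_forall fun z => Continuous.continuousAt ?_
    exact (hu.comp (f := fun p : X × ℝ => (p.1, p.2 - z)) (by fun_prop)).const_smul (k z)

theorem continuous_kconv {k : ℝ → ℝ} {f : ℝ → E} (hk : Integrable k) (hf : Continuous f)
    {B : ℝ} (hB : ∀ y, ‖f y‖ ≤ B) : Continuous (kconv k f) := by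
  have := continuous_kconv_param (X := Unit) (u := fun _ => f) hk (by fun_prop)
    (fun _ => ⟨B, Filter.Eventually.of_forall fun _ => hB⟩)
  exact this.comp (f := fun y : ℝ => ((), y)) (by fun_prop)

theorem integrable_triple {k₁ k₂ : ℝ → ℝ} {f : ℝ → E} (hk₁ : Integrable k₁) (hk₂ : Integrable k₂)
    (hf : Continuous f) {B : ℝ} (hB : ∀ y, ‖f y‖ ≤ B) (x : ℝ) :
    Integrable (fun p : ℝ × ℝ => k₁ (x - p.1) • k₂ (p.1 - p.2) • f p.2)
      (volume.prod volume) := by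
  have h1 : Integrable (fun p : ℝ × ℝ => k₁ (x - p.2) * k₂ (-(p.1 - p.2)))
      (volume.prod volume) :=
    Integrable.convolution_integrand (ContinuousLinearMap.mul ℝ ℝ)
      (f := fun y => k₁ (x - y)) (g := fun y => k₂ (-y)) (hk₁.comp_sub_left x) hk₂.comp_neg
  have h2 := h1.swap
  have h3 := h2.smul_bdd B (f := fun p : ℝ × ℝ => f p.2)
    (hf.comp continuous_snd).aestronglyMeasurable
    (Filter.Eventually.of_forall fun p => hB p.2)
  refine h3.congr (Filter.Eventually.of_forall fun p => ?_)
  simp [Function.comp, mul_smul]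

theorem kconv_kconv {k₁ k₂ k₃ : ℝ → ℝ} {f : ℝ → E} (hk₁ : Integrable k₁)
    (hk₂ : Integrable k₂) (hk : ∀ x, ∫ y, k₁ (x - y) * k₂ y = k₃ x)
    (hf : Continuous f) {B : ℝ} (hB : ∀ y, ‖f y‖ ≤ B) (x : ℝ) :
    kconv k₁ (kconv k₂ f) x = kconv k₃ f x := by
  -- Without completeness the Bochner integral is zero by definition, and both sides vanish.
  by_cases hE : CompleteSpace E
  swap
  · simp [kconv, integral, hE]
  unfold kconv
  simp_rw [← integral_smul]
  rw [integral_integral_swap (integrable_triple hk₁ hk₂ hf hB x)]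
  congr 1
  funext z
  have h1 : (∫ y, k₁ (x - y) • k₂ (y - z) • f z) = (∫ y, k₁ (x - y) * k₂ (y - z)) • f z := by
    rw [← integral_smul_const]
    simp_rw [mul_smul]
  rw [h1, ← hk (x - z), ← integral_add_right_eq_self _ z]
  congr 3
  funext y
  rw [add_sub_cancel_right, sub_sub, add_comm z y]

theorem hasDerivAt_kconv {k k' : ℝ → ℝ} {f : ℝ → E} (hk : ∀ x, HasDerivAt k (k' x) x)
    (hki : Integrable k) (hk' : Continuous k') {C : ℝ} (hC : ∀ x, |k' x| ≤ C * polyKernel 2 1 x)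
    (hpi : Integrable (polyKernel 2 1))
    (hf : Continuous f) {B : ℝ} (hB : ∀ y, ‖f y‖ ≤ B) (x : ℝ) :
    HasDerivAt (kconv k f) (kconv k' f x) x := by
  have hC0 : 0 ≤ C := by
    have := (abs_nonneg _).trans (hC 0)
    simpa [polyKernel] using this
  -- The factor `4` is the square of the `2` in `1 + |x - y| ≤ 2 (1 + |x' - y|)`, valid for `|x' -
  -- x| < 1`.
  refine (hasDerivAt_integral_of_dominated_loc_of_deriv_le (F := fun x y => k (x - y) • f y)
    (F' := fun x y => k' (x - y) • f y) (bound := fun y => (C * (4 * polyKernel 2 1 (x - y))) * B)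
    (Metric.ball_mem_nhds x one_pos) ?_ (integrable_kconv hki hf hB x) ?_ ?_ ?_ ?_).2
  · refine Filter.Eventually.of_forall fun x' => (integrable_kconv hki hf hB x').aestronglyMeasurable
  · exact ((hk'.comp (by fun_prop)).smul hf).aestronglyMeasurable
  · refine Filter.Eventually.of_forall fun y x' hx' => ?_
    rw [norm_smul, Real.norm_eq_abs]
    refine mul_le_mul ((hC _).trans (mul_le_mul_of_nonneg_left ?_ hC0)) (hB y) (norm_nonneg _) ?_
    · unfold polyKernel
      rw [Metric.mem_ball, Real.dist_eq] at hx'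
      have h1 : |x - y| ≤ |x' - y| + 1 := by
        have := abs_sub_abs_le_abs_sub (x - y) (x' - y)
        have h : x - y - (x' - y) = -(x' - x) := by ring
        rw [h, abs_neg] at this
        linarith
      rw [one_mul, one_mul, one_mul, one_mul, ← div_eq_mul_inv, inv_eq_one_div, div_le_div_iff₀ (by positivity)
        (by positivity)]
      have := abs_nonneg (x' - y)
      have := abs_nonneg (x - y)
      nlinarith
    · unfold polyKernel; positivity
  · exact (((hpi.comp_sub_left x).const_mul 4).const_mul C).mul_const B
  · refine Filter.Eventually.of_forall fun y x' _ => ?_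
    have := (hk (x' - y)).comp_sub_const x' y
    exact this.smul_const (f y)

end Kconv

/-! ### Polynomially decaying majorants and rescaled kernels -/

section PolyKernel

theorem polyKernel_nonneg (m : ℕ) {R : ℝ} (hR : 0 ≤ R) (z : ℝ) : 0 ≤ polyKernel m R z := by
  unfold polyKernel; positivity

theorem polyKernel_neg (m : ℕ) (R z : ℝ) : polyKernel m R (-z) = polyKernel m R z := by
  unfold polyKernel; rw [abs_neg]

theorem polyKernel_sub_comm (m : ℕ) (R x y : ℝ) :
    polyKernel m R (x - y) = polyKernel m R (y - x) := by
  rw [← polyKernel_neg, neg_sub]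

/-- Spare powers of the majorant absorb powers of `1 + R|x - y|`. Every comparison of weights or
potentials at two points is paid for in this way. -/
theorem polyKernel_mul_pow (m j : ℕ) {R : ℝ} (hR : 0 ≤ R) (z : ℝ) :
    polyKernel (m + j) R z * (1 + R * |z|) ^ j = polyKernel m R z := by
  unfold polyKernel
  have : 0 < 1 + R * |z| := by positivity
  rw [pow_add]
  field_simp

theorem polyKernel_anti {m n : ℕ} (h : n ≤ m) {R : ℝ} (hR : 0 ≤ R) (z : ℝ) :
    polyKernel m R z ≤ polyKernel n R z := by
  unfold polyKernel
  have : 1 ≤ 1 + R * |z| := by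
    have : 0 ≤ R * |z| := by positivity
    linarith
  gcongr

theorem continuous_polyKernel (m : ℕ) {R : ℝ} (hR : 0 ≤ R) : Continuous (polyKernel m R) := by
  unfold polyKernel
  refine continuous_const.mul (Continuous.inv₀ (by fun_prop) fun z => ?_)
  have : 0 < 1 + R * |z| := by positivity
  positivity

theorem integrable_polyKernel_one : Integrable (polyKernel 2 1) := by
  refine integrable_inv_one_add_sq.mono' (continuous_polyKernel 2 zero_le_one).aestronglyMeasurable
    (Filter.Eventually.of_forall fun z => ?_)
  rw [Real.norm_of_nonneg (polyKernel_nonneg 2 zero_le_one z)]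
  unfold polyKernel
  rw [one_mul, one_mul]
  have := abs_nonneg z
  gcongr
  nlinarith [sq_abs z]

theorem polyKernel_eq_scaled (m : ℕ) {R : ℝ} (hR : 0 ≤ R) (z : ℝ) :
    polyKernel m R z = scaledKernel (polyKernel m 1) R z := by
  unfold scaledKernel polyKernel
  rw [abs_mul, abs_of_nonneg hR, one_mul, one_mul]

theorem integrable_scaledKernel {g : ℝ → ℝ} (hg : Integrable g) {N : ℝ} (hN : 0 < N) :
    Integrable (scaledKernel g N) :=
  (hg.comp_mul_left' hN.ne').const_mul N

theorem integral_scaledKernel (g : ℝ → ℝ) {N : ℝ} (hN : 0 < N) :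
    ∫ x, scaledKernel g N x = ∫ x, g x := by
  unfold scaledKernel
  rw [integral_const_mul, Measure.integral_comp_mul_left, abs_of_pos (inv_pos.2 hN), smul_eq_mul,
    mul_inv_cancel_left₀ hN.ne']

theorem integrable_polyKernel {m : ℕ} (hm : 2 ≤ m) {R : ℝ} (hR : 0 < R) :
    Integrable (polyKernel m R) := by
  have h2 : Integrable (polyKernel 2 R) := by
    have := integrable_scaledKernel integrable_polyKernel_one hR
    exact this.congr (Filter.Eventually.of_forall fun z => (polyKernel_eq_scaled 2 hR.le z).symm)
  refine h2.mono' (continuous_polyKernel m hR.le).aestronglyMeasurable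
    (Filter.Eventually.of_forall fun z => ?_)
  rw [Real.norm_of_nonneg (polyKernel_nonneg m hR.le z)]
  exact polyKernel_anti hm hR.le z

/-- The mass of the majorants, which bounds all convolutions. -/
noncomputable def polyMass : ℝ := ∫ z, polyKernel 2 1 z

theorem integral_polyKernel_two {R : ℝ} (hR : 0 < R) : ∫ z, polyKernel 2 R z = polyMass := by
  unfold polyMass
  rw [← integral_scaledKernel (polyKernel 2 1) hR]
  congr 1
  funext z
  exact polyKernel_eq_scaled 2 hR.le z

theorem polyMass_nonneg : 0 ≤ polyMass := integral_nonneg (polyKernel_nonneg 2 zero_le_one)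

theorem integral_polyKernel_le {m : ℕ} (hm : 2 ≤ m) {R : ℝ} (hR : 0 < R) :
    ∫ z, polyKernel m R z ≤ polyMass := by
  rw [← integral_polyKernel_two hR]
  exact integral_mono (integrable_polyKernel hm hR) (integrable_polyKernel le_rfl hR)
    (polyKernel_anti hm hR.le)

/-- Kernels at frequencies comparable to `R` can all be measured by majorants at the single scale
`R`: the prefactor costs `2`, the decay `4 ^ m`. -/
theorem polyKernel_le_of_comparable (m : ℕ) {N R : ℝ} (hN : 0 < N) (h1 : R ≤ 4 * N)
    (h2 : N ≤ 2 * R) (z : ℝ) : polyKernel m N z ≤ 2 * 4 ^ m * polyKernel m R z := by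
  unfold polyKernel
  have hR : 0 < R := by linarith
  have hz := abs_nonneg z
  have h3 : (1 + R * |z|) ^ m ≤ 4 ^ m * (1 + N * |z|) ^ m := by
    rw [← mul_pow]
    gcongr
    nlinarith
  have h4 : ((1 + N * |z|) ^ m)⁻¹ ≤ 4 ^ m * ((1 + R * |z|) ^ m)⁻¹ := by
    rw [← div_eq_mul_inv, inv_eq_one_div, div_le_div_iff₀ (by positivity) (by positivity)]
    linarith
  calc N * ((1 + N * |z|) ^ m)⁻¹ ≤ (2 * R) * (4 ^ m * ((1 + R * |z|) ^ m)⁻¹) := by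
        gcongr
    _ = _ := by ring

theorem SchwartzMap.abs_le_polyKernel (h : 𝓢(ℝ, ℝ)) (m : ℕ) :
    ∃ C, 0 ≤ C ∧ ∀ x, |h x| ≤ C * polyKernel m 1 x := by
  obtain ⟨C, hC⟩ : ∃ C, ∀ x, (1 + ‖x‖) ^ m * ‖iteratedFDeriv ℝ 0 h x‖ ≤ C :=
    ⟨_, fun x => SchwartzMap.one_add_le_sup_seminorm_apply (𝕜 := ℝ) (m := (m, 0)) le_rfl le_rfl h x⟩
  refine ⟨C, le_trans (by positivity) (hC 0), fun x => ?_⟩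
  have := hC x
  rw [norm_iteratedFDeriv_zero, Real.norm_eq_abs, Real.norm_eq_abs] at this
  unfold polyKernel
  rw [one_mul, one_mul, ← div_eq_mul_inv, le_div_iff₀ (by positivity)]
  linarith

theorem abs_scaledKernel_le {g : ℝ → ℝ} {m : ℕ} {C : ℝ} (hC : ∀ x, |g x| ≤ C * polyKernel m 1 x)
    {N : ℝ} (hN : 0 < N) (x : ℝ) : |scaledKernel g N x| ≤ C * polyKernel m N x := by
  rw [polyKernel_eq_scaled m hN.le]
  unfold scaledKernel
  rw [abs_mul, abs_of_pos hN]
  calc N * |g (N * x)| ≤ N * (C * polyKernel m 1 (N * x)) := by gcongr; exact hC _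
    _ = _ := by ring

theorem hasDerivAt_scaledKernel (h : 𝓢(ℝ, ℝ)) (N x : ℝ) :
    HasDerivAt (scaledKernel h N) (N * scaledKernel (SchwartzMap.derivCLM ℝ ℝ h) N x) x := by
  unfold scaledKernel
  have h1 := ((h.hasDerivAt (N * x)).comp x ((hasDerivAt_id x).const_mul N)).const_mul N
  refine h1.congr_deriv ?_
  rw [SchwartzMap.derivCLM_apply]
  ring

theorem continuous_scaledKernel {g : ℝ → ℝ} (hg : Continuous g) (N : ℝ) :
    Continuous (scaledKernel g N) := by
  unfold scaledKernel
  fun_prop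

end PolyKernel

/-! ### Composition of Littlewood-Paley operators -/

namespace IsLPProfile
variable {ρ : ℝ → ℝ} {g : 𝓢(ℝ, ℝ)}

theorem lpLow_eq (hg : IsLPProfile ρ g) {N : ℝ} (hN : 0 < N) (φ : ℝ → ℂ) (x : ℝ) :
    lpLow ρ N φ x = kconv (scaledKernel g N) φ x := by
  unfold lpLow kconv scaledKernel
  congr 1
  funext y
  rw [hg.kernel_eq N _ hN, Complex.real_smul]

theorem scaledKernel_neg (hg : IsLPProfile ρ g) (N x : ℝ) :
    scaledKernel g N (-x) = scaledKernel g N x := by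
  unfold scaledKernel
  rw [mul_neg, hg.even]

theorem integrable (g : 𝓢(ℝ, ℝ)) {N : ℝ} (hN : 0 < N) : Integrable (scaledKernel g N) :=
  integrable_scaledKernel g.integrable hN

theorem fourier_scaled (hg : IsLPProfile ρ g) {N : ℝ} (hN : 0 < N) (ξ : ℝ) :
    ∫ x : ℝ, (scaledKernel g N x : ℂ) * Complex.exp (-(Complex.I * (x * ξ : ℝ))) = ρ (ξ / N) := by
  rw [← hg.fourier (ξ / N)]
  have h := Measure.integral_comp_mul_left (fun x : ℝ => (g x : ℂ) *
    Complex.exp (-(Complex.I * (x * (ξ / N) : ℝ)))) N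
  rw [abs_of_pos (inv_pos.2 hN)] at h
  have h2 : ∫ x, (g x : ℂ) * Complex.exp (-(Complex.I * (x * (ξ / N) : ℝ))) = (N : ℂ) *
      ∫ x : ℝ, (g (N * x) : ℂ) * Complex.exp (-(Complex.I * (N * x * (ξ / N) : ℝ))) := by
    have : (N : ℂ) ≠ 0 := by exact_mod_cast hN.ne'
    rw [h, Complex.real_smul, Complex.ofReal_inv, mul_inv_cancel_left₀ this]
  rw [h2, ← integral_const_mul]
  congr 1
  funext x
  have : N * x * (ξ / N) = x * ξ := by field_simp
  rw [this]
  unfold scaledKernel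
  push_cast
  ring

/-- On the Fourier side `ρ(ξ/N) ρ(ξ/R) = ρ(ξ/R)`: the support of `ρ(·/R)` lies in `|ξ| ≤ 9R/8 ≤ N`,
where `ρ(·/N) = 1`. -/
theorem convolution_eq (hρ : IsLPCutoff ρ) (hg : IsLPProfile ρ g) {N R : ℝ} (hR : 0 < R)
    (hRN : 9 / 8 * R ≤ N) (x : ℝ) :
    ∫ y, scaledKernel g N (x - y) * scaledKernel g R y = scaledKernel g R x := by
  have hN : 0 < N := by linarith
  have key : ((∫ y, scaledKernel g N (x - y) * scaledKernel g R y : ℝ) : ℂ) = lpKernel ρ R x := by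
    rw [← integral_complex_ofReal]
    have hint : Integrable (fun ξ : ℝ => (ρ (ξ / R) : ℂ)) := by
      refine Continuous.integrable_of_hasCompactSupport ?_ ?_
      · exact Complex.continuous_ofReal.comp (hρ.smooth.continuous.comp (by fun_prop))
      · refine HasCompactSupport.intro (K := Set.Icc (-(9 / 8 * R)) (9 / 8 * R)) isCompact_Icc ?_
        intro ξ hξ
        rw [hρ.eq_zero, Complex.ofReal_zero]
        intro h
        apply hξ
        obtain ⟨h1, h2⟩ := h
        rw [le_div_iff₀ hR] at h1
        rw [div_le_iff₀ hR] at h2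
        exact ⟨by linarith, h2⟩
    have h1 : ∀ y, ((scaledKernel g N (x - y) * scaledKernel g R y : ℝ) : ℂ) =
        ((2 * Real.pi : ℝ) : ℂ)⁻¹ * ∫ ξ : ℝ, (scaledKernel g N (x - y) : ℂ) *
          ((ρ (ξ / R) : ℂ) * Complex.exp (Complex.I * (y * ξ : ℝ))) := by
      intro y
      have := hg.kernel_eq R y hR
      unfold lpKernel at this
      rw [integral_const_mul, ← mul_assoc, mul_comm _ (scaledKernel g N (x - y) : ℂ), mul_assoc,
        this, Complex.ofReal_mul]
      rfl
    simp_rw [h1]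
    rw [integral_const_mul]
    unfold lpKernel
    congr 1
    rw [integral_integral_swap]
    · congr 1
      funext ξ
      have h2 : ∀ y : ℝ, (scaledKernel g N (x - y) : ℂ) *
          ((ρ (ξ / R) : ℂ) * Complex.exp (Complex.I * (y * ξ : ℝ))) =
          ((ρ (ξ / R) : ℂ) * Complex.exp (Complex.I * (x * ξ : ℝ))) *
          ((scaledKernel g N (x - y) : ℂ) * Complex.exp (-(Complex.I * ((x - y) * ξ : ℝ)))) := by
        intro y
        have : Complex.exp (Complex.I * (y * ξ : ℝ)) = Complex.exp (Complex.I * (x * ξ : ℝ)) *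
            Complex.exp (-(Complex.I * ((x - y) * ξ : ℝ))) := by
          rw [← Complex.exp_add]
          congr 1
          push_cast
          ring
        rw [this]
        ring
      simp_rw [h2]
      rw [integral_const_mul, integral_sub_left_eq_self (fun z : ℝ => (scaledKernel g N z : ℂ) *
        Complex.exp (-(Complex.I * (z * ξ : ℝ)))) volume x, hg.fourier_scaled hN ξ]
      by_cases hξ : ξ / R ∈ Set.Icc (-(9 / 8) : ℝ) (9 / 8)
      · obtain ⟨h3, h4⟩ := hξ
        rw [le_div_iff₀ hR] at h3
        rw [div_le_iff₀ hR] at h4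
        rw [hρ.eq_one (ξ / N), Complex.ofReal_one, mul_one]
        constructor
        · rw [le_div_iff₀ hN]; linarith
        · rw [div_le_iff₀ hN]; linarith
      · rw [hρ.eq_zero _ hξ]
        simp
    · have h3 : Integrable (fun p : ℝ × ℝ => ((scaledKernel g N (x - p.1) : ℝ) : ℂ) *
          (ρ (p.2 / R) : ℂ)) (volume.prod volume) :=
        (((IsLPProfile.integrable g hN).comp_sub_left x).ofReal).mul_prod hint
      have h4 := h3.mul_bdd (c := 1) (g := fun p : ℝ × ℝ => Complex.exp (Complex.I * (p.1 * p.2 : ℝ)))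
        (Continuous.aestronglyMeasurable (by fun_prop))
        (Filter.Eventually.of_forall fun p => by
          rw [mul_comm, Complex.norm_exp_ofReal_mul_I])
      refine h4.congr (Filter.Eventually.of_forall fun p => ?_)
      simp [Function.uncurry, mul_assoc]
  have h := hg.kernel_eq R x hR
  rw [h] at key
  exact_mod_cast key

theorem convolution_eq' (hρ : IsLPCutoff ρ) (hg : IsLPProfile ρ g) {N R : ℝ} (hR : 0 < R)
    (hRN : 9 / 8 * R ≤ N) (x : ℝ) :
    ∫ y, scaledKernel g R (x - y) * scaledKernel g N y = scaledKernel g R x := by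
  rw [← hg.convolution_eq hρ hR hRN x, ← integral_sub_left_eq_self _ volume x]
  congr 1
  funext y
  rw [sub_sub_cancel, mul_comm]

variable {f : ℝ → ℂ} {B : ℝ}

theorem kconv_large_small (hρ : IsLPCutoff ρ) (hg : IsLPProfile ρ g) {N R : ℝ} (hR : 0 < R)
    (hRN : 9 / 8 * R ≤ N) (hf : Continuous f) (hB : ∀ y, ‖f y‖ ≤ B) (x : ℝ) :
    kconv (scaledKernel g N) (kconv (scaledKernel g R) f) x = kconv (scaledKernel g R) f x :=
  kconv_kconv (IsLPProfile.integrable g (by linarith)) (IsLPProfile.integrable g hR)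
    (hg.convolution_eq hρ hR hRN) hf hB x

theorem kconv_small_large (hρ : IsLPCutoff ρ) (hg : IsLPProfile ρ g) {N R : ℝ} (hR : 0 < R)
    (hRN : 9 / 8 * R ≤ N) (hf : Continuous f) (hB : ∀ y, ‖f y‖ ≤ B) (x : ℝ) :
    kconv (scaledKernel g R) (kconv (scaledKernel g N) f) x = kconv (scaledKernel g R) f x :=
  kconv_kconv (IsLPProfile.integrable g hR) (IsLPProfile.integrable g (by linarith))
    (hg.convolution_eq' hρ hR hRN) hf hB x

end IsLPProfile

/-- The derivative of a convolution with a rescaled Schwartz kernel. -/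
theorem hasDerivAt_kconv_scaledKernel (h : 𝓢(ℝ, ℝ)) {N : ℝ} (hN : 0 < N) {f : ℝ → ℂ} {B : ℝ}
    (hf : Continuous f) (hB : ∀ y, ‖f y‖ ≤ B) (x : ℝ) :
    HasDerivAt (kconv (scaledKernel h N) f)
      ((N : ℝ) • kconv (scaledKernel (SchwartzMap.derivCLM ℝ ℝ h) N) f x) x := by
  obtain ⟨C, hC0, hC⟩ := (SchwartzMap.derivCLM ℝ ℝ h).abs_le_polyKernel 2
  rw [← kconv_const_mul]
  -- This bound only serves domination under the integral; its dependence on `N` enters no estimate.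
  have hbd : ∀ x, |N * scaledKernel (SchwartzMap.derivCLM ℝ ℝ h) N x| ≤
      (N * (C * (N * (1 + N⁻¹) ^ 2))) * polyKernel 2 1 x := by
    intro x
    rw [abs_mul, abs_of_pos hN, mul_assoc]
    refine mul_le_mul_of_nonneg_left ((abs_scaledKernel_le hC hN x).trans ?_) hN.le
    rw [mul_assoc]
    refine mul_le_mul_of_nonneg_left ?_ hC0
    unfold polyKernel
    rw [mul_assoc, one_mul, one_mul]
    refine mul_le_mul_of_nonneg_left ?_ hN.le
    rw [← div_eq_mul_inv, inv_eq_one_div, div_le_div_iff₀ (by positivity) (by positivity), one_mul,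
      ← mul_pow]
    refine pow_le_pow_left₀ (by positivity) ?_ 2
    have h1 : (1 + N⁻¹) * (1 + N * |x|) = 1 + |x| + N⁻¹ + N * |x| := by
      field_simp
      ring
    rw [h1]
    have : 0 < N⁻¹ := inv_pos.2 hN
    have : 0 ≤ N * |x| := by positivity
    linarith
  exact hasDerivAt_kconv (hasDerivAt_scaledKernel h N) (IsLPProfile.integrable h hN)
    ((continuous_scaledKernel (SchwartzMap.derivCLM ℝ ℝ h).continuous N).const_mul N) hbd
    integrable_polyKernel_one hf hB x

/-! ### The logarithmic weight -/

/-- The logarithmic weight `log(S + ⟨x⟩)`. -/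
noncomputable def logWeight (S x : ℝ) : ℝ := Real.log (S + japaneseBracket x)

theorem one_le_japaneseBracket (x : ℝ) : 1 ≤ japaneseBracket x :=
  Real.one_le_sqrt.2 (by nlinarith [sq_nonneg x])

theorem abs_le_japaneseBracket (x : ℝ) : |x| ≤ japaneseBracket x :=
  Real.abs_le_sqrt (by linarith)

theorem continuous_japaneseBracket : Continuous japaneseBracket := by
  unfold japaneseBracket; fun_prop

theorem hasDerivAt_japaneseBracket (x : ℝ) :
    HasDerivAt japaneseBracket (x / japaneseBracket x) x := by
  have h : (1 : ℝ) + x ^ 2 ≠ 0 := by positivity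
  have := ((hasDerivAt_pow 2 x).const_add 1).sqrt h
  refine this.congr_deriv ?_
  unfold japaneseBracket
  have : Real.sqrt (1 + x ^ 2) ≠ 0 := by positivity
  field_simp
  norm_num

theorem abs_div_japaneseBracket_le (x : ℝ) : |x / japaneseBracket x| ≤ 1 := by
  have h := one_le_japaneseBracket x
  rw [abs_div, abs_of_pos (by linarith : 0 < japaneseBracket x), div_le_one (by linarith)]
  exact abs_le_japaneseBracket x

theorem abs_japaneseBracket_sub_le (x y : ℝ) :
    |japaneseBracket x - japaneseBracket y| ≤ |x - y| := by
  have := (convex_univ (𝕜 := ℝ) (E := ℝ)).norm_image_sub_le_of_norm_hasDerivWithin_le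
    (f := japaneseBracket) (C := 1)
    (fun x _ => (hasDerivAt_japaneseBracket x).hasDerivWithinAt)
    (fun x _ => abs_div_japaneseBracket_le x) (Set.mem_univ y) (Set.mem_univ x)
  simpa using this

theorem japaneseBracket_le_mul {R : ℝ} (hR : 1 ≤ R) (x : ℝ) :
    japaneseBracket x ≤ R * japaneseBracket (x / R) := by
  unfold japaneseBracket
  refine Real.sqrt_le_iff.2 ⟨by positivity, ?_⟩
  rw [mul_pow, Real.sq_sqrt (by positivity)]
  field_simp
  nlinarith

section LogWeight
variable {S : ℝ}

theorem one_le_log_of_three_le (hS : 3 ≤ S) : 1 ≤ Real.log S := by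
  rw [Real.le_log_iff_exp_le (by linarith)]
  linarith [Real.exp_one_lt_d9]

theorem one_le_logWeight (hS : 3 ≤ S) (x : ℝ) : 1 ≤ logWeight S x :=
  one_le_log_of_three_le (by linarith [one_le_japaneseBracket x])

theorem continuous_logWeight (hS : 3 ≤ S) : Continuous (logWeight S) := by
  refine Continuous.log (continuous_const.add continuous_japaneseBracket) fun x => ?_
  linarith [one_le_japaneseBracket x]

theorem continuous_logWeight_rpow (hS : 3 ≤ S) (q : ℝ) : Continuous fun x => logWeight S x ^ q :=
  (continuous_logWeight hS).rpow_const fun x =>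
    Or.inl (by linarith [one_le_logWeight hS x])

/-- Since `S + ⟨y⟩ ≤ (S + ⟨x⟩)(1 + |x - y|)`, the logarithm increases by at most `|x - y|`; as the
weight is at least `1`, this additive loss is also a multiplicative one. -/
theorem logWeight_le_mul (hS : 3 ≤ S) (x y : ℝ) :
    logWeight S y ≤ logWeight S x * (1 + |x - y|) := by
  have hx := one_le_japaneseBracket x
  have hxy := abs_nonneg (x - y)
  have h1 : S + japaneseBracket y ≤ (S + japaneseBracket x) * (1 + |x - y|) := by
    have := neg_abs_le (japaneseBracket x - japaneseBracket y)
    have := abs_japaneseBracket_sub_le x y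
    nlinarith
  have h2 : logWeight S y ≤ logWeight S x + Real.log (1 + |x - y|) := by
    unfold logWeight
    rw [← Real.log_mul (by linarith) (by linarith)]
    exact Real.log_le_log (by linarith [one_le_japaneseBracket y]) h1
  have h3 : Real.log (1 + |x - y|) ≤ |x - y| := by
    have := Real.log_le_sub_one_of_pos (by linarith : 0 < 1 + |x - y|)
    linarith
  nlinarith [one_le_logWeight hS x]

theorem logWeight_rpow_le_mul (hS : 3 ≤ S) {R q : ℝ} {n : ℕ} (hR : 1 ≤ R) (hq : 0 ≤ q)
    (hqn : q ≤ n) (x y : ℝ) :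
    logWeight S y ^ q ≤ logWeight S x ^ q * (1 + R * |x - y|) ^ n := by
  have hx := one_le_logWeight hS x
  have hy := one_le_logWeight hS y
  have hxy := abs_nonneg (x - y)
  calc logWeight S y ^ q ≤ (logWeight S x * (1 + R * |x - y|)) ^ q := by
        refine Real.rpow_le_rpow (by linarith) ((logWeight_le_mul hS x y).trans ?_) hq
        gcongr
        nlinarith
    _ = logWeight S x ^ q * (1 + R * |x - y|) ^ q := Real.mul_rpow (by linarith) (by positivity)
    _ ≤ _ := by
        gcongr
        rw [← Real.rpow_natCast]
        refine Real.rpow_le_rpow_of_exponent_le ?_ hqn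
        have : 0 ≤ R * |x - y| := by positivity
        linarith

theorem logWeight_rpow_le_rpow (hS : 3 ≤ S) {q r : ℝ} (h : q ≤ r) (x : ℝ) :
    logWeight S x ^ q ≤ logWeight S x ^ r :=
  Real.rpow_le_rpow_of_exponent_le (one_le_logWeight hS x) h

/-- From `⟨x⟩ ≤ R⟨x/R⟩ ≤ S⟨x/R⟩`: beyond `log S` the weight grows only on the scale `R` on which
`σ_R` decays. -/
theorem logWeight_le_log_add (hS : 3 ≤ S) {R : ℝ} (hR : 1 ≤ R) (hRS : R ≤ S) (x : ℝ) :
    logWeight S x ≤ Real.log S + Real.log (1 + japaneseBracket (x / R)) := by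
  have h := one_le_japaneseBracket (x / R)
  unfold logWeight
  rw [← Real.log_mul (by linarith) (by linarith)]
  refine Real.log_le_log (by linarith [one_le_japaneseBracket x]) ?_
  have := japaneseBracket_le_mul hR x
  nlinarith

theorem logWeight_le_log_mul (hS : 3 ≤ S) {R : ℝ} (hR : 1 ≤ R) (hRS : R ≤ S) (x : ℝ) :
    logWeight S x ≤ Real.log S * (1 + japaneseBracket (x / R)) := by
  have h := one_le_japaneseBracket (x / R)
  have h1 := Real.log_le_sub_one_of_pos (by linarith : 0 < 1 + japaneseBracket (x / R))
  have h2 := logWeight_le_log_add hS hR hRS x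
  have h3 := one_le_log_of_three_le hS
  nlinarith

end LogWeight

/-! ### The weight `σ_R` and its integrals against logarithms -/

section Sigma

theorem sigmaWeight_pos (R x : ℝ) : 0 < sigmaWeight R x := Real.exp_pos _

theorem continuous_sigmaWeight (R : ℝ) : Continuous (sigmaWeight R) := by
  unfold sigmaWeight
  exact Real.continuous_exp.comp (continuous_japaneseBracket.comp (by fun_prop)).neg

/-- A difference form of `|σ_R'| ≤ σ_R / R`, from `1 - e^{-s} ≤ s`. With both values on the right
there is no exponential loss in `|x - y| / R`, which a polynomially decaying kernel could not
absorb. -/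
theorem abs_sigmaWeight_sub_le {R : ℝ} (hR : 0 < R) (x y : ℝ) :
    |sigmaWeight R x - sigmaWeight R y| ≤ |x - y| / R * (sigmaWeight R x + sigmaWeight R y) := by
  have main : ∀ a b : ℝ, a ≤ b → |Real.exp (-a) - Real.exp (-b)| ≤
      |a - b| * (Real.exp (-a) + Real.exp (-b)) := by
    intro a b hab
    have h1 : Real.exp (-b) = Real.exp (-a) * Real.exp (-(b - a)) := by
      rw [← Real.exp_add]; congr 1; ring
    have h2 := Real.add_one_le_exp (-(b - a))
    have h3 := Real.exp_pos (-a)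
    have h4 := Real.exp_pos (-b)
    have h5 : Real.exp (-b) ≤ Real.exp (-a) := Real.exp_le_exp.2 (by linarith)
    rw [abs_of_nonneg (by linarith), abs_of_nonpos (by linarith)]
    nlinarith
  have h := abs_japaneseBracket_sub_le (x / R) (y / R)
  rw [← sub_div, abs_div, abs_of_pos hR] at h
  have hp : 0 < sigmaWeight R x + sigmaWeight R y := by
    linarith [sigmaWeight_pos R x, sigmaWeight_pos R y]
  refine le_trans ?_ (mul_le_mul_of_nonneg_right h hp.le)
  unfold sigmaWeight
  rcases le_total (japaneseBracket (x / R)) (japaneseBracket (y / R)) with hab | hab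
  · exact main _ _ hab
  · rw [abs_sub_comm, abs_sub_comm (japaneseBracket (x / R)), add_comm]
    exact main _ _ hab

theorem hasDerivAt_sigmaWeight (R x : ℝ) : HasDerivAt (sigmaWeight R)
    (-(sigmaWeight R x * (x / R / japaneseBracket (x / R) / R))) x := by
  unfold sigmaWeight
  have h := ((hasDerivAt_japaneseBracket (x / R)).comp x ((hasDerivAt_id x).div_const R)).neg.exp
  refine h.congr_deriv ?_
  simp only [Function.comp, Pi.neg_apply, id]
  ring

theorem abs_deriv_sigmaWeight_le {R : ℝ} (hR : 0 < R) (x : ℝ) :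
    |-(sigmaWeight R x * (x / R / japaneseBracket (x / R) / R))| ≤ sigmaWeight R x / R := by
  rw [abs_neg, abs_mul, abs_of_pos (sigmaWeight_pos R x), div_eq_mul_inv _ R, div_eq_mul_inv _ R,
    abs_mul, abs_of_pos (inv_pos.2 hR)]
  refine mul_le_mul_of_nonneg_left ?_ (sigmaWeight_pos R x).le
  refine mul_le_of_le_one_left (inv_pos.2 hR).le ?_
  rw [← div_eq_mul_inv]
  exact abs_div_japaneseBracket_le _

/-- Half of the decay is enough to integrate logarithmic weights; the other half is spent on the
tail in `logWeight_rpow_le_log_add`. -/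
theorem sigmaWeight_le_exp_half (R x : ℝ) :
    sigmaWeight R x ≤ Real.exp (-(japaneseBracket (x / R) / 2)) := by
  unfold sigmaWeight
  rw [Real.exp_le_exp]
  linarith [one_le_japaneseBracket (x / R)]

theorem integrable_bracket_rpow_mul_exp (q : ℝ) : Integrable fun y : ℝ =>
    (1 + japaneseBracket y) ^ q * Real.exp (-(japaneseBracket y / 2)) := by
  obtain ⟨n, hn⟩ := exists_nat_ge q
  have hcont : Continuous fun y : ℝ =>
      (1 + japaneseBracket y) ^ q * Real.exp (-(japaneseBracket y / 2)) := by
    have h1 : Continuous fun y => 1 + japaneseBracket y :=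
      continuous_const.add continuous_japaneseBracket
    refine Continuous.mul (h1.rpow_const fun x => Or.inl ?_) (Real.continuous_exp.comp (continuous_japaneseBracket.div_const 2).neg)
    linarith [one_le_japaneseBracket x]
  -- Two powers beyond `n` are reserved for the factor `1 + y²`, and a factorial bound on the
  -- exponential absorbs all `n + 2`.
  refine (integrable_inv_one_add_sq.const_mul
    (2 ^ (n + 2) * (n + 2).factorial * Real.exp (1 / 2))).mono' hcont.aestronglyMeasurable
    (Filter.Eventually.of_forall fun y => ?_)
  have h1 := one_le_japaneseBracket y
  rw [Real.norm_of_nonneg (by positivity), ← div_eq_mul_inv, le_div_iff₀ (by positivity)]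
  have h2 := Real.pow_div_factorial_le_exp ((1 + japaneseBracket y) / 2) (by positivity) (n + 2)
  rw [div_le_iff₀ (by positivity), div_pow, div_le_iff₀ (by positivity)] at h2
  have h3 : (1 + japaneseBracket y) ^ q ≤ (1 + japaneseBracket y) ^ n := by
    rw [← Real.rpow_natCast]
    exact Real.rpow_le_rpow_of_exponent_le (by linarith) hn
  have h4 : 1 + y ^ 2 ≤ (1 + japaneseBracket y) ^ 2 := by
    have : japaneseBracket y ^ 2 = 1 + y ^ 2 := Real.sq_sqrt (by positivity)
    nlinarith
  have h5 : Real.exp ((1 + japaneseBracket y) / 2) * Real.exp (-(japaneseBracket y / 2))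
      = Real.exp (1 / 2) := by
    rw [← Real.exp_add]; congr 1; ring
  calc (1 + japaneseBracket y) ^ q * Real.exp (-(japaneseBracket y / 2)) * (1 + y ^ 2)
      ≤ (1 + japaneseBracket y) ^ n * Real.exp (-(japaneseBracket y / 2)) *
        (1 + japaneseBracket y) ^ 2 := by gcongr
    _ = (1 + japaneseBracket y) ^ (n + 2) * Real.exp (-(japaneseBracket y / 2)) := by ring
    _ ≤ (Real.exp ((1 + japaneseBracket y) / 2) * (n + 2).factorial * 2 ^ (n + 2)) *
        Real.exp (-(japaneseBracket y / 2)) := by gcongr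
    _ = 2 ^ (n + 2) * (n + 2).factorial * (Real.exp ((1 + japaneseBracket y) / 2) *
        Real.exp (-(japaneseBracket y / 2))) := by ring
    _ = _ := by rw [h5]

/-- The constant in the bound for the integrals of logarithmic weights. -/
noncomputable def weightConst (q : ℝ) : ℝ :=
  ∫ y : ℝ, (1 + japaneseBracket y) ^ q * Real.exp (-(japaneseBracket y / 2))

theorem weightConst_nonneg (q : ℝ) : 0 ≤ weightConst q := by
  refine integral_nonneg fun y => ?_
  have := one_le_japaneseBracket y
  positivity

variable {S R : ℝ}

theorem logWeight_rpow_exp_le (hS : 3 ≤ S) (hR : 1 ≤ R) (hRS : R ≤ S) {q : ℝ} (hq : 0 ≤ q)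
    (x : ℝ) : logWeight S x ^ q * Real.exp (-(japaneseBracket (x / R) / 2)) ≤ Real.log S ^ q *
      ((1 + japaneseBracket (x / R)) ^ q * Real.exp (-(japaneseBracket (x / R) / 2))) := by
  have h1 := one_le_japaneseBracket (x / R)
  have h3 := one_le_log_of_three_le hS
  rw [← mul_assoc, ← Real.mul_rpow (by linarith) (by linarith)]
  have := one_le_logWeight hS x
  have := logWeight_le_log_mul hS hR hRS x
  gcongr

theorem integrable_logWeight_exp (hS : 3 ≤ S) (hR : 1 ≤ R) (hRS : R ≤ S) {q : ℝ} (hq : 0 ≤ q) :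
    Integrable fun x => logWeight S x ^ q * Real.exp (-(japaneseBracket (x / R) / 2)) := by
  have h := ((integrable_bracket_rpow_mul_exp q).comp_div (by linarith : R ≠ 0)).const_mul
    (Real.log S ^ q)
  refine h.mono' ?_ (Filter.Eventually.of_forall fun x => ?_)
  · exact ((continuous_logWeight_rpow hS q).mul (Real.continuous_exp.comp
      ((continuous_japaneseBracket.comp (by fun_prop)).div_const 2).neg)).aestronglyMeasurable
  · have := one_le_logWeight hS x
    rw [Real.norm_of_nonneg (by positivity)]
    exact logWeight_rpow_exp_le hS hR hRS hq x

theorem integral_logWeight_exp_le (hS : 3 ≤ S) (hR : 1 ≤ R) (hRS : R ≤ S) {q : ℝ} (hq : 0 ≤ q) :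
    ∫ x, logWeight S x ^ q * Real.exp (-(japaneseBracket (x / R) / 2)) ≤
      weightConst q * R * Real.log S ^ q := by
  have h := ((integrable_bracket_rpow_mul_exp q).comp_div (by linarith : R ≠ 0)).const_mul
    (Real.log S ^ q)
  refine (integral_mono (integrable_logWeight_exp hS hR hRS hq) h
    (logWeight_rpow_exp_le hS hR hRS hq)).trans (le_of_eq ?_)
  rw [integral_const_mul, Measure.integral_comp_div
    (fun y => (1 + japaneseBracket y) ^ q * Real.exp (-(japaneseBracket y / 2))) R,
    abs_of_pos (by linarith), smul_eq_mul]
  unfold weightConst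
  ring

theorem logWeight_rpow_sigma_le (hS : 3 ≤ S) (q x : ℝ) : logWeight S x ^ q * sigmaWeight R x ≤
    logWeight S x ^ q * Real.exp (-(japaneseBracket (x / R) / 2)) := by
  have := one_le_logWeight hS x
  have := sigmaWeight_le_exp_half R x
  gcongr

theorem integrable_logWeight_sigma (hS : 3 ≤ S) (hR : 1 ≤ R) (hRS : R ≤ S) {q : ℝ} (hq : 0 ≤ q) :
    Integrable fun x => logWeight S x ^ q * sigmaWeight R x := by
  refine (integrable_logWeight_exp hS hR hRS hq).mono'
    ((continuous_logWeight_rpow hS q).mul (continuous_sigmaWeight R)).aestronglyMeasurable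
    (Filter.Eventually.of_forall fun x => ?_)
  have := one_le_logWeight hS x
  have := sigmaWeight_pos R x
  rw [Real.norm_of_nonneg (by positivity)]
  exact logWeight_rpow_sigma_le hS q x

theorem integral_logWeight_sigma_le (hS : 3 ≤ S) (hR : 1 ≤ R) (hRS : R ≤ S) {q : ℝ}
    (hq : 0 ≤ q) :
    ∫ x, logWeight S x ^ q * sigmaWeight R x ≤ weightConst q * R * Real.log S ^ q :=
  (integral_mono (integrable_logWeight_sigma hS hR hRS hq) (integrable_logWeight_exp hS hR hRS hq)
    (logWeight_rpow_sigma_le hS q)).trans (integral_logWeight_exp_le hS hR hRS hq)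

theorem integrable_sigmaWeight (hR : 0 < R) : Integrable (sigmaWeight R) := by
  have h := (integrable_bracket_rpow_mul_exp 0).comp_div hR.ne'
  refine h.mono' (continuous_sigmaWeight R).aestronglyMeasurable
    (Filter.Eventually.of_forall fun x => ?_)
  rw [Real.norm_of_nonneg (sigmaWeight_pos R x).le, Real.rpow_zero, one_mul]
  exact sigmaWeight_le_exp_half R x

/-- Where `⟨x/R⟩ ≤ S` the weight is at most `3 log S`; elsewhere `exp(⟨x/R⟩/2) ≥ S²/8`. Thus the
coefficient of the mass is exactly of order `(log S)^q`, as the exponential in the final bound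
requires, and the tail becomes an error of size `S⁻²`. -/
theorem logWeight_rpow_le_log_add (hS : 3 ≤ S) (hR : 1 ≤ R) (hRS : R ≤ S) {q : ℝ} (hq : 0 ≤ q)
    (x : ℝ) : logWeight S x ^ q ≤ 3 ^ q * Real.log S ^ q +
      8 * (S ^ 2)⁻¹ * (logWeight S x ^ q * Real.exp (japaneseBracket (x / R) / 2)) := by
  have h1 := one_le_japaneseBracket (x / R)
  have h3 := one_le_log_of_three_le hS
  have h4 := one_le_logWeight hS x
  by_cases h : japaneseBracket (x / R) ≤ S
  · have h5 : logWeight S x ≤ 3 * Real.log S := by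
      refine (logWeight_le_log_add hS hR hRS x).trans ?_
      have : Real.log (1 + japaneseBracket (x / R)) ≤ Real.log (S * S) :=
        Real.log_le_log (by linarith) (by nlinarith)
      rw [Real.log_mul (by linarith) (by linarith)] at this
      linarith
    have h6 : logWeight S x ^ q ≤ 3 ^ q * Real.log S ^ q := by
      rw [← Real.mul_rpow (by norm_num) (by linarith)]
      exact Real.rpow_le_rpow (by linarith) h5 hq
    have : 0 ≤ 8 * (S ^ 2)⁻¹ * (logWeight S x ^ q * Real.exp (japaneseBracket (x / R) / 2)) := by
      positivity
    linarith
  · push Not at h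
    have h5 : S ^ 2 / 8 ≤ Real.exp (japaneseBracket (x / R) / 2) := by
      have h6 := Real.quadratic_le_exp_of_nonneg (by positivity : 0 ≤ japaneseBracket (x / R) / 2)
      nlinarith
    have h7 : 1 ≤ 8 * (S ^ 2)⁻¹ * Real.exp (japaneseBracket (x / R) / 2) := by
      rw [mul_right_comm, ← div_eq_mul_inv, le_div_iff₀ (by positivity)]
      linarith
    have h8 : 0 ≤ 3 ^ q * Real.log S ^ q := by positivity
    have h9 : 0 ≤ logWeight S x ^ q := by positivity
    nlinarith

end Sigma

/-! ### Schur test and weighted `L²` bounds for convolutions -/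

theorem integrable_polyKernel_mul_snd {R : ℝ} (hR : 0 < R) {h : ℝ → ℝ} (hh : Integrable h) :
    Integrable (fun p : ℝ × ℝ => polyKernel 2 R (p.1 - p.2) * h p.2) (volume.prod volume) := by
  have := Integrable.convolution_integrand (ContinuousLinearMap.mul ℝ ℝ) hh
    (integrable_polyKernel le_rfl hR) (μ := volume) (ν := volume)
  refine this.congr (Filter.Eventually.of_forall fun p => ?_)
  simp [mul_comm]

theorem integrable_polyKernel_mul_fst {R : ℝ} (hR : 0 < R) {h : ℝ → ℝ} (hh : Integrable h) :
    Integrable (fun p : ℝ × ℝ => polyKernel 2 R (p.1 - p.2) * h p.1) (volume.prod volume) := by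
  refine (integrable_polyKernel_mul_snd hR hh).swap.congr (Filter.Eventually.of_forall fun p => ?_)
  simp [Function.comp, polyKernel_sub_comm 2 R p.2 p.1]

/-- A Schur test: functions of two variables dominated by `Φ(x-y)(h₁(x) + h₂(y))`. -/
theorem integrable_of_le_polyKernel {E : Type*} [NormedAddCommGroup E] {R : ℝ} (hR : 0 < R)
    {F : ℝ × ℝ → E} (hF : AEStronglyMeasurable F (volume.prod volume))
    {h₁ h₂ : ℝ → ℝ} (i₁ : Integrable h₁) (i₂ : Integrable h₂)
    (hle : ∀ x y, ‖F (x, y)‖ ≤ polyKernel 2 R (x - y) * (h₁ x + h₂ y)) :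
    Integrable F (volume.prod volume) := by
  refine ((integrable_polyKernel_mul_fst hR i₁).add (integrable_polyKernel_mul_snd hR i₂)).mono'
    hF (Filter.Eventually.of_forall fun p => ?_)
  rw [Pi.add_apply, ← mul_add]
  exact hle p.1 p.2

theorem integral_prod_le_of_le_polyKernel {R : ℝ} (hR : 0 < R) {F : ℝ × ℝ → ℝ}
    (hF : AEStronglyMeasurable F (volume.prod volume))
    {h₁ h₂ : ℝ → ℝ} (i₁ : Integrable h₁) (i₂ : Integrable h₂)
    (hle : ∀ x y, |F (x, y)| ≤ polyKernel 2 R (x - y) * (h₁ x + h₂ y)) :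
    ∫ p, F p ∂(volume.prod volume) ≤ polyMass * ((∫ x, h₁ x) + ∫ y, h₂ y) := by
  have hi := integrable_of_le_polyKernel hR hF i₁ i₂ hle
  have j₁ := integrable_polyKernel_mul_fst hR i₁
  have j₂ := integrable_polyKernel_mul_snd hR i₂
  refine (integral_mono hi (j₁.add j₂) fun p => ?_).trans (le_of_eq ?_)
  · rw [Pi.add_apply, ← mul_add]
    exact (le_abs_self _).trans (hle p.1 p.2)
  · rw [integral_add' j₁ j₂, mul_add]
    congr 1
    · rw [integral_prod _ j₁]
      simp_rw [integral_mul_const, integral_sub_left_eq_self (polyKernel 2 R)]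
      rw [integral_const_mul, integral_polyKernel_two hR]
    · rw [integral_prod_symm _ j₂]
      simp_rw [integral_mul_const, integral_sub_right_eq_self (polyKernel 2 R)]
      rw [integral_const_mul, integral_polyKernel_two hR]

theorem norm_integral_le_polyMass {E : Type*} [NormedAddCommGroup E] [NormedSpace ℝ E] {R : ℝ}
    (hR : 0 < R) {F : ℝ → E} {B x : ℝ} (h : ∀ y, ‖F y‖ ≤ B * polyKernel 2 R (x - y)) :
    ‖∫ y, F y‖ ≤ B * polyMass := by
  refine (norm_integral_le_of_norm_le
    (((integrable_polyKernel le_rfl hR).comp_sub_left x).const_mul B)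
    (Filter.Eventually.of_forall h)).trans (le_of_eq ?_)
  rw [integral_const_mul, integral_sub_left_eq_self (polyKernel 2 R), integral_polyKernel_two hR]

/-- Cauchy-Schwarz for convolution with a majorant. -/
theorem sq_kconv_polyKernel_le {m : ℕ} (hm : 2 ≤ m) {R : ℝ} (hR : 0 < R) {f : ℝ → ℝ}
    (hf : Continuous f) {B : ℝ} (hB : ∀ y, |f y| ≤ B) (x : ℝ) :
    kconv (polyKernel m R) f x ^ 2 ≤
      polyMass * kconv (polyKernel m R) (fun y => f y ^ 2) x := by
  have hk := integrable_polyKernel hm hR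
  set c := ∫ z, polyKernel m R z with hc
  have hcle : c ≤ polyMass := integral_polyKernel_le hm hR
  have hc0 : 0 ≤ c := integral_nonneg (polyKernel_nonneg m hR.le)
  set A := kconv (polyKernel m R) f x with hA
  set Q := kconv (polyKernel m R) (fun y => f y ^ 2) x with hQ
  have hB2 : ∀ y, ‖f y ^ 2‖ ≤ B ^ 2 := fun y => by
    rw [norm_pow, Real.norm_eq_abs]
    exact pow_le_pow_left₀ (abs_nonneg _) (hB y) 2
  have i1 := integrable_kconv hk hf (B := B) hB x
  have i2 : Integrable (fun y => polyKernel m R (x - y) • f y ^ 2) :=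
    integrable_kconv hk (hf.pow 2) hB2 x
  have i0 := hk.comp_sub_left x
  -- The quadratic is `∫ Φ(x - y) (f(y) - μ)² dy`, where `Φ` is the majorant; its discriminant gives
  -- Cauchy-Schwarz.
  have key : ∀ μ : ℝ, 0 ≤ c * (μ * μ) + (-2 * A) * μ + Q := by
    intro μ
    have h1 : 0 ≤ ∫ y, polyKernel m R (x - y) • (f y - μ) ^ 2 :=
      integral_nonneg fun y => smul_nonneg (polyKernel_nonneg m hR.le _) (sq_nonneg _)
    have h2 : (fun y => polyKernel m R (x - y) • (f y - μ) ^ 2) = fun y =>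
        polyKernel m R (x - y) • f y ^ 2 + ((-2 * μ) * (polyKernel m R (x - y) • f y) +
          (μ * μ) * polyKernel m R (x - y)) := by
      funext y
      simp only [smul_eq_mul]
      ring
    have h3 : ∫ y, polyKernel m R (x - y) = c := integral_sub_left_eq_self (polyKernel m R) volume x
    have i3 : Integrable (fun y => (-2 * μ) * (polyKernel m R (x - y) • f y) +
        (μ * μ) * polyKernel m R (x - y)) := (i1.const_mul _).add (i0.const_mul _)
    rw [h2, integral_add i2 i3, integral_add (i1.const_mul _) (i0.const_mul _),
      integral_const_mul, integral_const_mul, h3] at h1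
    change 0 ≤ Q + (-2 * μ * A + μ * μ * c) at h1
    linarith
  have h := discrim_le_zero key
  have hQ0 : 0 ≤ Q := by have := key 0; simpa using this
  unfold discrim at h
  nlinarith

/-- Convolution with a polynomially decaying kernel is bounded on `L²(σ_R)`, up to a
small error for functions of logarithmic growth. -/
theorem integral_sq_kconv_sigma_le {m : ℕ} (hm : 5 ≤ m) {S R : ℝ} (hS : 3 ≤ S) (hR : 1 ≤ R)
    (hRS : R ≤ S) {f : ℝ → ℂ} (hf : Continuous f) {B₀ B : ℝ} (hB₀ : ∀ y, ‖f y‖ ≤ B₀)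
    (hB : ∀ y, ‖f y‖ ≤ B * logWeight S y) :
    ∫ x, kconv (polyKernel m R) (fun y => ‖f y‖) x ^ 2 * sigmaWeight R x ≤
      polyMass ^ 2 * ((∫ x, ‖f x‖ ^ 2 * sigmaWeight R x) +
        2 * weightConst 2 * (B ^ 2 * R⁻¹ * Real.log S ^ (2 : ℝ))) := by
  have hR0 : 0 < R := by linarith
  have hk := integrable_polyKernel (by omega : 2 ≤ m) hR0
  have hfn : Continuous fun y => ‖f y‖ := hf.norm
  have hB₀' : ∀ y, |‖f y‖| ≤ B₀ := fun y => by rw [abs_norm]; exact hB₀ y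
  have hB₀2 : ∀ y, ‖‖f y‖ ^ 2‖ ≤ B₀ ^ 2 := fun y => by
    rw [norm_pow, norm_norm]
    exact pow_le_pow_left₀ (norm_nonneg _) (hB₀ y) 2
  have hσ := integrable_sigmaWeight hR0
  have hfσ : Integrable fun x => ‖f x‖ ^ 2 * sigmaWeight R x :=
    hσ.bdd_mul (c := B₀ ^ 2) (hfn.pow 2).aestronglyMeasurable
      (Filter.Eventually.of_forall hB₀2)
  have hLσ := integrable_logWeight_sigma hS hR hRS (q := 2) (by norm_num)
  set h₁ : ℝ → ℝ := fun x => (B ^ 2 * (R⁻¹) ^ 2) * (logWeight S x ^ (2 : ℝ) * sigmaWeight R x)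
    with hh₁
  have i₁ : Integrable h₁ := hLσ.const_mul _
  set h₂ : ℝ → ℝ := fun x => ‖f x‖ ^ 2 * sigmaWeight R x + h₁ x with hh₂
  have i₂ : Integrable h₂ := hfσ.add i₁
  set F : ℝ × ℝ → ℝ := fun p => polyKernel m R (p.1 - p.2) * ‖f p.2‖ ^ 2 * sigmaWeight R p.1
    with hF
  have hFc : Continuous F := by
    refine Continuous.mul (Continuous.mul ?_ ?_) ?_
    · exact (continuous_polyKernel m hR0.le).comp (by fun_prop)
    · fun_prop
    · exact (continuous_sigmaWeight R).comp continuous_fst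
  have hF0 : ∀ p, 0 ≤ F p := fun p => by
    have := polyKernel_nonneg m hR0.le (p.1 - p.2)
    have := (sigmaWeight_pos R p.1).le
    positivity
  -- Moving `σ_R` from `x` to `y` produces a remainder with the factor `R⁻² (1 + R|x - y|)`, in
  -- which `f` is replaced by its logarithmic bound. One spare power pays for this factor and two
  -- for the squared logarithm, whence `m ≥ 2 + 3`.
  have hle : ∀ x y, |F (x, y)| ≤ polyKernel 2 R (x - y) * (h₁ x + h₂ y) := by
    intro x y
    rw [abs_of_nonneg (hF0 _)]
    simp only [hF, hh₁, hh₂]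
    set Φ := polyKernel 2 R (x - y) with hΦ
    have hΦ0 : 0 ≤ Φ := polyKernel_nonneg 2 hR0.le _
    have ha : 1 ≤ 1 + R * |x - y| := by
      have : 0 ≤ R * |x - y| := by positivity
      linarith
    set a := 1 + R * |x - y| with haa
    have hΦ5 : polyKernel m R (x - y) * a ^ 3 ≤ Φ := by
      have h1 := polyKernel_anti hm hR0.le (x - y)
      have h2 := polyKernel_mul_pow 2 3 hR0.le (x - y)
      rw [hΦ, ← h2]
      exact mul_le_mul_of_nonneg_right h1 (by positivity)
    have hΦm := polyKernel_nonneg m hR0.le (x - y)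
    set Φm := polyKernel m R (x - y)
    have hσx := sigmaWeight_pos R x
    have hσy := sigmaWeight_pos R y
    have hσxy : sigmaWeight R x ≤ sigmaWeight R y +
        (R⁻¹) ^ 2 * a * (sigmaWeight R x + sigmaWeight R y) := by
      have h1 := (le_abs_self _).trans (abs_sigmaWeight_sub_le hR0 x y)
      have h2 : |x - y| / R ≤ (R⁻¹) ^ 2 * a := by
        rw [haa, inv_pow, div_eq_mul_inv]
        have : |x - y| * R⁻¹ = (R ^ 2)⁻¹ * (R * |x - y|) := by field_simp
        rw [this]
        have : 0 < (R ^ 2)⁻¹ := by positivity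
        nlinarith
      have h3 : |x - y| / R * (sigmaWeight R x + sigmaWeight R y) ≤
          (R⁻¹) ^ 2 * a * (sigmaWeight R x + sigmaWeight R y) := by gcongr
      linarith
    have hLy := one_le_logWeight hS y
    have hLx := one_le_logWeight hS x
    have hL : logWeight S y ≤ logWeight S x * a := by
      refine (logWeight_le_mul hS x y).trans ?_
      rw [haa]
      have := abs_nonneg (x - y)
      gcongr
      nlinarith
    have hfy : ‖f y‖ ^ 2 ≤ B ^ 2 * logWeight S y ^ 2 := by
      rw [← mul_pow]
      exact pow_le_pow_left₀ (norm_nonneg _) (hB y) 2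
    have hLL : logWeight S y ^ 2 ≤ logWeight S x ^ 2 * a ^ 2 := by
      rw [← mul_pow]
      exact pow_le_pow_left₀ (by linarith) hL 2
    rw [Real.rpow_two, Real.rpow_two]
    have hr : 0 ≤ (R⁻¹) ^ 2 := by positivity
    have hΦ1 : Φm ≤ Φ := by
      have : 1 ≤ a ^ 3 := one_le_pow₀ ha
      nlinarith
    have hΦa : Φm * a ≤ Φ := by
      have : a ≤ a ^ 3 := le_self_pow₀ ha (by norm_num)
      nlinarith
    calc Φm * ‖f y‖ ^ 2 * sigmaWeight R x
        ≤ Φm * ‖f y‖ ^ 2 * (sigmaWeight R y +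
          (R⁻¹) ^ 2 * a * (sigmaWeight R x + sigmaWeight R y)) := by gcongr
      _ = Φm * (‖f y‖ ^ 2 * sigmaWeight R y) + (R⁻¹) ^ 2 * (Φm * a) *
          (‖f y‖ ^ 2 * sigmaWeight R x) + (R⁻¹) ^ 2 * (Φm * a) * (‖f y‖ ^ 2 * sigmaWeight R y) := by
          ring
      _ ≤ Φm * (‖f y‖ ^ 2 * sigmaWeight R y) + (R⁻¹) ^ 2 * (Φm * a) *
          (B ^ 2 * (logWeight S x ^ 2 * a ^ 2) * sigmaWeight R x) + (R⁻¹) ^ 2 * (Φm * a) *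
          (B ^ 2 * logWeight S y ^ 2 * sigmaWeight R y) := by
          have : ‖f y‖ ^ 2 ≤ B ^ 2 * (logWeight S x ^ 2 * a ^ 2) :=
            hfy.trans (mul_le_mul_of_nonneg_left hLL (sq_nonneg B))
          gcongr
      _ = Φm * (‖f y‖ ^ 2 * sigmaWeight R y) + (Φm * a ^ 3) *
          (B ^ 2 * (R⁻¹) ^ 2 * (logWeight S x ^ 2 * sigmaWeight R x)) + (Φm * a) *
          (B ^ 2 * (R⁻¹) ^ 2 * (logWeight S y ^ 2 * sigmaWeight R y)) := by ring
      _ ≤ Φ * (‖f y‖ ^ 2 * sigmaWeight R y) + Φ *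
          (B ^ 2 * (R⁻¹) ^ 2 * (logWeight S x ^ 2 * sigmaWeight R x)) + Φ *
          (B ^ 2 * (R⁻¹) ^ 2 * (logWeight S y ^ 2 * sigmaWeight R y)) := by gcongr
      _ = _ := by ring
  have hFi := integrable_of_le_polyKernel hR0 hFc.aestronglyMeasurable i₁ i₂
    (fun x y => by rw [Real.norm_eq_abs]; exact hle x y)
  have hFle := integral_prod_le_of_le_polyKernel hR0 hFc.aestronglyMeasurable i₁ i₂ hle
  have hpt : ∀ x, kconv (polyKernel m R) (fun y => ‖f y‖) x ^ 2 * sigmaWeight R x ≤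
      polyMass * ∫ y, F (x, y) := by
    intro x
    have h1 := sq_kconv_polyKernel_le (by omega : 2 ≤ m) hR0 hfn hB₀' x
    have h2 : ∫ y, F (x, y) = kconv (polyKernel m R) (fun y => ‖f y‖ ^ 2) x * sigmaWeight R x := by
      simp only [hF]
      rw [integral_mul_const]
      rfl
    rw [h2, ← mul_assoc]
    exact mul_le_mul_of_nonneg_right h1 (sigmaWeight_pos R x).le
  have hstep : ∫ x, kconv (polyKernel m R) (fun y => ‖f y‖) x ^ 2 * sigmaWeight R x ≤
      polyMass * ∫ p, F p ∂(volume.prod volume) := by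
    rw [integral_prod _ hFi, ← integral_const_mul]
    refine integral_mono_of_nonneg (Filter.Eventually.of_forall fun x => ?_)
      (hFi.integral_prod_left.const_mul _) (Filter.Eventually.of_forall hpt)
    have := (sigmaWeight_pos R x).le
    simp only [Pi.zero_apply]
    positivity
  refine hstep.trans ?_
  have h1 : ∫ x, h₁ x ≤ weightConst 2 * (B ^ 2 * R⁻¹ * Real.log S ^ (2 : ℝ)) := by
    simp only [hh₁]
    rw [integral_const_mul]
    calc (B ^ 2 * (R⁻¹) ^ 2) * ∫ x, logWeight S x ^ (2 : ℝ) * sigmaWeight R x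
        ≤ (B ^ 2 * (R⁻¹) ^ 2) * (weightConst 2 * R * Real.log S ^ (2 : ℝ)) := by
          gcongr
          exact integral_logWeight_sigma_le hS hR hRS (by norm_num)
      _ = _ := by field_simp
  have h2 : ∫ y, h₂ y = (∫ y, ‖f y‖ ^ 2 * sigmaWeight R y) + ∫ x, h₁ x := integral_add hfσ i₁
  have hpm := polyMass_nonneg
  calc polyMass * ∫ p, F p ∂(volume.prod volume)
      ≤ polyMass * (polyMass * ((∫ x, h₁ x) + ∫ y, h₂ y)) := by gcongr
    _ ≤ polyMass * (polyMass * ((∫ x, ‖f x‖ ^ 2 * sigmaWeight R x) +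
        2 * weightConst 2 * (B ^ 2 * R⁻¹ * Real.log S ^ (2 : ℝ)))) := by
        refine mul_le_mul_of_nonneg_left (mul_le_mul_of_nonneg_left ?_ hpm) hpm
        rw [h2]
        linarith
    _ = _ := by ring

/-! ### The power nonlinearity and its averaged differential -/

/-- Bernoulli's inequality for `s / r`. -/
theorem rpow_sub_rpow_le {q r s : ℝ} (hq : 1 ≤ q) (hs : 0 ≤ s) (hsr : s ≤ r) :
    r ^ q - s ^ q ≤ q * r ^ (q - 1) * (r - s) := by
  rcases (hs.trans hsr).eq_or_lt with h | h
  · have : s = 0 := by linarith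
    subst h; subst this; simp
  · have h1 := one_add_mul_self_le_rpow_one_add (s := s / r - 1) (by
      have : 0 ≤ s / r := by positivity
      linarith) hq
    rw [add_sub_cancel, Real.div_rpow hs h.le, le_div_iff₀ (by positivity)] at h1
    have h2 : r ^ q = r ^ (q - 1) * r := by
      rw [← Real.rpow_add_one h.ne']; congr 1; ring
    have h3 : (1 + q * (s / r - 1)) * r ^ q = r ^ q - q * r ^ (q - 1) * (r - s) := by
      rw [h2]; field_simp; ring
    linarith

/-- The power nonlinearity `|z|^{p-1} z`. -/
noncomputable def powNonlin (p : ℝ) (z : ℂ) : ℂ := ((‖z‖ ^ (p - 1) : ℝ) : ℂ) * z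

/-- The real differential of the power nonlinearity. -/
noncomputable def powNonlinDeriv (p : ℝ) (z : ℂ) : ℂ →L[ℝ] ℂ :=
  ‖z‖ ^ (p - 1) • ContinuousLinearMap.id ℝ ℂ +
    (((p - 1) * ‖z‖ ^ (p - 3)) • innerSL ℝ z).smulRight z

section Nonlin
variable {p : ℝ}

theorem continuous_powNonlin (hp : 3 ≤ p) : Continuous (powNonlin p) := by
  unfold powNonlin
  refine Continuous.mul (Complex.continuous_ofReal.comp ?_) continuous_id
  exact continuous_norm.rpow_const fun z => Or.inr (by linarith)

theorem norm_powNonlin (p : ℝ) (z : ℂ) : ‖powNonlin p z‖ = ‖z‖ ^ (p - 1) * ‖z‖ := by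
  unfold powNonlin
  rw [norm_mul, Complex.norm_real, Real.norm_of_nonneg (by positivity)]

theorem hasFDerivAt_powNonlin (hp : 3 ≤ p) (z : ℂ) :
    HasFDerivAt (powNonlin p) (powNonlinDeriv p z) z := by
  have h1 := (hasFDerivAt_norm_rpow z (by linarith : 1 < p - 1)).smul (hasFDerivAt_id (𝕜 := ℝ) z)
  have h2 : powNonlin p = fun z : ℂ => ‖z‖ ^ (p - 1) • id z := by
    funext z
    rw [powNonlin, Complex.real_smul, id]
  rw [h2]
  refine h1.congr_fderiv ?_
  unfold powNonlinDeriv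
  have : p - 1 - 2 = p - 3 := by ring
  rw [this]
  rfl

theorem continuous_powNonlinDeriv (hp : 3 ≤ p) : Continuous (powNonlinDeriv p) := by
  unfold powNonlinDeriv
  have h1 : Continuous fun z : ℂ => ‖z‖ ^ (p - 1) :=
    continuous_norm.rpow_const fun z => Or.inr (by linarith)
  have h2 : Continuous fun z : ℂ => ‖z‖ ^ (p - 3) :=
    continuous_norm.rpow_const fun z => Or.inr (by linarith)
  have h3 : Continuous fun z : ℂ => ((p - 1) * ‖z‖ ^ (p - 3)) • innerSL ℝ z :=
    (continuous_const.mul h2).smul (innerSL ℝ).continuous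
  refine (h1.smul continuous_const).add ?_
  exact ((ContinuousLinearMap.smulRightL ℝ ℂ ℂ).continuous.comp h3).clm_apply continuous_id

theorem powNonlinDeriv_apply (p : ℝ) (z h : ℂ) : powNonlinDeriv p z h =
    ‖z‖ ^ (p - 1) • h + ((p - 1) * ‖z‖ ^ (p - 3) * inner ℝ z h) • z := by
  simp [powNonlinDeriv]

theorem rpow_sub_three_mul_sq (hp : 3 ≤ p) {r : ℝ} (hr : 0 ≤ r) :
    r ^ (p - 3) * r ^ 2 = r ^ (p - 1) := by
  rw [← Real.rpow_two, ← Real.rpow_add_of_nonneg hr (by linarith) (by norm_num)]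
  congr 1; ring

theorem rpow_sub_three_mul (hp : 3 ≤ p) {r : ℝ} (hr : 0 ≤ r) :
    r ^ (p - 3) * r = r ^ (p - 2) := by
  nth_rewrite 2 [← Real.rpow_one r]
  rw [← Real.rpow_add_of_nonneg hr (by linarith) (by norm_num)]
  congr 1; ring

theorem norm_powNonlinDeriv_le (hp : 3 ≤ p) {z : ℂ} {M : ℝ} (hz : ‖z‖ ≤ M) :
    ‖powNonlinDeriv p z‖ ≤ p * M ^ (p - 1) := by
  have hM : 0 ≤ M := (norm_nonneg z).trans hz
  refine ContinuousLinearMap.opNorm_le_bound _ (by positivity) fun h => ?_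
  rw [powNonlinDeriv_apply]
  refine (norm_add_le _ _).trans ?_
  have hr := norm_nonneg z
  have h1 : |inner ℝ z h| ≤ ‖z‖ * ‖h‖ := abs_real_inner_le_norm z h
  have h2 : ‖z‖ ^ (p - 1) ≤ M ^ (p - 1) := Real.rpow_le_rpow hr hz (by linarith)
  have hp1 : 0 ≤ p - 1 := by linarith
  rw [norm_smul, norm_smul, Real.norm_of_nonneg (by positivity), Real.norm_eq_abs, abs_mul,
    abs_of_nonneg (by positivity : 0 ≤ (p - 1) * ‖z‖ ^ (p - 3))]
  calc ‖z‖ ^ (p - 1) * ‖h‖ + (p - 1) * ‖z‖ ^ (p - 3) * |inner ℝ z h| * ‖z‖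
      ≤ ‖z‖ ^ (p - 1) * ‖h‖ + (p - 1) * ‖z‖ ^ (p - 3) * (‖z‖ * ‖h‖) * ‖z‖ := by gcongr
    _ = ‖z‖ ^ (p - 1) * ‖h‖ + (p - 1) * (‖z‖ ^ (p - 3) * ‖z‖ ^ 2) * ‖h‖ := by ring
    _ = p * ‖z‖ ^ (p - 1) * ‖h‖ := by rw [rpow_sub_three_mul_sq hp hr]; ring
    _ ≤ _ := by gcongr

theorem norm_powNonlinDeriv_sub_le (hp : 3 ≤ p) {z z' : ℂ} {M : ℝ} (hz : ‖z‖ ≤ M)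
    (hz' : ‖z'‖ ≤ M) :
    ‖powNonlinDeriv p z - powNonlinDeriv p z'‖ ≤ (p - 1) * (p + 2) * M ^ (p - 2) * ‖z - z'‖ := by
  wlog hzz : ‖z'‖ ≤ ‖z‖ generalizing z z'
  · rw [norm_sub_rev, norm_sub_rev z]
    exact this hz' hz (le_of_not_ge hzz)
  have hM : 0 ≤ M := (norm_nonneg z).trans hz
  have hp1 : 0 ≤ p - 1 := by linarith
  refine ContinuousLinearMap.opNorm_le_bound _ (by positivity) fun h => ?_
  rw [sub_apply, powNonlinDeriv_apply, powNonlinDeriv_apply]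
  have hr := norm_nonneg z
  have hs := norm_nonneg z'
  set r := ‖z‖ with hrdef
  set s := ‖z'‖ with hsdef
  set d := ‖z - z'‖ with hd
  have hd0 : 0 ≤ d := norm_nonneg _
  have hrs : r - s ≤ d := norm_sub_norm_le z z'
  have e : r ^ (p - 1) • h + ((p - 1) * r ^ (p - 3) * inner ℝ z h) • z -
      (s ^ (p - 1) • h + ((p - 1) * s ^ (p - 3) * inner ℝ z' h) • z') =
      (r ^ (p - 1) - s ^ (p - 1)) • h + (p - 1) • ((r ^ (p - 3) * inner ℝ (z - z') h) • z +
        (r ^ (p - 3) * inner ℝ z' h) • (z - z') +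
        ((r ^ (p - 3) - s ^ (p - 3)) * inner ℝ z' h) • z') := by
    rw [inner_sub_left]
    module
  have hk1 : r ^ (p - 1) - s ^ (p - 1) ≤ (p - 1) * r ^ (p - 2) * d := by
    have := rpow_sub_rpow_le (by linarith : 1 ≤ p - 1) hs hzz
    rw [show p - 1 - 1 = p - 2 by ring] at this
    refine this.trans ?_
    gcongr
  have hk0 : s ^ (p - 1) ≤ r ^ (p - 1) := Real.rpow_le_rpow hs hzz hp1
  have hk2 : s ^ (p - 3) ≤ r ^ (p - 3) := Real.rpow_le_rpow hs hzz (by linarith)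
  -- The exponent `p - 3` may be below `1`, where a Lipschitz bound for the power fails. The factor
  -- `s²`, supplied by the two occurrences of `z'`, raises the exponent to `p - 1 ≥ 2`.
  have hk3 : (r ^ (p - 3) - s ^ (p - 3)) * s ^ 2 ≤ r ^ (p - 1) - s ^ (p - 1) := by
    rw [sub_mul, rpow_sub_three_mul_sq hp hs, ← rpow_sub_three_mul_sq hp hr]
    gcongr
  have hrM : r ^ (p - 2) ≤ M ^ (p - 2) := Real.rpow_le_rpow hr hz (by linarith)
  have hi1 : |inner ℝ (z - z') h| ≤ d * ‖h‖ := abs_real_inner_le_norm _ _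
  have hi2 : |inner ℝ z' h| ≤ s * ‖h‖ := abs_real_inner_le_norm _ _
  have hr3 : 0 ≤ r ^ (p - 3) := by positivity
  have hr2 := rpow_sub_three_mul hp hr
  rw [e]
  calc _ ≤ (r ^ (p - 1) - s ^ (p - 1)) * ‖h‖ + (p - 1) * (r ^ (p - 3) * |inner ℝ (z - z') h| * r +
        r ^ (p - 3) * |inner ℝ z' h| * d + (r ^ (p - 3) - s ^ (p - 3)) * |inner ℝ z' h| * s) := by
        refine (norm_add_le _ _).trans ?_
        rw [norm_smul, norm_smul, Real.norm_of_nonneg (by linarith), Real.norm_of_nonneg hp1]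
        gcongr
        refine (norm_add_le _ _).trans (add_le_add ((norm_add_le _ _).trans (add_le_add ?_ ?_)) ?_)
        · rw [norm_smul, Real.norm_eq_abs, abs_mul, abs_of_nonneg hr3]
        · rw [norm_smul, Real.norm_eq_abs, abs_mul, abs_of_nonneg hr3]
        · rw [norm_smul, Real.norm_eq_abs, abs_mul, abs_of_nonneg (by linarith)]
    _ ≤ (r ^ (p - 1) - s ^ (p - 1)) * ‖h‖ + (p - 1) * (r ^ (p - 3) * (d * ‖h‖) * r +
        r ^ (p - 3) * (s * ‖h‖) * d + (r ^ (p - 3) - s ^ (p - 3)) * (s * ‖h‖) * s) := by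
        have : 0 ≤ r ^ (p - 3) - s ^ (p - 3) := by linarith
        gcongr
    _ = ((r ^ (p - 1) - s ^ (p - 1)) + (p - 1) * (r ^ (p - 3) * r * d +
        r ^ (p - 3) * s * d + (r ^ (p - 3) - s ^ (p - 3)) * s ^ 2)) * ‖h‖ := by ring
    _ ≤ (((p - 1) * r ^ (p - 2) * d) + (p - 1) * (r ^ (p - 3) * r * d +
        r ^ (p - 3) * r * d + (p - 1) * r ^ (p - 2) * d)) * ‖h‖ := by
        have := hk3.trans hk1
        gcongr
    _ = (p - 1) * (p + 2) * r ^ (p - 2) * d * ‖h‖ := by rw [hr2]; ring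
    _ ≤ _ := by gcongr

/-- The averaged differential along the segment from `b` to `a`. -/
noncomputable def dividedDiff (p : ℝ) (a b : ℂ) : ℂ →L[ℝ] ℂ :=
  ∫ θ in (0 : ℝ)..1, powNonlinDeriv p (b + θ • (a - b))

theorem intervalIntegrable_powNonlinDeriv (hp : 3 ≤ p) (a b : ℂ) :
    IntervalIntegrable (fun θ : ℝ => powNonlinDeriv p (b + θ • (a - b))) volume 0 1 :=
  ((continuous_powNonlinDeriv hp).comp (by fun_prop)).intervalIntegrable 0 1

/-- The fundamental theorem of calculus along the segment. The resulting potential is only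
real-linear, so the pairing of `W` with `I * V W` need not cancel and is later bounded by the size
of `V`. -/
theorem powNonlin_sub (hp : 3 ≤ p) (a b : ℂ) :
    powNonlin p a - powNonlin p b = dividedDiff p a b (a - b) := by
  unfold dividedDiff
  rw [ContinuousLinearMap.intervalIntegral_apply (intervalIntegrable_powNonlinDeriv hp a b)]
  have hd : ∀ θ ∈ Set.uIcc (0 : ℝ) 1, HasDerivAt (fun θ : ℝ => powNonlin p (b + θ • (a - b)))
      (powNonlinDeriv p (b + θ • (a - b)) (a - b)) θ := by
    intro θ _
    have h1 : HasDerivAt (fun θ : ℝ => b + θ • (a - b)) (a - b) θ := by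
      simpa using ((hasDerivAt_id θ).smul_const (a - b)).const_add b
    exact (hasFDerivAt_powNonlin hp _).comp_hasDerivAt θ h1
  have hc : Continuous fun θ : ℝ => powNonlinDeriv p (b + θ • (a - b)) (a - b) :=
    ((continuous_powNonlinDeriv hp).comp (by fun_prop)).clm_apply continuous_const
  rw [intervalIntegral.integral_eq_sub_of_hasDerivAt hd (hc.intervalIntegrable 0 1)]
  simp

theorem norm_segment_le {a b : ℂ} {M θ : ℝ} (ha : ‖a‖ ≤ M) (hb : ‖b‖ ≤ M)
    (hθ : θ ∈ Set.uIoc (0 : ℝ) 1) : ‖b + θ • (a - b)‖ ≤ M := by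
  rw [Set.uIoc_of_le zero_le_one] at hθ
  have h1 : b + θ • (a - b) = (1 - θ) • b + θ • a := by module
  rw [h1]
  refine (norm_add_le _ _).trans ?_
  rw [norm_smul, norm_smul, Real.norm_of_nonneg (by linarith [hθ.2]),
    Real.norm_of_nonneg hθ.1.le]
  nlinarith [hθ.1, hθ.2]

theorem norm_dividedDiff_le (hp : 3 ≤ p) {a b : ℂ} {M : ℝ} (ha : ‖a‖ ≤ M) (hb : ‖b‖ ≤ M) :
    ‖dividedDiff p a b‖ ≤ p * M ^ (p - 1) := by
  refine (intervalIntegral.norm_integral_le_of_norm_le_const fun θ hθ =>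
    norm_powNonlinDeriv_le hp (norm_segment_le ha hb hθ)).trans (le_of_eq ?_)
  simp

theorem norm_dividedDiff_sub_le (hp : 3 ≤ p) {a b a' b' : ℂ} {M : ℝ} (ha : ‖a‖ ≤ M)
    (hb : ‖b‖ ≤ M) (ha' : ‖a'‖ ≤ M) (hb' : ‖b'‖ ≤ M) :
    ‖dividedDiff p a b - dividedDiff p a' b'‖ ≤
      (p - 1) * (p + 2) * M ^ (p - 2) * (‖a - a'‖ + ‖b - b'‖) := by
  have hM : 0 ≤ M := (norm_nonneg a).trans ha
  have hp1 : 0 ≤ p - 1 := by linarith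
  unfold dividedDiff
  rw [← intervalIntegral.integral_sub (intervalIntegrable_powNonlinDeriv hp a b)
    (intervalIntegrable_powNonlinDeriv hp a' b')]
  refine (intervalIntegral.norm_integral_le_of_norm_le_const
    (C := (p - 1) * (p + 2) * M ^ (p - 2) * (‖a - a'‖ + ‖b - b'‖)) fun θ hθ => ?_).trans
    (le_of_eq (by simp))
  refine (norm_powNonlinDeriv_sub_le hp (norm_segment_le ha hb hθ)
    (norm_segment_le ha' hb' hθ)).trans ?_
  gcongr
  rw [Set.uIoc_of_le zero_le_one] at hθ
  have h1 : b + θ • (a - b) - (b' + θ • (a' - b')) = (1 - θ) • (b - b') + θ • (a - a') := by module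
  rw [h1]
  refine (norm_add_le _ _).trans ?_
  rw [norm_smul, norm_smul, Real.norm_of_nonneg (by linarith [hθ.2]),
    Real.norm_of_nonneg hθ.1.le]
  nlinarith [hθ.1, hθ.2, norm_nonneg (a - a'), norm_nonneg (b - b')]

theorem continuous_dividedDiff_comp (hp : 3 ≤ p) {u v : ℝ → ℂ} (hu : Continuous u)
    (hv : Continuous v) : Continuous fun x => dividedDiff p (u x) (v x) := by
  unfold dividedDiff
  refine intervalIntegral.continuous_parametric_intervalIntegral_of_continuous' ?_ 0 1
  exact (continuous_powNonlinDeriv hp).comp (by fun_prop)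

end Nonlin

/-! ### Pointwise size and regularity at the scale `1/R` -/

section Growth

/-- Logarithmic growth is preserved with a constant uniform in `N ≥ 1`, since `n` spare powers of
the kernel absorb the ratio of the weights. -/
theorem norm_kconv_le_logWeight {h : ℝ → ℝ} {n : ℕ} {C : ℝ}
    (hC : ∀ x, |h x| ≤ C * polyKernel (2 + n) 1 x) {N S : ℝ} (hN : 1 ≤ N) (hS : 3 ≤ S) {q : ℝ}
    (hq : 0 ≤ q) (hqn : q ≤ n) {f : ℝ → ℂ} {B : ℝ} (hB0 : 0 ≤ B)
    (hB : ∀ y, ‖f y‖ ≤ B * logWeight S y ^ q) (x : ℝ) :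
    ‖kconv (scaledKernel h N) f x‖ ≤ C * polyMass * B * logWeight S x ^ q := by
  have hN0 : 0 < N := by linarith
  have hL := one_le_logWeight hS x
  have key : ∀ y, ‖scaledKernel h N (x - y) • f y‖ ≤
      (C * B * logWeight S x ^ q) * polyKernel 2 N (x - y) := by
    intro y
    rw [norm_smul, Real.norm_eq_abs]
    calc |scaledKernel h N (x - y)| * ‖f y‖
        ≤ (C * polyKernel (2 + n) N (x - y)) *
          (B * (logWeight S x ^ q * (1 + N * |x - y|) ^ n)) := by
          have h1 := abs_scaledKernel_le hC hN0 (x - y)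
          have h2 := (hB y).trans (mul_le_mul_of_nonneg_left
            (logWeight_rpow_le_mul hS hN hq hqn x y) hB0)
          exact mul_le_mul h1 h2 (norm_nonneg _) ((abs_nonneg _).trans h1)
      _ = (C * B * logWeight S x ^ q) *
          (polyKernel (2 + n) N (x - y) * (1 + N * |x - y|) ^ n) := by ring
      _ = _ := by rw [polyKernel_mul_pow 2 n hN0.le]
  refine (norm_integral_le_polyMass hN0 key).trans (le_of_eq (by ring))

/-- Bernstein's inequality: the derivative of the kernel costs `N`. One factor `1 + R|x - y|`
compares the weights between `x` and `y`, the other comes from `|x - y| ≤ R⁻¹ (1 + R|x - y|)`. -/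
theorem exists_kconv_lipschitz (g : 𝓢(ℝ, ℝ)) : ∃ C, 0 ≤ C ∧ ∀ N S R : ℝ, 1 ≤ N → 3 ≤ S →
    1 ≤ R → ∀ (f : ℝ → ℂ) (B₀ B : ℝ), 0 ≤ B → Continuous f → (∀ y, ‖f y‖ ≤ B₀) →
    (∀ y, ‖f y‖ ≤ B * logWeight S y ^ (1 / 2 : ℝ)) → ∀ x y,
    ‖kconv (scaledKernel g N) f x - kconv (scaledKernel g N) f y‖ ≤
      C * B * N * R⁻¹ * logWeight S x ^ (1 / 2 : ℝ) * (1 + R * |x - y|) ^ 2 := by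
  obtain ⟨C, hC0, hC⟩ := (SchwartzMap.derivCLM ℝ ℝ g).abs_le_polyKernel 3
  refine ⟨C * polyMass, mul_nonneg hC0 polyMass_nonneg, ?_⟩
  intro N S R hN hS hR f B₀ B hB0 hf hB₀ hB x y
  have hN0 : 0 < N := by linarith
  have hR0 : 0 < R := by linarith
  have hL := one_le_logWeight hS x
  have hpm := polyMass_nonneg
  set K := N * (C * polyMass * B * (logWeight S x ^ (1 / 2 : ℝ) * (1 + R * |x - y|))) with hK
  have hbd : ∀ z ∈ Set.uIcc x y,
      ‖(N : ℝ) • kconv (scaledKernel (SchwartzMap.derivCLM ℝ ℝ g) N) f z‖ ≤ K := by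
    intro z hz
    rw [norm_smul, Real.norm_of_nonneg hN0.le, hK]
    have h1 := norm_kconv_le_logWeight (n := 1) hC hN hS (q := 1 / 2) (by norm_num)
      (by norm_num) hB0 hB z
    have h2 := logWeight_rpow_le_mul (n := 1) hS hR (q := 1 / 2) (by norm_num) (by norm_num) x z
    have h3 : |x - z| ≤ |x - y| := by
      have := Set.abs_sub_left_of_mem_uIcc hz
      rw [abs_sub_comm x z, abs_sub_comm x y]
      exact this
    rw [pow_one] at h2
    have h4 : logWeight S z ^ (1 / 2 : ℝ) ≤ logWeight S x ^ (1 / 2 : ℝ) * (1 + R * |x - y|) := by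
      refine h2.trans ?_
      gcongr
    refine mul_le_mul_of_nonneg_left (h1.trans ?_) hN0.le
    gcongr
  have h := (convex_uIcc x y).norm_image_sub_le_of_norm_hasDerivWithin_le
    (fun z _ => (hasDerivAt_kconv_scaledKernel g hN0 hf hB₀ z).hasDerivWithinAt) hbd
    Set.right_mem_uIcc Set.left_mem_uIcc
  refine h.trans ?_
  rw [Real.norm_eq_abs, hK]
  have h5 : |x - y| ≤ R⁻¹ * (1 + R * |x - y|) := by
    rw [mul_add, inv_mul_cancel_left₀ hR0.ne']
    have : 0 < R⁻¹ := inv_pos.2 hR0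
    linarith
  calc N * (C * polyMass * B * (logWeight S x ^ (1 / 2 : ℝ) * (1 + R * |x - y|))) * |x - y|
      ≤ N * (C * polyMass * B * (logWeight S x ^ (1 / 2 : ℝ) * (1 + R * |x - y|))) *
        (R⁻¹ * (1 + R * |x - y|)) := by gcongr
    _ = _ := by ring

/-- The pointwise bounds which the good event imposes at a fixed time. -/
structure SliceBounds (g : 𝓢(ℝ, ℝ)) (p δ A S : ℝ) (u : ℝ → ℂ) : Prop where
  continuous : Continuous u
  bounded : ∃ B, ∀ x, ‖u x‖ ≤ B
  size : ∀ x, ‖u x‖ ≤ A * logWeight S x ^ (2 / (p + 3))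
  high : ∀ (k : ℕ) x, ‖u x - kconv (scaledKernel g (2 ^ k)) u x‖ ≤
    A * ((2 : ℝ) ^ k) ^ (δ - 1 / 2) * logWeight S x ^ (1 / 2 : ℝ)

theorem SliceBounds.size_half {g : 𝓢(ℝ, ℝ)} {p δ A S : ℝ} {u : ℝ → ℂ} (hp : 3 ≤ p) (hA : 0 ≤ A)
    (hS : 3 ≤ S) (h : SliceBounds g p δ A S u) (x : ℝ) :
    ‖u x‖ ≤ A * logWeight S x ^ (1 / 2 : ℝ) := by
  refine (h.size x).trans (mul_le_mul_of_nonneg_left (logWeight_rpow_le_rpow hS ?_ x) hA)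
  rw [div_le_div_iff₀ (by linarith) (by norm_num)]
  linarith

theorem rpow_le_of_comparable {N R l : ℝ} (hR : 0 < R) (h1 : R ≤ 4 * N) (h2 : N ≤ R) :
    N ^ l ≤ 4 ^ |l| * R ^ l := by
  have hN : 0 < N := by linarith
  rcases le_total 0 l with h | h
  · rw [abs_of_nonneg h]
    have h3 : N ^ l ≤ R ^ l := Real.rpow_le_rpow hN.le h2 h
    have h4 : (1 : ℝ) ≤ 4 ^ l := Real.one_le_rpow (by norm_num) h
    have h5 : 0 ≤ R ^ l := by positivity
    nlinarith
  · rw [abs_of_nonpos h]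
    have h3 : (4 * N) ^ l ≤ R ^ l := Real.rpow_le_rpow_of_nonpos hR h1 h
    rw [Real.mul_rpow (by norm_num) hN.le] at h3
    have h4 : (4 : ℝ) ^ (-l) * 4 ^ l = 1 := by
      rw [← Real.rpow_add (by norm_num)]; simp
    calc N ^ l = 4 ^ (-l) * (4 ^ l * N ^ l) := by rw [← mul_assoc, h4, one_mul]
      _ ≤ _ := by gcongr

/-- Regularity of a function whose high frequencies are small: `u` is essentially constant at
scale `R⁻¹`, up to the size of `P_{>R} u`. -/
theorem exists_increment_bound {ρ : ℝ → ℝ} (hρ : IsLPCutoff ρ) {g : 𝓢(ℝ, ℝ)}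
    (hg : IsLPProfile ρ g) {p δ : ℝ} (hp : 3 ≤ p) (hδ : 0 < δ) :
    ∃ C, 0 ≤ C ∧ ∀ (A S R : ℝ) (k : ℕ) (u : ℝ → ℂ), 0 ≤ A → 3 ≤ S → 1 ≤ R → R ≤ 4 * 2 ^ k →
      (2 : ℝ) ^ k ≤ R → SliceBounds g p δ A S u → ∀ x y, ‖u x - u y‖ ≤
        C * A * R ^ (δ - 1 / 2) * logWeight S x ^ (1 / 2 : ℝ) * (1 + R * |x - y|) ^ 2 := by
  obtain ⟨C₁, hC₁, hlip⟩ := exists_kconv_lipschitz g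
  have hμ : 0 < δ + 1 / 2 := by linarith
  have h2μ : 1 < (2 : ℝ) ^ (δ + 1 / 2) := Real.one_lt_rpow (by norm_num) hμ
  -- The Lipschitz constant of one dyadic block: the bracket adds the bounds for `P_{>2^j} u` and
  -- `P_{>2^{j+1}} u`, and `8` comes from the reproducing kernel at frequency `2^{j+3}`.
  set C₂ : ℝ := C₁ * (1 + 2 ^ (δ - 1 / 2)) * 8 with hC₂
  have hC₂0 : 0 ≤ C₂ := by positivity
  -- Chosen so that `C₃ + C₂ ≤ C₃ 2^{δ+1/2}`, which closes the induction.
  set C₃ : ℝ := C₁ + C₂ / (2 ^ (δ + 1 / 2) - 1) with hC₃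
  have hC₃1 : C₁ ≤ C₃ := by
    have : 0 ≤ C₂ / (2 ^ (δ + 1 / 2) - 1) := div_nonneg hC₂0 (by linarith)
    linarith
  have hC₃2 : C₂ ≤ C₃ * (2 ^ (δ + 1 / 2) - 1) := by
    rw [hC₃, add_mul, div_mul_cancel₀ _ (by linarith)]
    nlinarith
  refine ⟨C₃ + 2 * 4 ^ |δ - 1 / 2|, by positivity, ?_⟩
  intro A S R k u hA hS hR hRk hkR hu x y
  have hR0 : 0 < R := by linarith
  obtain ⟨B₀, hB₀⟩ := hu.bounded
  have hL := one_le_logWeight hS x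
  have ha : 1 ≤ 1 + R * |x - y| := by
    have : 0 ≤ R * |x - y| := by positivity
    linarith
  set E := R⁻¹ * logWeight S x ^ (1 / 2 : ℝ) * (1 + R * |x - y|) ^ 2 with hE
  have hE0 : 0 ≤ E := by positivity
  -- A block at frequency `2^j` has size `2^{j(δ-1/2)}` and hence Lipschitz constant `2^{j(δ+1/2)}`.
  -- As `δ + 1/2 > 0`, the geometric sum is dominated by its last term.
  have hlow : ∀ j : ℕ, ‖kconv (scaledKernel g (2 ^ j)) u x - kconv (scaledKernel g (2 ^ j)) u y‖ ≤
      C₃ * A * ((2 : ℝ) ^ j) ^ (δ + 1 / 2) * E := by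
    intro j
    induction j with
    | zero =>
      have := hlip 1 S R le_rfl hS hR u B₀ A hA hu.continuous hB₀ (hu.size_half hp hA hS) x y
      simp only [pow_zero, Real.one_rpow, mul_one] at this ⊢
      refine this.trans ?_
      rw [show C₁ * A * R⁻¹ * logWeight S x ^ (1 / 2 : ℝ) * (1 + R * |x - y|) ^ 2 =
        C₁ * A * E by rw [hE]; ring]
      gcongr
    | succ j ih =>
      have hpos : (0 : ℝ) < 2 ^ j := by positivity
      have hpos' : (0 : ℝ) < 2 ^ (j + 1) := by positivity
      have i1 : Integrable (scaledKernel g (2 ^ j)) := IsLPProfile.integrable g hpos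
      have i2 : Integrable (scaledKernel g (2 ^ (j + 1))) := IsLPProfile.integrable g hpos'
      have i3 : Integrable (scaledKernel g (2 ^ (j + 3))) :=
        IsLPProfile.integrable g (by positivity)
      set Pj := kconv (scaledKernel g (2 ^ j)) u with hPj
      set Pj' := kconv (scaledKernel g (2 ^ (j + 1))) u with hPj'
      have c1 : Continuous Pj := continuous_kconv i1 hu.continuous hB₀
      have c2 : Continuous Pj' := continuous_kconv i2 hu.continuous hB₀
      have b1 := norm_kconv_le (f := u) i1 hB₀
      have b2 := norm_kconv_le (f := u) i2 hB₀
      have b3 : ∀ z, ‖Pj' z - Pj z‖ ≤ _ := fun z => (norm_sub_le _ _).trans (add_le_add (b2 z) (b1 z))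
      -- The block is reproduced by a kernel of higher frequency, so `hlip` can use the small size
      -- of the block instead of the size of `u`.
      have hrep : ∀ z, kconv (scaledKernel g (2 ^ (j + 3))) (fun z => Pj' z - Pj z) z =
          Pj' z - Pj z := by
        intro z
        rw [kconv_sub i3 c2 c1 b2 b1,
          hg.kconv_large_small hρ hpos' (by rw [pow_add, pow_add]; linarith) hu.continuous hB₀,
          hg.kconv_large_small hρ hpos (by rw [pow_add]; linarith) hu.continuous hB₀]
      have hsz : ∀ z, ‖Pj' z - Pj z‖ ≤
          (A * (1 + 2 ^ (δ - 1 / 2)) * ((2 : ℝ) ^ j) ^ (δ - 1 / 2)) *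
            logWeight S z ^ (1 / 2 : ℝ) := by
        intro z
        have h1 := hu.high j z
        have h2 := hu.high (j + 1) z
        have h3 : Pj' z - Pj z = (u z - Pj z) - (u z - Pj' z) := by ring
        rw [h3]
        refine ((norm_sub_le _ _).trans (add_le_add h1 h2)).trans (le_of_eq ?_)
        rw [pow_succ, Real.mul_rpow hpos.le (by norm_num)]
        ring
      have h1 := hlip (2 ^ (j + 3)) S R (one_le_pow₀ (by norm_num)) hS hR (fun z => Pj' z - Pj z) _ _ (by positivity)
        (c2.sub c1) b3 hsz x y
      rw [hrep x, hrep y] at h1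
      have h4 : ((2 : ℝ) ^ j) ^ (δ - 1 / 2) * 2 ^ j = ((2 : ℝ) ^ j) ^ (δ + 1 / 2) := by
        rw [← Real.rpow_add_one hpos.ne']
        congr 1; ring
      have h5 : C₁ * (A * (1 + 2 ^ (δ - 1 / 2)) * ((2 : ℝ) ^ j) ^ (δ - 1 / 2)) * 2 ^ (j + 3) *
          R⁻¹ * logWeight S x ^ (1 / 2 : ℝ) * (1 + R * |x - y|) ^ 2 =
          C₂ * A * ((2 : ℝ) ^ j) ^ (δ + 1 / 2) * E := by
        rw [← h4, hC₂, hE, pow_add]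
        ring
      rw [h5] at h1
      have h6 : Pj' x - Pj' y = (Pj x - Pj y) + ((Pj' x - Pj x) - (Pj' y - Pj y)) := by ring
      rw [h6, pow_succ, Real.mul_rpow hpos.le (by norm_num)]
      refine ((norm_add_le _ _).trans (add_le_add ih h1)).trans ?_
      have h7 : 0 ≤ A * ((2 : ℝ) ^ j) ^ (δ + 1 / 2) * E := by positivity
      nlinarith
  have hkx := hu.high k x
  have hky := hu.high k y
  have hLy := logWeight_rpow_le_mul (n := 1) hS hR (q := 1 / 2) (by norm_num) (by norm_num) x y
  rw [pow_one] at hLy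
  have hk : ((2 : ℝ) ^ k) ^ (δ - 1 / 2) ≤ 4 ^ |δ - 1 / 2| * R ^ (δ - 1 / 2) :=
    rpow_le_of_comparable hR0 hRk hkR
  have hk' : ((2 : ℝ) ^ k) ^ (δ + 1 / 2) ≤ R ^ (δ - 1 / 2) * R := by
    refine (Real.rpow_le_rpow (by positivity) hkR hμ.le).trans (le_of_eq ?_)
    rw [← Real.rpow_add_one hR0.ne']
    congr 1; ring
  set a := 1 + R * |x - y| with haa
  have ha2 : 1 ≤ a ^ 2 := one_le_pow₀ ha
  have haa2 : a ≤ a ^ 2 := le_self_pow₀ ha (by norm_num)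
  have e : u x - u y = (kconv (scaledKernel g (2 ^ k)) u x - kconv (scaledKernel g (2 ^ k)) u y) +
      ((u x - kconv (scaledKernel g (2 ^ k)) u x) -
        (u y - kconv (scaledKernel g (2 ^ k)) u y)) := by ring
  rw [e]
  calc _ ≤ C₃ * A * ((2 : ℝ) ^ k) ^ (δ + 1 / 2) * E +
        (A * ((2 : ℝ) ^ k) ^ (δ - 1 / 2) * logWeight S x ^ (1 / 2 : ℝ) +
          A * ((2 : ℝ) ^ k) ^ (δ - 1 / 2) * logWeight S y ^ (1 / 2 : ℝ)) :=
        (norm_add_le _ _).trans (add_le_add (hlow k) ((norm_sub_le _ _).trans (add_le_add hkx hky)))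
    _ ≤ C₃ * A * (R ^ (δ - 1 / 2) * R) * E +
        (A * (4 ^ |δ - 1 / 2| * R ^ (δ - 1 / 2)) * (logWeight S x ^ (1 / 2 : ℝ) * a ^ 2) +
          A * (4 ^ |δ - 1 / 2| * R ^ (δ - 1 / 2)) * (logWeight S x ^ (1 / 2 : ℝ) * a ^ 2)) := by
        have h1 : logWeight S y ^ (1 / 2 : ℝ) ≤ logWeight S x ^ (1 / 2 : ℝ) * a ^ 2 :=
          hLy.trans (by gcongr)
        have h2 : logWeight S x ^ (1 / 2 : ℝ) ≤ logWeight S x ^ (1 / 2 : ℝ) * a ^ 2 :=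
          le_mul_of_one_le_right (by positivity) ha2
        have h3 : 0 ≤ logWeight S y ^ (1 / 2 : ℝ) := by
          have := one_le_logWeight hS y
          positivity
        gcongr
    _ = _ := by
        rw [hE]
        field_simp
        ring

/-- The differential is Lipschitz with constant of order `M^{p-2}`, and `u`, `v` vary by
`R^{δ-1/2}`. The fourth power is two from those increments and two from comparing the logarithms,
whose exponent `2(p-1)/(p+3)` is at most `2`. -/
theorem exists_potential_increment_bound {ρ : ℝ → ℝ} (hρ : IsLPCutoff ρ) {g : 𝓢(ℝ, ℝ)}
    (hg : IsLPProfile ρ g) {p δ A : ℝ} (hp : 3 ≤ p) (hδ : 0 < δ) (hA : 0 ≤ A) :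
    ∃ C, 0 ≤ C ∧ ∀ (S R : ℝ) (k : ℕ) (u v : ℝ → ℂ), 3 ≤ S → 1 ≤ R → R ≤ 4 * 2 ^ k →
      (2 : ℝ) ^ k ≤ R → SliceBounds g p δ A S u → SliceBounds g p δ A S v → ∀ x y,
      ‖dividedDiff p (u x) (v x) - dividedDiff p (u y) (v y)‖ ≤
        C * R ^ (δ - 1 / 2) * logWeight S x ^ (2 * (p - 1) / (p + 3) + 1 / 2) *
          (1 + R * |x - y|) ^ 4 := by
  obtain ⟨C, hC0, hC⟩ := exists_increment_bound hρ hg hp hδ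
  have hp1 : 0 ≤ p - 1 := by linarith
  refine ⟨(p - 1) * (p + 2) * A ^ (p - 2) * (2 * (C * A)), by positivity, ?_⟩
  intro S R k u v hS hR hRk hkR hu hv x y
  have hux := hC A S R k u hA hS hR hRk hkR hu x y
  have hvx := hC A S R k v hA hS hR hRk hkR hv x y
  have hL := one_le_logWeight hS x
  have hLy := one_le_logWeight hS y
  have ha : 1 ≤ 1 + R * |x - y| := by
    have : 0 ≤ R * |x - y| := by positivity
    linarith
  set a := 1 + R * |x - y| with haa
  set Z := logWeight S x * a with hZ
  have hZ1 : 1 ≤ Z := by nlinarith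
  have hxZ : logWeight S x ≤ Z := by nlinarith
  have hyZ : logWeight S y ≤ Z := by
    refine (logWeight_le_mul hS x y).trans ?_
    rw [hZ, haa]
    have := abs_nonneg (x - y)
    gcongr
    nlinarith
  set γ := 2 / (p + 3) with hγ
  have hγ0 : 0 ≤ γ := by positivity
  have hM : ∀ w : ℝ → ℂ, SliceBounds g p δ A S w → ‖w x‖ ≤ A * Z ^ γ ∧ ‖w y‖ ≤ A * Z ^ γ :=
    fun w hw => ⟨(hw.size x).trans (by gcongr), (hw.size y).trans (by gcongr)⟩
  have h1 := norm_dividedDiff_sub_le hp (hM u hu).1 (hM v hv).1 (hM u hu).2 (hM v hv).2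
  have h2 : (A * Z ^ γ) ^ (p - 2) ≤
      A ^ (p - 2) * (logWeight S x ^ (2 * (p - 1) / (p + 3)) * a ^ 2) := by
    have hle : γ * (p - 2) ≤ 2 * (p - 1) / (p + 3) := by
      rw [hγ, div_mul_eq_mul_div]
      gcongr
      linarith
    have hle2 : 2 * (p - 1) / (p + 3) ≤ 2 := by
      rw [div_le_iff₀ (by linarith)]; linarith
    rw [Real.mul_rpow hA (by positivity), ← Real.rpow_mul (by linarith)]
    refine mul_le_mul_of_nonneg_left ?_ (by positivity)
    refine (Real.rpow_le_rpow_of_exponent_le hZ1 hle).trans ?_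
    rw [hZ, Real.mul_rpow (by linarith) (by linarith)]
    refine mul_le_mul_of_nonneg_left ?_ (by positivity)
    rw [← Real.rpow_two]
    exact Real.rpow_le_rpow_of_exponent_le ha hle2
  refine h1.trans ?_
  rw [Real.rpow_add (by linarith)]
  calc _ ≤ (p - 1) * (p + 2) *
        (A ^ (p - 2) * (logWeight S x ^ (2 * (p - 1) / (p + 3)) * a ^ 2)) *
        ((C * A * R ^ (δ - 1 / 2) * logWeight S x ^ (1 / 2 : ℝ) * a ^ 2) +
        (C * A * R ^ (δ - 1 / 2) * logWeight S x ^ (1 / 2 : ℝ) * a ^ 2)) := by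
        gcongr
    _ = _ := by ring

/-- The source of the exponent in the final exponential: the potential is of order `p - 1` in
solutions of size `log^{2/(p+3)}`. -/
theorem norm_potential_le {g : 𝓢(ℝ, ℝ)} {p δ A S : ℝ} (hp : 3 ≤ p) (hA : 0 ≤ A) (hS : 3 ≤ S)
    {u v : ℝ → ℂ} (hu : SliceBounds g p δ A S u) (hv : SliceBounds g p δ A S v) (x : ℝ) :
    ‖dividedDiff p (u x) (v x)‖ ≤ p * A ^ (p - 1) * logWeight S x ^ (2 * (p - 1) / (p + 3)) := by
  have hL := one_le_logWeight hS x
  refine (norm_dividedDiff_le hp (hu.size x) (hv.size x)).trans (le_of_eq ?_)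
  rw [Real.mul_rpow hA (by positivity), ← Real.rpow_mul (by linarith), mul_assoc]
  congr 3
  ring

end Growth

/-! ### Commutators with the potential and with the weight -/

/-- The commutator of a convolution operator with a matrix potential. -/
noncomputable def kcomm (k : ℝ → ℝ) (V : ℝ → ℂ →L[ℝ] ℂ) (f : ℝ → ℂ) (x : ℝ) : ℂ :=
  ∫ y, k (x - y) • (V y - V x) (f y)

section Comm
variable {k : ℝ → ℝ} {V : ℝ → ℂ →L[ℝ] ℂ} {f : ℝ → ℂ}

theorem norm_apply_le_of_bounds {BV B : ℝ} (hBV : ∀ x, ‖V x‖ ≤ BV) (hB : ∀ y, ‖f y‖ ≤ B) (y : ℝ) :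
    ‖V y (f y)‖ ≤ BV * B :=
  (V y).le_of_opNorm_le_of_le (hBV y) (hB y)

theorem kcomm_eq (hk : Integrable k) (hV : Continuous V) (hf : Continuous f) {BV B : ℝ}
    (hBV : ∀ x, ‖V x‖ ≤ BV) (hB : ∀ y, ‖f y‖ ≤ B) (x : ℝ) :
    kcomm k V f x = kconv k (fun y => V y (f y)) x - V x (kconv k f x) := by
  have i1 := integrable_kconv hk (hV.clm_apply hf) (norm_apply_le_of_bounds hBV hB) x
  have i2 := integrable_kconv hk hf hB x
  unfold kcomm kconv
  rw [← (V x).integral_comp_comm i2, ← integral_sub i1 ((V x).integrable_comp i2)]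
  congr 1
  funext y
  rw [sub_apply, smul_sub, map_smul]

theorem continuous_kcomm (hk : Integrable k) (hV : Continuous V) (hf : Continuous f) {BV B : ℝ}
    (hBV : ∀ x, ‖V x‖ ≤ BV) (hB : ∀ y, ‖f y‖ ≤ B) : Continuous (kcomm k V f) := by
  have : kcomm k V f = fun x => kconv k (fun y => V y (f y)) x - V x (kconv k f x) :=
    funext (kcomm_eq hk hV hf hBV hB)
  rw [this]
  exact (continuous_kconv hk (hV.clm_apply hf) (norm_apply_le_of_bounds hBV hB)).sub
    (hV.clm_apply (continuous_kconv hk hf hB))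

theorem norm_kcomm_le {m : ℕ} (hm : 2 ≤ m) {R C D x : ℝ} (hR : 0 < R)
    (hk : ∀ z, |k z| ≤ C * polyKernel (m + 4) R z)
    (hV : ∀ y, ‖V x - V y‖ ≤ D * (1 + R * |x - y|) ^ 4) (hf : Continuous f) {B : ℝ}
    (hB : ∀ y, ‖f y‖ ≤ B) :
    ‖kcomm k V f x‖ ≤ C * D * kconv (polyKernel m R) (fun y => ‖f y‖) x := by
  unfold kcomm kconv
  rw [← integral_const_mul]
  have hB' : ∀ y, ‖‖f y‖‖ ≤ B := fun y => by rw [norm_norm]; exact hB y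
  refine norm_integral_le_of_norm_le
    ((integrable_kconv (integrable_polyKernel hm hR) hf.norm hB' x).const_mul _)
    (Filter.Eventually.of_forall fun y => ?_)
  rw [norm_smul, Real.norm_eq_abs]
  have h1 : ‖(V y - V x) (f y)‖ ≤ D * (1 + R * |x - y|) ^ 4 * ‖f y‖ := by
    refine ContinuousLinearMap.le_of_opNorm_le _ ?_ _
    rw [norm_sub_rev]
    exact hV y
  calc |k (x - y)| * ‖(V y - V x) (f y)‖
      ≤ (C * polyKernel (m + 4) R (x - y)) * (D * (1 + R * |x - y|) ^ 4 * ‖f y‖) :=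
        mul_le_mul (hk _) h1 (norm_nonneg _) ((abs_nonneg _).trans (hk _))
    _ = C * D * ((polyKernel (m + 4) R (x - y) * (1 + R * |x - y|) ^ 4) * ‖f y‖) := by ring
    _ = _ := by rw [polyKernel_mul_pow m 4 hR.le, smul_eq_mul]

theorem norm_kconv_le_kconv_norm {m : ℕ} (hm : 2 ≤ m) {R C : ℝ} (hR : 0 < R)
    (hk : ∀ z, |k z| ≤ C * polyKernel m R z) (hf : Continuous f) {B : ℝ}
    (hB : ∀ y, ‖f y‖ ≤ B) (x : ℝ) :
    ‖kconv k f x‖ ≤ C * kconv (polyKernel m R) (fun y => ‖f y‖) x := by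
  unfold kconv
  rw [← integral_const_mul]
  have hB' : ∀ y, ‖‖f y‖‖ ≤ B := fun y => by rw [norm_norm]; exact hB y
  refine norm_integral_le_of_norm_le
    ((integrable_kconv (integrable_polyKernel hm hR) hf.norm hB' x).const_mul _)
    (Filter.Eventually.of_forall fun y => ?_)
  rw [norm_smul, Real.norm_eq_abs, smul_eq_mul, ← mul_assoc]
  exact mul_le_mul_of_nonneg_right (hk _) (norm_nonneg _)

end Comm

theorem kconv_polyKernel_nonneg (m : ℕ) {R : ℝ} (hR : 0 ≤ R) (f : ℝ → ℂ) (x : ℝ) :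
    0 ≤ kconv (polyKernel m R) (fun y => ‖f y‖) x :=
  integral_nonneg fun _ => smul_nonneg (polyKernel_nonneg m hR _) (norm_nonneg _)

theorem kconv_polyKernel_le_logWeight {n m : ℕ} (hm : 2 + n ≤ m) {R S : ℝ} (hR : 1 ≤ R)
    (hS : 3 ≤ S) {q : ℝ} (hq : 0 ≤ q) (hqn : q ≤ n) {f : ℝ → ℂ} {B : ℝ} (hB0 : 0 ≤ B)
    (hB : ∀ y, ‖f y‖ ≤ B * logWeight S y ^ q) (x : ℝ) :
    kconv (polyKernel m R) (fun y => ‖f y‖) x ≤ polyMass * B * logWeight S x ^ q := by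
  have hR0 : 0 < R := by linarith
  have hL := one_le_logWeight hS x
  have key : ∀ y, ‖polyKernel m R (x - y) • ‖f y‖‖ ≤
      (B * logWeight S x ^ q) * polyKernel 2 R (x - y) := by
    intro y
    have h0 := polyKernel_nonneg m hR0.le (x - y)
    have h1 := polyKernel_anti hm hR0.le (x - y)
    rw [smul_eq_mul, norm_mul, Real.norm_of_nonneg h0, norm_norm]
    calc polyKernel m R (x - y) * ‖f y‖
        ≤ polyKernel (2 + n) R (x - y) * (B * (logWeight S x ^ q * (1 + R * |x - y|) ^ n)) := by
          have h2 := (hB y).trans (mul_le_mul_of_nonneg_left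
            (logWeight_rpow_le_mul hS hR hq hqn x y) hB0)
          exact mul_le_mul h1 h2 (norm_nonneg _) (h0.trans h1)
      _ = (B * logWeight S x ^ q) *
          (polyKernel (2 + n) R (x - y) * (1 + R * |x - y|) ^ n) := by ring
      _ = _ := by rw [polyKernel_mul_pow 2 n hR0.le]
  refine (le_abs_self _).trans ((norm_integral_le_polyMass hR0 key).trans (le_of_eq (by ring)))

/-- If `k * X = 0`, then only the high frequencies of `W` contribute to the weighted pairing with
`X`, up to a commutator with the weight. -/
theorem integral_inner_eq_of_kconv_eq_zero {k : ℝ → ℝ} (hkc : Continuous k)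
    (heven : ∀ z, k (-z) = k z) {R : ℝ} (hR : 0 < R) {C : ℝ}
    (hk : ∀ z, |k z| ≤ C * polyKernel 2 R z) {W X : ℝ → ℂ} (hW : Continuous W)
    (hX : Continuous X) {B B' : ℝ} (hB : ∀ x, ‖W x‖ ≤ B) (hB' : ∀ x, ‖X x‖ ≤ B')
    (hzero : ∀ x, kconv k X x = 0) :
    ∫ x, inner ℝ (W x) (X x) * sigmaWeight R x =
      (∫ x, inner ℝ (W x - kconv k W x) (X x) * sigmaWeight R x) +
      ∫ p : ℝ × ℝ, k (p.1 - p.2) * (sigmaWeight R p.1 - sigmaWeight R p.2) *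
        inner ℝ (W p.2) (X p.1) ∂(volume.prod volume) := by
  have hki : Integrable k := ((integrable_polyKernel le_rfl hR).const_mul C).mono'
    hkc.aestronglyMeasurable (Filter.Eventually.of_forall hk)
  have hσ := integrable_sigmaWeight hR
  have hσc := continuous_sigmaWeight R
  have hB0 : 0 ≤ B := (norm_nonneg _).trans (hB 0)
  have hin : ∀ x y, |inner ℝ (W y) (X x)| ≤ B * B' := fun x y =>
    (abs_real_inner_le_norm _ _).trans (mul_le_mul (hB y) (hB' x) (norm_nonneg _) hB0)
  have hbb : 0 ≤ B * B' := (abs_nonneg _).trans (hin 0 0)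
  set G₁ : ℝ × ℝ → ℝ := fun p => k (p.1 - p.2) * sigmaWeight R p.1 * inner ℝ (W p.2) (X p.1)
  set G₂ : ℝ × ℝ → ℝ := fun p => k (p.1 - p.2) * sigmaWeight R p.2 * inner ℝ (W p.2) (X p.1)
  have c₁ : Continuous G₁ :=
    ((hkc.comp (by fun_prop)).mul (hσc.comp continuous_fst)).mul (by fun_prop)
  have c₂ : Continuous G₂ :=
    ((hkc.comp (by fun_prop)).mul (hσc.comp continuous_snd)).mul (by fun_prop)
  have bound : ∀ x y s : ℝ, 0 ≤ s → ‖k (x - y) * s * inner ℝ (W y) (X x)‖ ≤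
      polyKernel 2 R (x - y) * (C * (B * B') * s) := by
    intro x y s hs
    rw [norm_mul, norm_mul, Real.norm_eq_abs, Real.norm_of_nonneg hs, Real.norm_eq_abs]
    have h0 := (abs_nonneg _).trans (hk (x - y))
    calc |k (x - y)| * s * |inner ℝ (W y) (X x)|
        ≤ (C * polyKernel 2 R (x - y)) * s * (B * B') := by
          gcongr
          · exact hk _
          · exact hin x y
      _ = _ := by ring
  have i₁ : Integrable G₁ (volume.prod volume) := by
    refine integrable_of_le_polyKernel hR c₁.aestronglyMeasurable
      (hσ.const_mul (C * (B * B'))) (integrable_zero ℝ ℝ volume) fun x y => ?_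
    exact (bound x y _ (sigmaWeight_pos R x).le).trans (le_of_eq (by simp))
  have i₂ : Integrable G₂ (volume.prod volume) := by
    refine integrable_of_le_polyKernel hR c₂.aestronglyMeasurable
      (integrable_zero ℝ ℝ volume) (hσ.const_mul (C * (B * B'))) fun x y => ?_
    exact (bound x y _ (sigmaWeight_pos R y).le).trans (le_of_eq (by simp))
  have e₁ : ∫ p, G₁ p ∂(volume.prod volume) =
      ∫ x, inner ℝ (kconv k W x) (X x) * sigmaWeight R x := by
    rw [integral_prod _ i₁]
    congr 1
    funext x
    have h1 : ∀ y, G₁ (x, y) = inner ℝ (X x) (k (x - y) • W y) * sigmaWeight R x := fun y => by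
      simp only [G₁]
      rw [inner_smul_right, real_inner_comm]
      ring
    simp_rw [h1]
    rw [integral_mul_const, integral_inner (integrable_kconv hki hW hB x), real_inner_comm]
    rfl
  -- With the weight at `y`, integrating first in `x` and using that `k` is even produces `(k *
  -- X)(y)`, which vanishes.
  have e₂ : ∫ p, G₂ p ∂(volume.prod volume) = 0 := by
    rw [integral_prod_symm _ i₂]
    have h0 : ∀ y, ∫ x, G₂ (x, y) = 0 := by
      intro y
      have h1 : ∀ x, G₂ (x, y) = inner ℝ (W y) (k (y - x) • X x) * sigmaWeight R y := fun x => by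
        simp only [G₂]
        rw [inner_smul_right, ← heven, neg_sub]
        ring
      simp_rw [h1]
      rw [integral_mul_const, integral_inner (integrable_kconv hki hX hB' y)]
      have := hzero y
      unfold kconv at this
      rw [this, inner_zero_right, zero_mul]
    simp_rw [h0]
    simp
  have hsub : ∫ p : ℝ × ℝ, k (p.1 - p.2) * (sigmaWeight R p.1 - sigmaWeight R p.2) *
        inner ℝ (W p.2) (X p.1) ∂(volume.prod volume) =
      ∫ x, inner ℝ (kconv k W x) (X x) * sigmaWeight R x := by
    rw [← e₁, ← sub_zero (∫ p, G₁ p ∂(volume.prod volume)), ← e₂, ← integral_sub i₁ i₂]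
    congr 1
    funext p
    simp only [G₁, G₂]
    ring
  have hWk := continuous_kconv hki hW hB
  have j : ∀ Y : ℝ → ℂ, Continuous Y → (∃ b, ∀ x, ‖Y x‖ ≤ b) →
      Integrable fun x => inner ℝ (Y x) (X x) * sigmaWeight R x := by
    rintro Y hY ⟨b, hb⟩
    refine hσ.bdd_mul (c := b * B') (hY.inner hX).aestronglyMeasurable
      (Filter.Eventually.of_forall fun x => ?_)
    exact (abs_real_inner_le_norm _ _).trans (mul_le_mul (hb x) (hB' x) (norm_nonneg _)
      ((norm_nonneg _).trans (hb x)))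
  rw [hsub, ← integral_add]
  · congr 1
    funext x
    rw [inner_sub_left]
    ring
  · exact j _ (hW.sub hWk) ⟨_, fun x => (norm_sub_le _ _).trans
      (add_le_add (hB x) (norm_kconv_le hki hB x))⟩
  · exact j _ hWk ⟨_, norm_kconv_le hki hB⟩

/-! ### Weighted bounds for the terms of the energy identity -/

section EnergyTerms
variable {S R : ℝ}

theorem integrable_sq_sigma (hR : 0 < R) {Q : ℝ → ℝ} (hQ : Continuous Q) {B : ℝ}
    (hB : ∀ x, |Q x| ≤ B) : Integrable fun x => Q x ^ 2 * sigmaWeight R x := by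
  refine (integrable_sigmaWeight hR).bdd_mul (c := B ^ 2) (hQ.pow 2).aestronglyMeasurable
    (Filter.Eventually.of_forall fun x => ?_)
  rw [norm_pow, Real.norm_eq_abs]
  exact pow_le_pow_left₀ (abs_nonneg _) (hB x) 2

/-- Young's inequality: `Q²` is kept, and `K²` is multiplied by `∫ log^{2q} σ_R ≲ R (log S)^{2q}`.
An error of size `R^{-1+4δ}` therefore requires `K` of order `R^{2δ-1}`. -/
theorem abs_integral_sigma_le_young (hS : 3 ≤ S) (hR : 1 ≤ R) (hRS : R ≤ S) {F Q : ℝ → ℝ}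
    {K q B : ℝ} (hq : 0 ≤ q) (hQ : Continuous Q) (hB : ∀ x, |Q x| ≤ B)
    (hF : ∀ x, |F x| ≤ K * logWeight S x ^ q * Q x) :
    |∫ x, F x * sigmaWeight R x| ≤ (∫ x, Q x ^ 2 * sigmaWeight R x) +
      K ^ 2 * (weightConst (2 * q) * R * Real.log S ^ (2 * q)) := by
  have hR0 : 0 < R := by linarith
  have i1 := integrable_sq_sigma hR0 hQ hB
  have i2 := (integrable_logWeight_sigma hS hR hRS (q := 2 * q) (by positivity)).const_mul (K ^ 2)
  rw [← Real.norm_eq_abs]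
  refine (norm_integral_le_of_norm_le (i1.add i2) (Filter.Eventually.of_forall fun x => ?_)).trans ?_
  · have hL := one_le_logWeight hS x
    have hσ := sigmaWeight_pos R x
    rw [norm_mul, Real.norm_of_nonneg hσ.le, Real.norm_eq_abs, Pi.add_apply, ← mul_assoc, ← add_mul]
    refine mul_le_mul_of_nonneg_right ((hF x).trans ?_) hσ.le
    have : logWeight S x ^ (2 * q) = (logWeight S x ^ q) ^ 2 := by
      rw [mul_comm, Real.rpow_mul (by linarith), Real.rpow_two]
    rw [this]
    nlinarith [sq_nonneg (K * logWeight S x ^ q - Q x), sq_nonneg (K * logWeight S x ^ q),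
      sq_nonneg (Q x)]
  · rw [integral_add' i1 i2, integral_const_mul]
    gcongr
    exact integral_logWeight_sigma_le hS hR hRS (by positivity)

/-- Used for `V W`, the term responsible for the growth rate: the mass must receive exactly `(log
S)^a`. The tail carries `S⁻²`, and `S⁻² R ≤ R⁻¹`. -/
theorem abs_integral_sigma_le_main (hS : 3 ≤ S) (hR : 1 ≤ R) (hRS : R ≤ S) {F : ℝ → ℝ} {W : ℝ → ℂ}
    {a D B B₀ : ℝ} (ha : 0 ≤ a) (hD : 0 ≤ D) (hW : Continuous W) (hB₀ : ∀ x, ‖W x‖ ≤ B₀)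
    (hB : ∀ x, ‖W x‖ ≤ B * logWeight S x ^ (1 / 2 : ℝ))
    (hF : ∀ x, |F x| ≤ D * logWeight S x ^ a * ‖W x‖ ^ 2) :
    |∫ x, F x * sigmaWeight R x| ≤ D * (3 ^ a * Real.log S ^ a * ∫ x, ‖W x‖ ^ 2 * sigmaWeight R x) +
      D * (8 * B ^ 2 * weightConst (a + 1)) * (R⁻¹ * Real.log S ^ (a + 1)) := by
  have hR0 : 0 < R := by linarith
  have i1 := (integrable_sq_sigma hR0 hW.norm (B := B₀)
    (fun x => by rw [abs_norm]; exact hB₀ x)).const_mul (D * (3 ^ a * Real.log S ^ a))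
  have i2 := (integrable_logWeight_exp hS hR hRS (q := a + 1) (by linarith)).const_mul
    (D * (8 * (S ^ 2)⁻¹ * B ^ 2))
  rw [← Real.norm_eq_abs]
  refine (norm_integral_le_of_norm_le (i1.add i2) (Filter.Eventually.of_forall fun x => ?_)).trans ?_
  · have hL := one_le_logWeight hS x
    have hσ := sigmaWeight_pos R x
    rw [norm_mul, Real.norm_of_nonneg hσ.le, Real.norm_eq_abs, Pi.add_apply]
    have h1 := logWeight_rpow_le_log_add hS hR hRS ha x
    have h2 : ‖W x‖ ^ 2 ≤ B ^ 2 * logWeight S x := by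
      have := pow_le_pow_left₀ (norm_nonneg _) (hB x) 2
      rwa [mul_pow, ← Real.rpow_two (logWeight S x ^ (1 / 2 : ℝ)), ← Real.rpow_mul (by linarith),
        one_div_mul_cancel (by norm_num), Real.rpow_one] at this
    have h3 : Real.exp (japaneseBracket (x / R) / 2) * sigmaWeight R x =
        Real.exp (-(japaneseBracket (x / R) / 2)) := by
      unfold sigmaWeight
      rw [← Real.exp_add]; congr 1; ring
    calc |F x| * sigmaWeight R x ≤ (D * logWeight S x ^ a * ‖W x‖ ^ 2) * sigmaWeight R x := by
          gcongr; exact hF x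
      _ ≤ (D * (3 ^ a * Real.log S ^ a + 8 * (S ^ 2)⁻¹ *
          (logWeight S x ^ a * Real.exp (japaneseBracket (x / R) / 2))) * ‖W x‖ ^ 2) *
          sigmaWeight R x := by gcongr
      _ = D * (3 ^ a * Real.log S ^ a) * (‖W x‖ ^ 2 * sigmaWeight R x) +
          D * (8 * (S ^ 2)⁻¹ * (logWeight S x ^ a *
          (Real.exp (japaneseBracket (x / R) / 2) * sigmaWeight R x))) * ‖W x‖ ^ 2 := by ring
      _ ≤ D * (3 ^ a * Real.log S ^ a) * (‖W x‖ ^ 2 * sigmaWeight R x) +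
          D * (8 * (S ^ 2)⁻¹ * (logWeight S x ^ a *
          (Real.exp (japaneseBracket (x / R) / 2) * sigmaWeight R x))) *
          (B ^ 2 * logWeight S x) := by gcongr
      _ = _ := by
          rw [h3, Real.rpow_add_one (by linarith)]
          ring
  · rw [integral_add' i1 i2, integral_const_mul, integral_const_mul]
    have h1 := integral_logWeight_exp_le hS hR hRS (q := a + 1) (by linarith)
    have h2 : (S ^ 2)⁻¹ * R ≤ R⁻¹ := by
      rw [inv_mul_le_iff₀ (by positivity), ← div_eq_mul_inv, le_div_iff₀ hR0]
      nlinarith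
    have h3 := weightConst_nonneg (a + 1)
    have h4 : 0 ≤ Real.log S ^ (a + 1) := by
      have := one_le_log_of_three_le hS
      positivity
    have h5 : D * (8 * (S ^ 2)⁻¹ * B ^ 2) *
        ∫ x, logWeight S x ^ (a + 1) * Real.exp (-(japaneseBracket (x / R) / 2)) ≤
        D * (8 * B ^ 2 * weightConst (a + 1)) * (R⁻¹ * Real.log S ^ (a + 1)) := by
      calc _ ≤ D * (8 * (S ^ 2)⁻¹ * B ^ 2) * (weightConst (a + 1) * R * Real.log S ^ (a + 1)) := by
            gcongr
        _ = D * (8 * B ^ 2 * weightConst (a + 1)) * (((S ^ 2)⁻¹ * R) * Real.log S ^ (a + 1)) := by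
            ring
        _ ≤ _ := by gcongr
    linarith

/-- The difference of the weights gains `R⁻² (1 + R|x - y|)`, and integrating the remaining weight
gives back `R`. Of the `4 + n` powers two are for integrability, one for `σ_R`, and at most `n + 1`
for the logarithms. -/
theorem abs_integral_weight_commutator_le (hS : 3 ≤ S) (hR : 1 ≤ R) (hRS : R ≤ S) {k : ℝ → ℝ}
    (hkc : Continuous k) {C : ℝ} {n : ℕ} (hk : ∀ z, |k z| ≤ C * polyKernel (4 + n) R z)
    {W X : ℝ → ℂ} (hW : Continuous W) (hX : Continuous X) {B D q : ℝ} (hq : 0 ≤ q) (hqn : q ≤ n)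
    (hB : ∀ x, ‖W x‖ ≤ B * logWeight S x ^ (1 / 2 : ℝ))
    (hD : ∀ x, ‖X x‖ ≤ D * logWeight S x ^ q) :
    |∫ p : ℝ × ℝ, k (p.1 - p.2) * (sigmaWeight R p.1 - sigmaWeight R p.2) *
        inner ℝ (W p.2) (X p.1) ∂(volume.prod volume)| ≤
      2 * polyMass * C * B * D * weightConst (q + 1 / 2) * (R⁻¹ * Real.log S ^ (q + 1 / 2)) := by
  have hR0 : 0 < R := by linarith
  have hσc := continuous_sigmaWeight R
  have hC0 : 0 ≤ C := by
    have h := (abs_nonneg _).trans (hk 0)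
    have h2 : polyKernel (4 + n) R 0 = R := by simp [polyKernel]
    rw [h2] at h
    exact nonneg_of_mul_nonneg_left h hR0
  have hL0 := one_le_logWeight hS 0
  have hB0 : 0 ≤ B := nonneg_of_mul_nonneg_left ((norm_nonneg _).trans (hB 0)) (by positivity)
  have hD0 : 0 ≤ D := nonneg_of_mul_nonneg_left ((norm_nonneg _).trans (hD 0)) (by positivity)
  set h : ℝ → ℝ := fun x => (C * B * D * (R⁻¹) ^ 2) *
    (logWeight S x ^ (q + 1 / 2) * sigmaWeight R x) with hh
  have i : Integrable h :=
    (integrable_logWeight_sigma hS hR hRS (q := q + 1 / 2) (by linarith)).const_mul _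
  set F : ℝ × ℝ → ℝ := fun p => |k (p.1 - p.2) * (sigmaWeight R p.1 - sigmaWeight R p.2) *
        inner ℝ (W p.2) (X p.1)| with hF
  have hFc : Continuous F := by
    refine Continuous.abs (Continuous.mul (Continuous.mul (hkc.comp (by fun_prop)) ?_) ?_)
    · exact (hσc.comp continuous_fst).sub (hσc.comp continuous_snd)
    · fun_prop
  have hle : ∀ x y, |F (x, y)| ≤ polyKernel 2 R (x - y) * (h x + h y) := by
    intro x y
    simp only [hF, hh, abs_abs]
    rw [abs_mul, abs_mul]
    have hLx := one_le_logWeight hS x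
    have hLy := one_le_logWeight hS y
    have ha : 1 ≤ 1 + R * |x - y| := by
      have : 0 ≤ R * |x - y| := by positivity
      linarith
    have hx := logWeight_rpow_le_mul (n := 1) hS hR (q := 1 / 2) (by norm_num) (by norm_num) x y
    have hy := logWeight_rpow_le_mul (n := n) hS hR hq hqn y x
    rw [abs_sub_comm y x] at hy
    have hσx := sigmaWeight_pos R x
    have hσy := sigmaWeight_pos R y
    have hσ := abs_sigmaWeight_sub_le hR0 x y
    have hxy : |x - y| / R ≤ (R⁻¹) ^ 2 * (1 + R * |x - y|) := by
      have h1 : |x - y| / R = (R⁻¹) ^ 2 * (R * |x - y|) := by field_simp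
      rw [h1]
      have : 0 < (R⁻¹) ^ 2 := by positivity
      nlinarith
    have hΦ0 := polyKernel_nonneg (4 + n) hR0.le (x - y)
    have hΦ := polyKernel_mul_pow 2 (n + 2) hR0.le (x - y)
    rw [show 2 + (n + 2) = 4 + n by ring] at hΦ
    have hin : |inner ℝ (W y) (X x)| ≤
        B * D * (logWeight S y ^ (1 / 2 : ℝ) * logWeight S x ^ q) := by
      refine (abs_real_inner_le_norm _ _).trans ?_
      calc ‖W y‖ * ‖X x‖ ≤ (B * logWeight S y ^ (1 / 2 : ℝ)) * (D * logWeight S x ^ q) :=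
            mul_le_mul (hB y) (hD x) (norm_nonneg _) (by positivity)
        _ = _ := by ring
    set a := 1 + R * |x - y| with haa
    set P := polyKernel (4 + n) R (x - y)
    have p1 : a ^ 2 ≤ a ^ (n + 2) := pow_le_pow_right₀ ha (by omega)
    have p2 : a ^ (n + 1) ≤ a ^ (n + 2) := pow_le_pow_right₀ ha (by omega)
    have key1 : logWeight S y ^ (1 / 2 : ℝ) * logWeight S x ^ q ≤
        logWeight S x ^ (q + 1 / 2) * a := by
      rw [Real.rpow_add (by linarith)]
      calc _ ≤ (logWeight S x ^ (1 / 2 : ℝ) * a ^ 1) * logWeight S x ^ q := by gcongr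
        _ = _ := by ring
    have key2 : logWeight S y ^ (1 / 2 : ℝ) * logWeight S x ^ q ≤
        logWeight S y ^ (q + 1 / 2) * a ^ n := by
      rw [Real.rpow_add (by linarith)]
      calc _ ≤ logWeight S y ^ (1 / 2 : ℝ) * (logWeight S y ^ q * a ^ n) := by gcongr
        _ = _ := by ring
    set M := logWeight S y ^ (1 / 2 : ℝ) * logWeight S x ^ q
    calc |k (x - y)| * |sigmaWeight R x - sigmaWeight R y| * |inner ℝ (W y) (X x)|
        ≤ (C * P) * (((R⁻¹) ^ 2 * a) * (sigmaWeight R x + sigmaWeight R y)) * (B * D * M) := by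
          have h1 : |sigmaWeight R x - sigmaWeight R y| ≤
              ((R⁻¹) ^ 2 * a) * (sigmaWeight R x + sigmaWeight R y) := hσ.trans (by gcongr)
          gcongr
          exact hk _
      _ = (C * B * D * (R⁻¹) ^ 2) * (P * (a * (M * sigmaWeight R x + M * sigmaWeight R y))) := by
          ring
      _ ≤ (C * B * D * (R⁻¹) ^ 2) * (P * (a * ((logWeight S x ^ (q + 1 / 2) * a) * sigmaWeight R x +
          (logWeight S y ^ (q + 1 / 2) * a ^ n) * sigmaWeight R y))) := by gcongr
      _ = (C * B * D * (R⁻¹) ^ 2) * (P * (a ^ 2 * (logWeight S x ^ (q + 1 / 2) * sigmaWeight R x) +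
          a ^ (n + 1) * (logWeight S y ^ (q + 1 / 2) * sigmaWeight R y))) := by ring
      _ ≤ (C * B * D * (R⁻¹) ^ 2) * (P * (a ^ (n + 2) * (logWeight S x ^ (q + 1 / 2) *
          sigmaWeight R x) +
          a ^ (n + 2) * (logWeight S y ^ (q + 1 / 2) * sigmaWeight R y))) := by gcongr
      _ = _ := by rw [← hΦ]; ring
  rw [← Real.norm_eq_abs]
  refine (norm_integral_le_integral_norm _).trans ?_
  have h1 := integral_prod_le_of_le_polyKernel hR0 hFc.aestronglyMeasurable i i hle
  refine h1.trans ?_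
  have h2 : ∫ x, h x ≤ C * B * D * weightConst (q + 1 / 2) *
      (R⁻¹ * Real.log S ^ (q + 1 / 2)) := by
    simp only [hh]
    rw [integral_const_mul]
    calc _ ≤ (C * B * D * (R⁻¹) ^ 2) * (weightConst (q + 1 / 2) * R * Real.log S ^ (q + 1 / 2)) := by
          gcongr
          exact integral_logWeight_sigma_le hS hR hRS (by linarith)
      _ = _ := by field_simp
  have hpm := polyMass_nonneg
  nlinarith

end EnergyTerms

/-! ### The nonlinear and dispersive energy estimates -/

theorem integrable_inner_sigma {R : ℝ} (hR : 0 < R) {W X : ℝ → ℂ} (hW : Continuous W)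
    (hX : Continuous X) {B B' : ℝ} (hB : ∀ x, ‖W x‖ ≤ B) (hB' : ∀ x, ‖X x‖ ≤ B') :
    Integrable fun x => inner ℝ (W x) (X x) * sigmaWeight R x := by
  refine (integrable_sigmaWeight hR).bdd_mul (c := B * B') (hW.inner hX).aestronglyMeasurable
    (Filter.Eventually.of_forall fun x => ?_)
  exact (abs_real_inner_le_norm _ _).trans (mul_le_mul (hB x) (hB' x) (norm_nonneg _)
    ((norm_nonneg _).trans (hB x)))

theorem integral_sq_kconv_le_of_majorant {S R : ℝ} (hS : 3 ≤ S) (hR : 1 ≤ R)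
    (hRS : R ≤ S) {f F : ℝ → ℂ} (hf : Continuous f) {B₀ B C : ℝ} (hB₀ : ∀ y, ‖f y‖ ≤ B₀)
    (hB : ∀ y, ‖f y‖ ≤ B * logWeight S y ^ (1 / 2 : ℝ)) (hB0 : 0 ≤ B)
    (hF : ∀ x, ‖F x‖ ≤ C * kconv (polyKernel 5 R) (fun y => ‖f y‖) x) :
    ∫ x, ‖F x‖ ^ 2 * sigmaWeight R x ≤
      C ^ 2 * (polyMass ^ 2 * ((∫ x, ‖f x‖ ^ 2 * sigmaWeight R x) +
        2 * weightConst 2 * (B ^ 2 * R⁻¹ * Real.log S ^ (2 : ℝ)))) := by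
  have hR0 : 0 < R := by linarith
  have hk : Integrable (polyKernel 5 R) := integrable_polyKernel (by norm_num) hR0
  have hB₀' : ∀ y, ‖‖f y‖‖ ≤ B₀ := fun y => by rw [norm_norm]; exact hB₀ y
  have hQ : Continuous (kconv (polyKernel 5 R) fun y => ‖f y‖) :=
    continuous_kconv hk hf.norm hB₀'
  have i := (integrable_sq_sigma hR0 hQ (norm_kconv_le hk hB₀')).const_mul (C ^ 2)
  refine (integral_mono_of_nonneg (Filter.Eventually.of_forall fun x => ?_) i
    (Filter.Eventually.of_forall fun x => ?_)).trans ?_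
  · have := (sigmaWeight_pos R x).le
    simp only [Pi.zero_apply]
    positivity
  · simp only
    rw [← mul_assoc, ← mul_pow]
    exact mul_le_mul_of_nonneg_right (pow_le_pow_left₀ (norm_nonneg _) (hF x) 2)
      (sigmaWeight_pos R x).le
  · rw [integral_const_mul]
    refine mul_le_mul_of_nonneg_left ?_ (sq_nonneg C)
    refine integral_sq_kconv_sigma_le le_rfl hS hR hRS hf hB₀ fun y => (hB y).trans ?_
    refine mul_le_mul_of_nonneg_left ?_ hB0
    nth_rewrite 2 [← Real.rpow_one (logWeight S y)]
    exact logWeight_rpow_le_rpow hS (by norm_num) y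

theorem abs_le_polyKernel_of_le {k : ℝ → ℝ} {C R : ℝ} {m n : ℕ} (hnm : n ≤ m) (hR : 0 < R)
    (hC : 0 ≤ C) (h : ∀ z, |k z| ≤ C * polyKernel m R z) (z : ℝ) :
    |k z| ≤ C * polyKernel n R z :=
  (h z).trans (mul_le_mul_of_nonneg_left (polyKernel_anti hnm hR.le z) hC)

theorem kconv_I_mul (k : ℝ → ℝ) (f : ℝ → ℂ) (x : ℝ) :
    kconv k (fun y => Complex.I * f y) x = Complex.I * kconv k f x := by
  unfold kconv
  rw [← integral_const_mul]
  congr 1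
  funext y
  rw [mul_smul_comm]

set_option maxHeartbeats 2000000 in
/-- The nonlinear contribution to the evolution of the localized mass. -/
theorem exists_nonlinear_energy_bound {ρ : ℝ → ℝ} (hρ : IsLPCutoff ρ) {g : 𝓢(ℝ, ℝ)}
    (hg : IsLPProfile ρ g) {p δ A : ℝ} (hp : 3 ≤ p) (hδ : 0 < δ) (hA : 0 ≤ A) :
    ∃ C, 0 ≤ C ∧ ∀ (S R : ℝ) (u v : ℝ → ℂ), 3 ≤ S → 2 ≤ R → R ≤ S →
      SliceBounds g p δ A S u → SliceBounds g p δ A S v →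
      |∫ x, inner ℝ (kconv (scaledKernel g R) (fun y => u y - v y) x) (Complex.I *
          kconv (scaledKernel g R) (fun y => powNonlin p (u y) - powNonlin p (v y)) x) *
            sigmaWeight R x| ≤
        C * (Real.log S ^ (2 * (p - 1) / (p + 3)) *
          (∫ x, ‖kconv (scaledKernel g R) (fun y => u y - v y) x‖ ^ 2 * sigmaWeight R x) +
          R ^ (-1 + 4 * δ) * Real.log S ^ (2 * (2 * (p - 1) / (p + 3) + 1))) := by
  -- Nine powers: four for the increments of the potential, five for the weighted `L²` bound.
  obtain ⟨Cg, hCg0, hCg⟩ := g.abs_le_polyKernel 9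
  obtain ⟨CV, hCV0, hCV⟩ := exists_potential_increment_bound hρ hg hp hδ hA
  have hc := polyMass_nonneg
  set c := polyMass with hcdef
  set a := 2 * (p - 1) / (p + 3) with ha
  have ha0 : 0 ≤ a := by
    have : 0 ≤ p - 1 := by linarith
    positivity
  have ha2 : a ≤ 2 := by rw [ha, div_le_iff₀ (by linarith)]; linarith
  set C' : ℝ := Cg * (2 * 4 ^ 9) with hC'
  have hC'0 : 0 ≤ C' := by positivity
  have hCgC' : Cg ≤ C' := by
    rw [hC']
    have : (1 : ℝ) ≤ 2 * 4 ^ 9 := by norm_num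
    nlinarith
  set BW : ℝ := Cg * c * (2 * A) with hBW
  have hBW0 : 0 ≤ BW := by positivity
  set Bh : ℝ := 2 * A * 4 ^ |δ - 1 / 2| with hBh
  have hBh0 : 0 ≤ Bh := by positivity
  set DV : ℝ := p * A ^ (p - 1) with hDV
  have hDV0 : 0 ≤ DV := by positivity
  set Kh : ℝ := C' * CV * (c * Bh) with hKh
  set KX : ℝ := C' * CV * (c * BW) with hKX
  set K1 : ℝ := (Cg * c * Bh) * (C' * CV) with hK1
  have hw2 := weightConst_nonneg 2
  have hwa := weightConst_nonneg (a + 1)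
  have hwa2 := weightConst_nonneg (2 * (a + 1))
  have hwa3 := weightConst_nonneg (a + 1 + 1 / 2)
  set w2 := weightConst 2
  set wa := weightConst (a + 1)
  set wa2 := weightConst (2 * (a + 1))
  set wa3 := weightConst (a + 1 + 1 / 2)
  refine ⟨(DV * 3 ^ a + DV * (8 * BW ^ 2 * wa)) + (1 + Kh ^ 2 * wa2) +
    (c ^ 2 * (C' ^ 2 * (c ^ 2 * (1 + 2 * w2 * BW ^ 2)) + 2 * w2 * BW ^ 2) + K1 ^ 2 * wa2) +
    2 * c * C' * BW * KX * wa3, by positivity, ?_⟩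
  intro S R u v hS hR2 hRS hu hv
  have hR : 1 ≤ R := by linarith
  have hR0 : 0 < R := by linarith
  -- This gives `R/4 < N ≤ R/2`: dyadic, so that the bounds on `P_{>N}` apply, comparable to `R`,
  -- and low enough that `P_{≤R} P_{≤N} = P_{≤N}`.
  obtain ⟨k, hk1, hk2⟩ := exists_nat_pow_near (x := R / 2) (y := (2 : ℝ)) (by linarith)
    (by norm_num)
  rw [pow_succ] at hk2
  set N : ℝ := 2 ^ k with hN
  have hN0 : 0 < N := by positivity
  have hN1 : 1 ≤ N := one_le_pow₀ (by norm_num)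
  have hNR : 9 / 8 * N ≤ R := by linarith
  have hRk : R ≤ 4 * N := by linarith
  have hkR : N ≤ R := by linarith
  have hlS := one_le_log_of_three_le hS
  set lS := Real.log S with hlSdef
  set κ : ℝ := R ^ (δ - 1 / 2) with hκ
  have hκ0 : 0 ≤ κ := by positivity
  set E : ℝ := R ^ (-1 + 4 * δ) with hE
  have hE0 : 0 ≤ E := by positivity
  -- A gain `κ²`, squared by Young's inequality, times the mass `R` of the weight.
  have e1 : κ ^ 4 * R = E := by
    rw [hκ, hE, ← Real.rpow_natCast, ← Real.rpow_mul hR0.le, ← Real.rpow_add_one hR0.ne']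
    congr 1; push_cast; ring
  have e2 : R⁻¹ ≤ E := by
    rw [hE, ← Real.rpow_neg_one]
    exact Real.rpow_le_rpow_of_exponent_le hR (by linarith)
  have e3 : κ * R⁻¹ ≤ E := by
    rw [hE, hκ, ← Real.rpow_neg_one, ← Real.rpow_add hR0]
    exact Real.rpow_le_rpow_of_exponent_le hR (by linarith)
  -- kernels
  set kR := scaledKernel g R with hkRdef
  set kN := scaledKernel g N with hkNdef
  have ikR : Integrable kR := IsLPProfile.integrable g hR0
  have ikN : Integrable kN := IsLPProfile.integrable g hN0
  have hkRb : ∀ z, |kR z| ≤ C' * polyKernel 9 R z := fun z =>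
    (abs_scaledKernel_le hCg hR0 z).trans
      (mul_le_mul_of_nonneg_right hCgC' (polyKernel_nonneg 9 hR0.le z))
  have hkNb : ∀ z, |kN z| ≤ C' * polyKernel 9 R z := fun z => by
    refine (abs_scaledKernel_le hCg hN0 z).trans ?_
    rw [hC', mul_assoc]
    exact mul_le_mul_of_nonneg_left
      (polyKernel_le_of_comparable 9 hN0 hRk (by linarith) z) hCg0
  -- functions
  obtain ⟨Bu, hBu⟩ := hu.bounded
  obtain ⟨Bv, hBv⟩ := hv.bounded
  set w : ℝ → ℂ := fun y => u y - v y with hw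
  have wc : Continuous w := hu.continuous.sub hv.continuous
  have wb : ∀ y, ‖w y‖ ≤ Bu + Bv := fun y => (norm_sub_le _ _).trans (add_le_add (hBu y) (hBv y))
  have wL : ∀ y, ‖w y‖ ≤ (2 * A) * logWeight S y ^ (1 / 2 : ℝ) := fun y => by
    refine (norm_sub_le _ _).trans ?_
    have h1 := hu.size_half hp hA hS y
    have h2 := hv.size_half hp hA hS y
    linarith
  set W := kconv kR w with hW
  set wl := kconv kN w with hwl
  set wh : ℝ → ℂ := fun y => w y - wl y with hwh
  have Wc : Continuous W := continuous_kconv ikR wc wb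
  have wlc : Continuous wl := continuous_kconv ikN wc wb
  have whc : Continuous wh := wc.sub wlc
  have Wb : ∀ x, ‖W x‖ ≤ _ := norm_kconv_le ikR wb
  have wlb : ∀ x, ‖wl x‖ ≤ _ := norm_kconv_le ikN wb
  have whb : ∀ x, ‖wh x‖ ≤ (Bu + Bv) + (∫ z, |kN z|) * (Bu + Bv) := fun x =>
    (norm_sub_le _ _).trans (add_le_add (wb x) (wlb x))
  have WL : ∀ x, ‖W x‖ ≤ BW * logWeight S x ^ (1 / 2 : ℝ) := fun x =>
    norm_kconv_le_logWeight (n := 7) hCg hR hS (by norm_num) (by norm_num) (by positivity) wL x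
  have wlL : ∀ x, ‖wl x‖ ≤ BW * logWeight S x ^ (1 / 2 : ℝ) := fun x =>
    norm_kconv_le_logWeight (n := 7) hCg hN1 hS (by norm_num) (by norm_num) (by positivity) wL x
  have whL : ∀ x, ‖wh x‖ ≤ (Bh * κ) * logWeight S x ^ (1 / 2 : ℝ) := fun x => by
    have h1 := hu.high k x
    have h2 := hv.high k x
    have h3 : wh x = (u x - kconv kN u x) - (v x - kconv kN v x) := by
      simp only [hwh, hwl, hw]
      rw [kconv_sub ikN hu.continuous hv.continuous hBu hBv]
      ring
    rw [h3]
    refine (norm_sub_le _ _).trans ((add_le_add h1 h2).trans ?_)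
    have h4 : N ^ (δ - 1 / 2) ≤ 4 ^ |δ - 1 / 2| * κ := rpow_le_of_comparable hR0 hRk hkR
    have hL := one_le_logWeight hS x
    calc _ = 2 * A * N ^ (δ - 1 / 2) * logWeight S x ^ (1 / 2 : ℝ) := by ring
      _ ≤ 2 * A * (4 ^ |δ - 1 / 2| * κ) * logWeight S x ^ (1 / 2 : ℝ) := by gcongr
      _ = _ := by rw [hBh]; ring
  -- potential
  set V : ℝ → ℂ →L[ℝ] ℂ := fun x => dividedDiff p (u x) (v x) with hV
  have Vc : Continuous V := continuous_dividedDiff_comp hp hu.continuous hv.continuous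
  have Vb : ∀ x, ‖V x‖ ≤ p * (max Bu Bv) ^ (p - 1) := fun x =>
    norm_dividedDiff_le hp ((hBu x).trans (le_max_left _ _)) ((hBv x).trans (le_max_right _ _))
  have VL : ∀ x, ‖V x‖ ≤ DV * logWeight S x ^ a := norm_potential_le hp hA hS hu hv
  have VI : ∀ x y, ‖V x - V y‖ ≤ (CV * κ * logWeight S x ^ (a + 1 / 2)) *
      (1 + R * |x - y|) ^ 4 := hCV S R k u v hS hR hRk hkR hu hv
  have hVw : (fun y => powNonlin p (u y) - powNonlin p (v y)) = fun y => V y (w y) :=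
    funext fun y => powNonlin_sub hp (u y) (v y)
  set X := kcomm kR V wl with hX
  set Y := kcomm kR V wh with hY
  have Xc : Continuous X := continuous_kcomm ikR Vc wlc Vb wlb
  have Yc : Continuous Y := continuous_kcomm ikR Vc whc Vb whb
  have hwlw : ∀ x, kconv kR wl x = wl x := hg.kconv_large_small hρ hN0 hNR wc wb
  have VwC : Continuous fun y => V y (w y) := Vc.clm_apply wc
  have VwlC : Continuous fun y => V y (wl y) := Vc.clm_apply wlc
  have Vwb := norm_apply_le_of_bounds Vb wb
  have Vwlb := norm_apply_le_of_bounds Vb wlb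
  have hXeq : ∀ x, X x = kconv kR (fun y => V y (wl y)) x - V x (wl x) := fun x => by
    rw [hX, kcomm_eq ikR Vc wlc Vb wlb, hwlw]
  have hWhigh : ∀ x, W x - kconv kN W x = kconv kR wh x := fun x => by
    rw [hW, hg.kconv_small_large hρ hN0 hNR wc wb, kconv_sub ikR wc wlc wb wlb, hwlw]
  -- Here `Y` and `X` are the commutators of `P_{≤R}` and `V` applied to the high and the low part
  -- of `w`.
  have hdecomp : ∀ x, kconv kR (fun y => V y (w y)) x = V x (W x) + Y x + X x := fun x => by
    have h1 : kconv kR (fun y => V y (wh y)) x =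
        kconv kR (fun y => V y (w y)) x - kconv kR (fun y => V y (wl y)) x := by
      rw [← kconv_sub ikR VwC VwlC Vwb Vwlb]
      congr 1
      funext y
      simp only [hwh]
      rw [map_sub]
    have h2 : kconv kR wh x = W x - wl x := by
      rw [kconv_sub ikR wc wlc wb wlb, hwlw]
    rw [hXeq, hY, kcomm_eq ikR Vc whc Vb whb, h1, h2, map_sub]
    ring
  -- As `P_{≤R} w_l = w_l`, the commutator is `X = -P_{>R}(V w_l)`, and `P_{≤N} P_{>R} = 0`.
  have hXzero : ∀ x, kconv kN X x = 0 := fun x => by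
    have h1 : X = fun x => kconv kR (fun y => V y (wl y)) x - V x (wl x) := funext hXeq
    rw [h1, kconv_sub ikN (continuous_kconv ikR VwlC Vwlb) VwlC (norm_kconv_le ikR Vwlb) Vwlb,
      hg.kconv_small_large hρ hN0 hNR VwlC Vwlb, sub_self]
  -- pointwise bounds for the commutators
  set Q : ℝ → ℝ := kconv (polyKernel 5 R) fun y => ‖wl y‖ with hQ
  have ikP : Integrable (polyKernel 5 R) := integrable_polyKernel (by norm_num) hR0
  have wlb' : ∀ y, ‖‖wl y‖‖ ≤ (∫ z, |kN z|) * (Bu + Bv) := fun y => by rw [norm_norm]; exact wlb y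
  have Qc : Continuous Q := continuous_kconv ikP wlc.norm wlb'
  have Qb : ∀ x, |Q x| ≤ _ := norm_kconv_le ikP wlb'
  have Q0 : ∀ x, 0 ≤ Q x := kconv_polyKernel_nonneg 5 hR0.le wl
  have hXQ : ∀ x, ‖X x‖ ≤ C' * (CV * κ * logWeight S x ^ (a + 1 / 2)) * Q x := fun x =>
    norm_kcomm_le (by norm_num) hR0 hkRb (VI x) wlc wlb
  have QL : ∀ x, Q x ≤ c * BW * logWeight S x ^ (1 / 2 : ℝ) := fun x =>
    kconv_polyKernel_le_logWeight (n := 1) (by norm_num) hR hS (by norm_num) (by norm_num) hBW0 wlL x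
  have hLadd : ∀ x, logWeight S x ^ (a + 1 / 2) * logWeight S x ^ (1 / 2 : ℝ) =
      logWeight S x ^ (a + 1) := fun x => by
    rw [← Real.rpow_add (by linarith [one_le_logWeight hS x])]
    congr 1; ring
  have hXL : ∀ x, ‖X x‖ ≤ (KX * κ) * logWeight S x ^ (a + 1) := fun x => by
    have hL := one_le_logWeight hS x
    refine (hXQ x).trans ?_
    calc _ ≤ C' * (CV * κ * logWeight S x ^ (a + 1 / 2)) *
          (c * BW * logWeight S x ^ (1 / 2 : ℝ)) := by gcongr; exact QL x
      _ = _ := by rw [← hLadd, hKX]; ring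
  have hYL : ∀ x, ‖Y x‖ ≤ (Kh * κ ^ 2) * logWeight S x ^ (a + 1) := fun x => by
    have hL := one_le_logWeight hS x
    have h1 : ‖Y x‖ ≤ C' * (CV * κ * logWeight S x ^ (a + 1 / 2)) *
        kconv (polyKernel 5 R) (fun y => ‖wh y‖) x :=
      norm_kcomm_le (by norm_num) hR0 hkRb (VI x) whc whb
    have h2 := kconv_polyKernel_le_logWeight (n := 1) (m := 5) (by norm_num) hR hS (by norm_num)
      (by norm_num) (by positivity : 0 ≤ Bh * κ) whL x
    refine h1.trans ?_
    calc _ ≤ C' * (CV * κ * logWeight S x ^ (a + 1 / 2)) *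
          (c * (Bh * κ) * logWeight S x ^ (1 / 2 : ℝ)) := by gcongr
      _ = _ := by rw [← hLadd, hKh]; ring
  -- global bounds
  have Xb : ∃ b, ∀ x, ‖X x‖ ≤ b := ⟨_, fun x => by
    rw [hXeq x]
    exact (norm_sub_le _ _).trans (add_le_add (norm_kconv_le ikR Vwlb x) (Vwlb x))⟩
  have hVwh := norm_apply_le_of_bounds Vb whb
  have Yb : ∃ b, ∀ x, ‖Y x‖ ≤ b := ⟨_, fun x => by
    rw [hY, kcomm_eq ikR Vc whc Vb whb x]
    exact (norm_sub_le _ _).trans (add_le_add (norm_kconv_le ikR hVwh x)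
      (norm_apply_le_of_bounds Vb (norm_kconv_le ikR whb) x))⟩
  obtain ⟨bX, hbX⟩ := Xb
  obtain ⟨bY, hbY⟩ := Yb
  have nI : ∀ z : ℂ, ‖Complex.I * z‖ = ‖z‖ := fun z => by rw [norm_mul, Complex.norm_I, one_mul]
  have IVW := norm_apply_le_of_bounds Vb Wb
  have i1 : Integrable fun x => inner ℝ (W x) (Complex.I * V x (W x)) * sigmaWeight R x :=
    integrable_inner_sigma hR0 Wc (continuous_const.mul (Vc.clm_apply Wc)) Wb
      (fun x => by rw [nI]; exact IVW x)
  have i2 : Integrable fun x => inner ℝ (W x) (Complex.I * Y x) * sigmaWeight R x :=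
    integrable_inner_sigma hR0 Wc (continuous_const.mul Yc) Wb (fun x => by rw [nI]; exact hbY x)
  have i3 : Integrable fun x => inner ℝ (W x) (Complex.I * X x) * sigmaWeight R x :=
    integrable_inner_sigma hR0 Wc (continuous_const.mul Xc) Wb (fun x => by rw [nI]; exact hbX x)
  set M := ∫ x, ‖W x‖ ^ 2 * sigmaWeight R x with hM
  have hM0 : 0 ≤ M := integral_nonneg fun x => by
    have := (sigmaWeight_pos R x).le
    positivity
  have hlSa : 1 ≤ lS ^ a := Real.one_le_rpow hlS ha0
  have hMl : M ≤ lS ^ a * M := le_mul_of_one_le_left hM0 hlSa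
  set Λ := lS ^ (2 * (a + 1)) with hΛ
  have hΛ0 : 0 ≤ Λ := by positivity
  have hlog : ∀ q : ℝ, q ≤ 2 * (a + 1) → lS ^ q ≤ Λ := fun q hq =>
    Real.rpow_le_rpow_of_exponent_le hlS hq
  have hErr : ∀ q : ℝ, q ≤ 2 * (a + 1) → R⁻¹ * lS ^ q ≤ E * Λ := fun q hq =>
    mul_le_mul e2 (hlog q hq) (by positivity) hE0
  -- the four terms
  have T1 : |∫ x, inner ℝ (W x) (Complex.I * V x (W x)) * sigmaWeight R x| ≤
      (DV * 3 ^ a + DV * (8 * BW ^ 2 * wa)) * (lS ^ a * M + E * Λ) := by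
    have h := abs_integral_sigma_le_main hS hR hRS (F := fun x => inner ℝ (W x)
      (Complex.I * V x (W x))) ha0 hDV0 Wc Wb WL (fun x => by
        refine (abs_real_inner_le_norm _ _).trans ?_
        rw [nI]
        have := (V x).le_of_opNorm_le (VL x) (W x)
        calc ‖W x‖ * ‖V x (W x)‖ ≤ ‖W x‖ * (DV * logWeight S x ^ a * ‖W x‖) := by gcongr
          _ = _ := by ring)
    have h2 := hErr (a + 1) (by linarith)
    have h3 : 0 ≤ DV * 3 ^ a := by positivity
    have h4 : 0 ≤ DV * (8 * BW ^ 2 * wa) := by positivity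
    have h5 : 0 ≤ E * Λ := by positivity
    have h6 : 0 ≤ lS ^ a * M := by positivity
    calc _ ≤ _ := h
      _ ≤ DV * (3 ^ a * lS ^ a * M) + DV * (8 * BW ^ 2 * wa) * (E * Λ) := by gcongr
      _ ≤ _ := by nlinarith
  -- One `κ` comes from the increments of `V`, the other from the size of `w_h`.
  have T2 : |∫ x, inner ℝ (W x) (Complex.I * Y x) * sigmaWeight R x| ≤
      (1 + Kh ^ 2 * wa2) * (lS ^ a * M + E * Λ) := by
    have h := abs_integral_sigma_le_young hS hR hRS (F := fun x => inner ℝ (W x)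
      (Complex.I * Y x)) (Q := fun x => ‖W x‖) (K := Kh * κ ^ 2) (q := a + 1) (by linarith)
      Wc.norm (fun x => by rw [abs_norm]; exact Wb x) (fun x => by
        refine (abs_real_inner_le_norm _ _).trans ?_
        rw [nI, mul_comm]
        exact mul_le_mul_of_nonneg_right (hYL x) (norm_nonneg _))
    have h2 : (Kh * κ ^ 2) ^ 2 * (wa2 * R * Λ) = Kh ^ 2 * wa2 * (E * Λ) := by
      rw [← e1]; ring
    have h5 : 0 ≤ E * Λ := by positivity
    have h6 : 0 ≤ lS ^ a * M := by positivity
    have h7 : 0 ≤ Kh ^ 2 * wa2 := by positivity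
    calc _ ≤ _ := h
      _ = M + Kh ^ 2 * wa2 * (E * Λ) := by rw [h2]
      _ ≤ _ := by nlinarith
  -- Since `w_l = P_{≤N} W`, two applications of the weighted `L²` bound lead from `Q` back to the
  -- mass of `W`.
  have hQint : ∫ x, Q x ^ 2 * sigmaWeight R x ≤
      c ^ 2 * (C' ^ 2 * (c ^ 2 * (1 + 2 * w2 * BW ^ 2)) + 2 * w2 * BW ^ 2) *
        (lS ^ a * M + E * Λ) := by
    have hwlW : ∀ x, ‖wl x‖ ≤ C' * kconv (polyKernel 5 R) (fun y => ‖W y‖) x := fun x => by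
      have h1 : wl x = kconv kN W x := by
        rw [hW, hg.kconv_small_large hρ hN0 hNR wc wb]
      rw [h1]
      exact norm_kconv_le_kconv_norm (by norm_num) hR0
        (abs_le_polyKernel_of_le (by norm_num) hR0 hC'0 hkNb) Wc Wb x
    have h1 := integral_sq_kconv_le_of_majorant hS hR hRS Wc Wb WL hBW0 hwlW
    have h2 := integral_sq_kconv_sigma_le (m := 5) le_rfl hS hR hRS wlc wlb (B := BW)
      (fun y => (wlL y).trans (by
        refine mul_le_mul_of_nonneg_left ?_ hBW0
        nth_rewrite 2 [← Real.rpow_one (logWeight S y)]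
        exact logWeight_rpow_le_rpow hS (by norm_num) y))
    have h3 : BW ^ 2 * R⁻¹ * lS ^ (2 : ℝ) ≤ BW ^ 2 * (lS ^ a * M + E * Λ) := by
      rw [mul_assoc]
      have := hErr 2 (by linarith)
      have h6 : 0 ≤ lS ^ a * M := by positivity
      gcongr
      linarith
    set Tt := lS ^ a * M + E * Λ with hTt
    have hMT : M ≤ Tt := by
      have h5 : 0 ≤ E * Λ := by positivity
      linarith
    calc _ ≤ _ := h2
      _ ≤ c ^ 2 * (C' ^ 2 * (c ^ 2 * (M + 2 * w2 * (BW ^ 2 * R⁻¹ * lS ^ (2 : ℝ)))) +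
          2 * w2 * (BW ^ 2 * R⁻¹ * lS ^ (2 : ℝ))) := by gcongr
      _ ≤ c ^ 2 * (C' ^ 2 * (c ^ 2 * (Tt + 2 * w2 * (BW ^ 2 * Tt))) +
          2 * w2 * (BW ^ 2 * Tt)) := by gcongr
      _ = _ := by ring
  -- The single `κ` in `X` would leave an error `κ² R = R^{2δ}`. Because `P_{≤N} X = 0`, the
  -- function `W` is replaced by `W - P_{≤N} W = P_{≤R} w_h`, which supplies the second `κ`.
  have T3 : |∫ x, inner ℝ (W x) (Complex.I * X x) * sigmaWeight R x| ≤
      (c ^ 2 * (C' ^ 2 * (c ^ 2 * (1 + 2 * w2 * BW ^ 2)) + 2 * w2 * BW ^ 2) + K1 ^ 2 * wa2) *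
        (lS ^ a * M + E * Λ) + 2 * c * C' * BW * KX * wa3 * (lS ^ a * M + E * Λ) := by
    have kNc : Continuous kN := continuous_scaledKernel g.continuous N
    have Xc' : Continuous fun x => Complex.I * X x := continuous_const.mul Xc
    rw [integral_inner_eq_of_kconv_eq_zero kNc (hg.scaledKernel_neg N) hR0
      (abs_le_polyKernel_of_le (by norm_num) hR0 hC'0 hkNb) Wc Xc' Wb
      (fun x => by rw [nI]; exact hbX x) (fun x => by rw [kconv_I_mul, hXzero, mul_zero])]
    refine (abs_add_le _ _).trans (add_le_add ?_ ?_)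
    · have hWh : ∀ x, ‖W x - kconv kN W x‖ ≤ (Cg * c * (Bh * κ)) * logWeight S x ^ (1 / 2 : ℝ) :=
        fun x => by
        rw [hWhigh]
        exact norm_kconv_le_logWeight (n := 7) hCg hR hS (by norm_num) (by norm_num)
          (by positivity) whL x
      have h := abs_integral_sigma_le_young hS hR hRS (F := fun x => inner ℝ (W x - kconv kN W x)
        (Complex.I * X x)) (Q := Q) (K := K1 * κ ^ 2) (q := a + 1) (by linarith)
        Qc Qb (fun x => by
          have hL := one_le_logWeight hS x
          refine (abs_real_inner_le_norm _ _).trans ?_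
          rw [nI]
          calc _ ≤ ((Cg * c * (Bh * κ)) * logWeight S x ^ (1 / 2 : ℝ)) *
                (C' * (CV * κ * logWeight S x ^ (a + 1 / 2)) * Q x) :=
                mul_le_mul (hWh x) (hXQ x) (norm_nonneg _) (by positivity)
            _ = _ := by rw [← hLadd, hK1]; ring)
      have h2 : (K1 * κ ^ 2) ^ 2 * (wa2 * R * Λ) = K1 ^ 2 * wa2 * (E * Λ) := by
        rw [← e1]; ring
      have h6 : 0 ≤ lS ^ a * M := by positivity
      have h7 : 0 ≤ K1 ^ 2 * wa2 := by positivity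
      calc _ ≤ _ := h
        _ = (∫ x, Q x ^ 2 * sigmaWeight R x) + K1 ^ 2 * wa2 * (E * Λ) := by rw [h2]
        _ ≤ _ := by nlinarith
    · have h := abs_integral_weight_commutator_le (n := 3) hS hR hRS kNc
        (abs_le_polyKernel_of_le (by norm_num) hR0 hC'0 hkNb) Wc
        Xc' (q := a + 1) (D := KX * κ)
        (by linarith)
        (by push_cast; linarith) WL (fun x => by rw [nI]; exact hXL x)
      have h2 : (κ * R⁻¹) * lS ^ (a + 1 + 1 / 2) ≤ lS ^ a * M + E * Λ := by
        have h6 : 0 ≤ lS ^ a * M := by positivity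
        have := mul_le_mul e3 (hlog (a + 1 + 1 / 2) (by linarith)) (by positivity) hE0
        linarith
      calc _ ≤ _ := h
        _ = 2 * c * C' * BW * KX * wa3 * ((κ * R⁻¹) * lS ^ (a + 1 + 1 / 2)) := by ring
        _ ≤ _ := by gcongr
  have hsplit : ∫ x, inner ℝ (W x) (Complex.I * kconv kR (fun y => powNonlin p (u y) -
      powNonlin p (v y)) x) * sigmaWeight R x =
      (∫ x, inner ℝ (W x) (Complex.I * V x (W x)) * sigmaWeight R x) +
      (∫ x, inner ℝ (W x) (Complex.I * Y x) * sigmaWeight R x) +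
      ∫ x, inner ℝ (W x) (Complex.I * X x) * sigmaWeight R x := by
    have i12 : Integrable (fun x => inner ℝ (W x) (Complex.I * V x (W x)) * sigmaWeight R x +
        inner ℝ (W x) (Complex.I * Y x) * sigmaWeight R x) := i1.add i2
    rw [← integral_add i1 i2, ← integral_add i12 i3, hVw]
    congr 1
    funext x
    rw [hdecomp, mul_add, mul_add, inner_add_right, inner_add_right]
    ring
  rw [hsplit]
  refine (abs_add_le _ _).trans ?_
  have := abs_add_le (∫ x, inner ℝ (W x) (Complex.I * V x (W x)) * sigmaWeight R x)
    (∫ x, inner ℝ (W x) (Complex.I * Y x) * sigmaWeight R x)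
  linarith

theorem inner_mul_I_self (z : ℂ) : inner ℝ z (Complex.I * z) = 0 := by
  rw [Complex.inner]
  simp
  ring

/-- The dispersive contribution to the evolution of the localized mass. -/
theorem exists_dispersive_energy_bound {ρ : ℝ → ℝ} (hρ : IsLPCutoff ρ) {g : 𝓢(ℝ, ℝ)}
    (hg : IsLPProfile ρ g) {A : ℝ} (hA : 0 ≤ A) :
    ∃ C, 0 ≤ C ∧ ∀ (S R : ℝ) (w : ℝ → ℂ), 3 ≤ S → 1 ≤ R → R ≤ S → Continuous w →
      (∃ B, ∀ y, ‖w y‖ ≤ B) → (∀ y, ‖w y‖ ≤ A * logWeight S y ^ (1 / 2 : ℝ)) →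
      |∫ x, inner ℝ (kconv (scaledKernel g R) w x) (Complex.I * (R • R • kconv (scaledKernel
          (SchwartzMap.derivCLM ℝ ℝ (SchwartzMap.derivCLM ℝ ℝ g)) R) w x)) * sigmaWeight R x| ≤
        C * ((∫ x, ‖kconv (scaledKernel g R) w x‖ ^ 2 * sigmaWeight R x) +
          R⁻¹ * Real.log S ^ (2 : ℝ)) := by
  set g' := SchwartzMap.derivCLM ℝ ℝ g with hg'
  set g'' := SchwartzMap.derivCLM ℝ ℝ g' with hg''
  obtain ⟨C0, hC00, hC0⟩ := g.abs_le_polyKernel (2 + 1)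
  obtain ⟨C1, hC10, hC1⟩ := g'.abs_le_polyKernel 5
  have hc := polyMass_nonneg
  have hw2 := weightConst_nonneg 2
  set c := polyMass
  set w2 := weightConst 2
  set BW : ℝ := C0 * c * A with hBW
  have hBW0 : 0 ≤ BW := by positivity
  set K : ℝ := 2 * (C1 * (2 * 4 ^ 5)) with hK
  have hK0 : 0 ≤ K := by positivity
  refine ⟨1 + K ^ 2 * c ^ 2 * (1 + 2 * w2 * BW ^ 2), by positivity, ?_⟩
  intro S R w hS hR hRS wc ⟨Bw, wb⟩ wL
  have hR0 : 0 < R := by linarith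
  have h2R0 : 0 < 2 * R := by linarith
  have ig := IsLPProfile.integrable g hR0
  have ig' := IsLPProfile.integrable g' hR0
  have ig'' := IsLPProfile.integrable g'' hR0
  set W : ℝ → ℂ := kconv (scaledKernel g R) w with hW
  set W1 : ℝ → ℂ := fun x => R • kconv (scaledKernel g' R) w x with hW1
  set W2 : ℝ → ℂ := fun x => R • R • kconv (scaledKernel g'' R) w x with hW2
  have Wc : Continuous W := continuous_kconv ig wc wb
  have W1c : Continuous W1 := (continuous_kconv ig' wc wb).const_smul R
  have W2c : Continuous W2 := ((continuous_kconv ig'' wc wb).const_smul R).const_smul R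
  have Wb := norm_kconv_le ig wb
  have W1b : ∀ x, ‖W1 x‖ ≤ R * ((∫ z, |scaledKernel g' R z|) * Bw) := fun x => by
    rw [hW1, norm_smul, Real.norm_of_nonneg hR0.le]
    exact mul_le_mul_of_nonneg_left (norm_kconv_le ig' wb x) hR0.le
  have W2b : ∀ x, ‖W2 x‖ ≤ R * (R * ((∫ z, |scaledKernel g'' R z|) * Bw)) := fun x => by
    rw [hW2, norm_smul, norm_smul, Real.norm_of_nonneg hR0.le]
    exact mul_le_mul_of_nonneg_left (mul_le_mul_of_nonneg_left (norm_kconv_le ig'' wb x) hR0.le)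
      hR0.le
  have WL : ∀ x, ‖W x‖ ≤ BW * logWeight S x ^ (1 / 2 : ℝ) := fun x =>
    norm_kconv_le_logWeight (n := 1) hC0 hR hS (by norm_num) (by norm_num) hA wL x
  have d1 : ∀ x, HasDerivAt W (W1 x) x := hasDerivAt_kconv_scaledKernel g hR0 wc wb
  have d2 : ∀ x, HasDerivAt W1 (W2 x) x := fun x =>
    (hasDerivAt_kconv_scaledKernel g' hR0 wc wb x).const_smul R
  -- `W` is reproduced by the kernel at frequency `2R`, on which the derivative can fall. This
  -- bounds `∂ₓ W` by `W` itself, whereas differentiating the original kernel would only involve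
  -- `w`.
  have W1eq : ∀ x, W1 x = (2 * R) • kconv (scaledKernel g' (2 * R)) W x := fun x => by
    have h1 := hasDerivAt_kconv_scaledKernel g h2R0 Wc Wb x
    have h2 : kconv (scaledKernel g (2 * R)) W = W :=
      funext (hg.kconv_large_small hρ hR0 (by linarith) wc wb)
    rw [h2] at h1
    exact (d1 x).unique h1
  have W1F : ∀ x, ‖R⁻¹ • W1 x‖ ≤ K * kconv (polyKernel 5 R) (fun y => ‖W y‖) x := fun x => by
    have h1 := norm_kconv_le_kconv_norm (m := 5) (by norm_num) hR0
      (k := scaledKernel g' (2 * R)) (C := C1 * (2 * 4 ^ 5)) (fun z => by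
        refine (abs_scaledKernel_le hC1 h2R0 z).trans ?_
        rw [mul_assoc]
        exact mul_le_mul_of_nonneg_left
          (polyKernel_le_of_comparable 5 h2R0 (by linarith) le_rfl z) hC10) Wc Wb x
    rw [W1eq, smul_smul, show R⁻¹ * (2 * R) = 2 by field_simp, norm_smul, Real.norm_two, hK,
      mul_assoc]
    linarith
  have hM := integral_sq_kconv_le_of_majorant hS hR hRS Wc Wb WL hBW0 W1F
  set M := ∫ x, ‖W x‖ ^ 2 * sigmaWeight R x with hMdef
  have iIW1 := integrable_inner_sigma hR0 Wc (continuous_const.mul W1c) Wb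
    (X := fun x => Complex.I * W1 x)
    (fun x => by rw [norm_mul, Complex.norm_I, one_mul]; exact W1b x)
  have iIW2 := integrable_inner_sigma hR0 Wc (continuous_const.mul W2c) Wb
    (X := fun x => Complex.I * W2 x)
    (fun x => by rw [norm_mul, Complex.norm_I, one_mul]; exact W2b x)
  set σ' : ℝ → ℝ := fun x => -(sigmaWeight R x * (x / R / japaneseBracket (x / R) / R)) with hσ'
  -- The other term of the product rule is the pairing of `W1` with `I * W1`, which is zero.
  have hder : ∀ x, HasDerivAt (fun x => inner ℝ (W x) (Complex.I * W1 x))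
      (inner ℝ (W x) (Complex.I * W2 x)) x := fun x => by
    have := (d1 x).inner ℝ ((d2 x).const_mul Complex.I)
    rwa [inner_mul_I_self, add_zero] at this
  have σ'b := abs_deriv_sigmaWeight_le hR0
  have σ'c : Continuous σ' := by
    have : ∀ x, japaneseBracket (x / R) ≠ 0 := fun x =>
      (lt_of_lt_of_le one_pos (one_le_japaneseBracket _)).ne'
    have h1 := continuous_sigmaWeight R
    have h2 := continuous_japaneseBracket
    exact (h1.mul (((continuous_id.div_const R).div (h2.comp (continuous_id.div_const R))
      this).div_const R)).neg
  have iσ' : Integrable fun x => inner ℝ (W x) (Complex.I * W1 x) * σ' x := by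
    refine (iIW1.norm.mul_const R⁻¹).mono' ((Wc.inner (continuous_const.mul W1c)).mul
      σ'c).aestronglyMeasurable (Filter.Eventually.of_forall fun x => ?_)
    rw [norm_mul, norm_mul, mul_assoc]
    refine mul_le_mul_of_nonneg_left ?_ (norm_nonneg _)
    rw [Real.norm_of_nonneg (sigmaWeight_pos R x).le, ← div_eq_mul_inv]
    exact σ'b x
  have ibp : ∫ x, inner ℝ (W x) (Complex.I * W1 x) * σ' x =
      -∫ x, inner ℝ (W x) (Complex.I * W2 x) * sigmaWeight R x :=
    integral_mul_deriv_eq_deriv_mul_of_integrable (fun x _ => hder x)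
      (fun x _ => hasDerivAt_sigmaWeight R x) iσ' iIW2 iIW1
  have iM := integrable_sq_sigma hR0 Wc.norm (B := _) (fun x => by rw [abs_norm]; exact Wb x)
  have W1c' : Continuous fun x => ‖R⁻¹ • W1 x‖ := (W1c.const_smul R⁻¹).norm
  have iM1 := integrable_sq_sigma hR0 W1c'
    (B := R⁻¹ * (R * ((∫ z, |scaledKernel g' R z|) * Bw))) (fun x => by
      rw [abs_norm, norm_smul, Real.norm_of_nonneg (inv_pos.2 hR0).le]
      exact mul_le_mul_of_nonneg_left (W1b x) (inv_pos.2 hR0).le)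
  rw [← abs_neg, ← ibp, ← Real.norm_eq_abs]
  have hbound : ‖∫ x, inner ℝ (W x) (Complex.I * W1 x) * σ' x‖ ≤
      ∫ x, (‖W x‖ ^ 2 * sigmaWeight R x + ‖R⁻¹ • W1 x‖ ^ 2 * sigmaWeight R x) := by
    refine norm_integral_le_of_norm_le (iM.add iM1) (Filter.Eventually.of_forall fun x => ?_)
    have hs := (sigmaWeight_pos R x).le
    have h1 := abs_real_inner_le_norm (W x) (Complex.I * W1 x)
    rw [norm_mul, Complex.norm_I, one_mul] at h1
    rw [norm_mul, Real.norm_eq_abs, Real.norm_eq_abs]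
    calc _ ≤ (‖W x‖ * ‖W1 x‖) * (sigmaWeight R x / R) :=
          mul_le_mul h1 (σ'b x) (abs_nonneg _) (by positivity)
      _ = (‖W x‖ * ‖R⁻¹ • W1 x‖) * sigmaWeight R x := by
          have hn : ‖R⁻¹ • W1 x‖ = R⁻¹ * ‖W1 x‖ := by
            rw [norm_smul, Real.norm_of_nonneg (inv_pos.2 hR0).le]
          rw [hn]; ring
      _ ≤ (‖W x‖ ^ 2 + ‖R⁻¹ • W1 x‖ ^ 2) * sigmaWeight R x := by
          refine mul_le_mul_of_nonneg_right ?_ hs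
          nlinarith [sq_nonneg (‖W x‖ - ‖R⁻¹ • W1 x‖), sq_nonneg (‖W x‖), sq_nonneg ‖R⁻¹ • W1 x‖]
      _ = _ := by ring
  refine hbound.trans ?_
  rw [integral_add iM iM1]
  have hM0 : 0 ≤ M := integral_nonneg fun x => mul_nonneg (sq_nonneg _) (sigmaWeight_pos R x).le
  have hE0 : 0 ≤ R⁻¹ * Real.log S ^ (2 : ℝ) := by
    have := one_le_log_of_three_le hS
    positivity
  set E := R⁻¹ * Real.log S ^ (2 : ℝ) with hE
  have h1 : K ^ 2 * (c ^ 2 * (M + 2 * w2 * (BW ^ 2 * R⁻¹ * Real.log S ^ (2 : ℝ)))) =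
    K ^ 2 * c ^ 2 * M + K ^ 2 * c ^ 2 * (2 * w2 * BW ^ 2) * E := by rw [hE]; ring
  rw [h1] at hM
  have p1 : 0 ≤ K ^ 2 * c ^ 2 * (2 * w2 * BW ^ 2) * M := by positivity
  have p2 : 0 ≤ K ^ 2 * c ^ 2 * E := by positivity
  nlinarith

/-! ### From the distributional equation to a time derivative of convolutions -/

/-- A continuous function on the line with vanishing distributional derivative is constant. -/
theorem eq_of_integral_deriv_smul_eq_zero {e : ℝ → ℂ} (he : Continuous e)
    (h : ∀ χ : ℝ → ℝ, ContDiff ℝ ∞ χ → HasCompactSupport χ → ∫ s, deriv χ s • e s = 0)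
    (s t : ℝ) : e s = e t := by
  let φ : ℕ → ContDiffBump (0 : ℝ) := fun n =>
    ⟨1 / ((n : ℝ) + 1), 2 * (1 / ((n : ℝ) + 1)), by positivity, by
      have : 0 < 1 / ((n : ℝ) + 1) := by positivity
      linarith⟩
  have hφ : Filter.Tendsto (fun n => (φ n).rOut) Filter.atTop (𝓝 0) := by
    have := tendsto_one_div_add_atTop_nhds_zero_nat (𝕜 := ℝ).const_mul 2
    rwa [mul_zero] at this
  -- The mollified function has zero derivative, by the hypothesis tested on reflected translates of
  -- the bump; the mollifications converge pointwise to `e`.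
  have hconst : ∀ n, (convolution ((φ n).normed volume) e (ContinuousLinearMap.lsmul ℝ ℝ) volume) s =
      (convolution ((φ n).normed volume) e (ContinuousLinearMap.lsmul ℝ ℝ) volume) t := by
    intro n
    have hd := fun x : ℝ =>
      ((φ n).hasCompactSupport_normed (μ := volume)).hasDerivAt_convolution_left (μ := volume)
      (ContinuousLinearMap.lsmul ℝ ℝ) ((φ n).contDiff_normed (n := 1)) (he.locallyIntegrable) x
    refine is_const_of_deriv_eq_zero (fun x => (hd x).differentiableAt) (fun x => ?_) s t
    rw [(hd x).deriv, convolution_lsmul_swap]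
    have hc : ContDiff ℝ ∞ ((φ n).normed volume) := (φ n).contDiff_normed
    have h1 := h (fun y => (φ n).normed volume (x - y)) (hc.comp (contDiff_const.sub contDiff_id))
      ((φ n).hasCompactSupport_normed.comp_homeomorph (Homeomorph.subLeft x))
    have h2 : ∀ y, deriv (fun y => (φ n).normed volume (x - y)) y =
        -deriv ((φ n).normed volume) (x - y) := deriv_comp_const_sub _ _
    simp_rw [h2, neg_smul, integral_neg, neg_eq_zero] at h1
    exact h1
  have l1 := ContDiffBump.convolution_tendsto_right_of_continuous (μ := volume) hφ he s
  have l2 := ContDiffBump.convolution_tendsto_right_of_continuous (μ := volume) hφ he t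
  simp_rw [hconst] at l1
  exact tendsto_nhds_unique l1 l2

/-- `i ∂ₜ u + ∂ₓ² u = q` in the sense of space-time distributions. -/
def IsWeakSolution (u q : ℝ → ℝ → ℂ) : Prop :=
  ∀ ψ : ℝ × ℝ → ℂ, ContDiff ℝ ∞ ψ → HasCompactSupport ψ →
    ∫ z : ℝ × ℝ, u z.1 z.2 * (-Complex.I * deriv (fun s : ℝ => ψ (s, z.2)) z.1
        + iteratedDeriv 2 (fun y : ℝ => ψ (z.1, y)) z.2)
      = ∫ z : ℝ × ℝ, q z.1 z.2 * ψ z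

/-- Bounded in space, uniformly on compact time intervals. -/
def LocallyBoundedInTime (u : ℝ → ℝ → ℂ) : Prop :=
  ∀ T : ℝ, ∃ B, ∀ t, |t| ≤ T → ∀ y, ‖u t y‖ ≤ B

theorem LocallyBoundedInTime.bound {u : ℝ → ℝ → ℂ} (h : LocallyBoundedInTime u) (t : ℝ) :
    ∃ B, ∀ y, ‖u t y‖ ≤ B :=
  let ⟨B, hB⟩ := h |t|
  ⟨B, hB t le_rfl⟩

theorem LocallyBoundedInTime.eventually {u : ℝ → ℝ → ℂ} (h : LocallyBoundedInTime u) (t : ℝ) :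
    ∃ B, ∀ᶠ s in 𝓝 t, ∀ y, ‖u s y‖ ≤ B := by
  obtain ⟨B, hB⟩ := h (|t| + 1)
  refine ⟨B, ?_⟩
  filter_upwards [Metric.ball_mem_nhds t one_pos] with s hs y
  refine hB s ?_ y
  rw [Metric.mem_ball, Real.dist_eq] at hs
  have := abs_add_le (s - t) t
  rw [sub_add_cancel] at this
  linarith

section Weak
variable {u q : ℝ → ℝ → ℂ}

theorem hasCompactSupport_mul_prod {χ k : ℝ → ℝ} (hχ : HasCompactSupport χ)
    (hk : HasCompactSupport k) (x : ℝ) :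
    HasCompactSupport fun z : ℝ × ℝ => χ z.1 * k (x - z.2) := by
  have hk' : HasCompactSupport fun y => k (x - y) := hk.comp_homeomorph (Homeomorph.subLeft x)
  refine HasCompactSupport.intro (hχ.isCompact.prod hk'.isCompact) fun z hz => ?_
  rw [Set.mem_prod, not_and_or] at hz
  rcases hz with hz | hz
  · rw [image_eq_zero_of_notMem_tsupport hz, zero_mul]
  · rw [image_eq_zero_of_notMem_tsupport (f := fun y => k (x - y)) hz, mul_zero]

theorem integrable_mul_prod (hu : Continuous fun z : ℝ × ℝ => u z.1 z.2) {χ k : ℝ → ℝ}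
    (hχ : HasCompactSupport χ) (hk : HasCompactSupport k) (hχc : Continuous χ) (hkc : Continuous k)
    (x : ℝ) : Integrable fun z : ℝ × ℝ => u z.1 z.2 * ((χ z.1 * k (x - z.2) : ℝ) : ℂ) := by
  refine Continuous.integrable_of_hasCompactSupport (by fun_prop) ?_
  refine HasCompactSupport.mul_left ?_
  exact (hasCompactSupport_mul_prod hχ hk x).comp_left (g := Complex.ofReal) Complex.ofReal_zero

theorem integral_mul_prod (hu : Continuous fun z : ℝ × ℝ => u z.1 z.2) {χ k : ℝ → ℝ}
    (hχ : HasCompactSupport χ) (hk : HasCompactSupport k) (hχc : Continuous χ) (hkc : Continuous k)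
    (x : ℝ) : ∫ z : ℝ × ℝ, u z.1 z.2 * ((χ z.1 * k (x - z.2) : ℝ) : ℂ) =
      ∫ s, χ s • kconv k (u s) x := by
  rw [Measure.volume_eq_prod, integral_prod _ (integrable_mul_prod hu hχ hk hχc hkc x)]
  congr 1
  funext s
  unfold kconv
  rw [← integral_smul]
  congr 1
  funext y
  rw [Complex.real_smul, Complex.real_smul]
  push_cast
  ring

theorem continuous_kconv_time {k : ℝ → ℝ} (hk : Integrable k)
    (hu : Continuous fun z : ℝ × ℝ => u z.1 z.2) (hb : LocallyBoundedInTime u) :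
    Continuous fun z : ℝ × ℝ => kconv k (u z.1) z.2 :=
  continuous_kconv_param hk hu hb.eventually

/-- The test function is `χ(s) k(x - y)`: its pairing in `y` is a convolution at `x`, and the two
signs from `∂_y²` cancel. -/
theorem IsWeakSolution.integral_deriv_smul_kconv (h : IsWeakSolution u q)
    (hu : Continuous fun z : ℝ × ℝ => u z.1 z.2) (hq : Continuous fun z : ℝ × ℝ => q z.1 z.2)
    {χ k : ℝ → ℝ} (hχ : HasCompactSupport χ) (hχs : ContDiff ℝ ∞ χ)
    (hk : HasCompactSupport k) (hks : ContDiff ℝ ∞ k) (x : ℝ) :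
    -Complex.I * (∫ s, deriv χ s • kconv k (u s) x) +
      (∫ s, χ s • kconv (deriv (deriv k)) (u s) x) = ∫ s, χ s • kconv k (q s) x := by
  have hχ' : ContDiff ℝ ∞ (deriv χ) := hχs.deriv'
  have hk' : ContDiff ℝ ∞ (deriv k) := hks.deriv'
  have hk'' : ContDiff ℝ ∞ (deriv (deriv k)) := hk'.deriv'
  have hdiff : ∀ {f : ℝ → ℝ}, ContDiff ℝ ∞ f → ∀ y, HasDerivAt f (deriv f y) y := fun hf y =>
    (hf.differentiable (by simp) y).hasDerivAt
  have key := h (fun z => ((χ z.1 * k (x - z.2) : ℝ) : ℂ))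
    (Complex.ofRealCLM.contDiff.comp ((hχs.comp contDiff_fst).mul
      (hks.comp (contDiff_const.sub contDiff_snd))))
    ((hasCompactSupport_mul_prod hχ hk x).comp_left (g := Complex.ofReal) Complex.ofReal_zero)
  have d1 : ∀ s y : ℝ, deriv (fun s : ℝ => ((χ s * k (x - y) : ℝ) : ℂ)) s =
      ((deriv χ s * k (x - y) : ℝ) : ℂ) := fun s y =>
    ((hdiff hχs s).mul_const (k (x - y))).ofReal_comp.deriv
  have d2 : ∀ s y : ℝ, iteratedDeriv 2 (fun y : ℝ => ((χ s * k (x - y) : ℝ) : ℂ)) y =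
      ((χ s * deriv (deriv k) (x - y) : ℝ) : ℂ) := fun s y => by
    have e1 : deriv (fun y : ℝ => ((χ s * k (x - y) : ℝ) : ℂ)) =
        fun y : ℝ => ((χ s * -deriv k (x - y) : ℝ) : ℂ) := by
      funext y
      refine HasDerivAt.deriv (HasDerivAt.ofReal_comp (HasDerivAt.const_mul _ ?_))
      exact (hdiff hks (x - y)).comp_const_sub x y
    rw [iteratedDeriv_succ, iteratedDeriv_one, e1]
    refine HasDerivAt.deriv (HasDerivAt.ofReal_comp (HasDerivAt.const_mul _ ?_))
    have := ((hdiff hk' (x - y)).comp_const_sub x y).neg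
    rwa [neg_neg] at this
  simp_rw [d1, d2] at key
  have i1 := (integrable_mul_prod hu hχ.deriv hk hχ'.continuous hks.continuous x).const_mul
    (-Complex.I)
  have i2 := integrable_mul_prod hu hχ hk.deriv.deriv hχs.continuous hk''.continuous x
  rw [← integral_mul_prod hu hχ.deriv hk hχ'.continuous hks.continuous x,
    ← integral_mul_prod hu hχ hk.deriv.deriv hχs.continuous hk''.continuous x,
    ← integral_mul_prod hq hχ hk hχs.continuous hks.continuous x, ← key, ← integral_const_mul,
    ← integral_add i1 i2]
  congr 1
  funext z
  ring

end Weak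

section Weak
variable {u q : ℝ → ℝ → ℂ}

theorem continuous_kconv_slice {k : ℝ → ℝ} (hk : Integrable k)
    (hu : Continuous fun z : ℝ × ℝ => u z.1 z.2) (hb : LocallyBoundedInTime u) (x : ℝ) :
    Continuous fun s => kconv k (u s) x :=
  (continuous_kconv_time hk hu hb).comp (f := fun s : ℝ => (s, x)) (by fun_prop)

/-- The difference between the convolved solution and the time primitive `∫ G` is continuous with
zero distributional derivative in time, hence constant. -/
theorem IsWeakSolution.kconv_sub_eq_of_hasCompactSupport (h : IsWeakSolution u q)
    (hu : Continuous fun z : ℝ × ℝ => u z.1 z.2) (hq : Continuous fun z : ℝ × ℝ => q z.1 z.2)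
    (hub : LocallyBoundedInTime u) (hqb : LocallyBoundedInTime q)
    {k : ℝ → ℝ} (hk : HasCompactSupport k) (hks : ContDiff ℝ ∞ k) (x s t : ℝ) :
    kconv k (u t) x - kconv k (u s) x = ∫ τ in s..t,
      (Complex.I * kconv (deriv (deriv k)) (u τ) x - Complex.I * kconv k (q τ) x) := by
  have hk'' : ContDiff ℝ ∞ (deriv (deriv k)) := hks.deriv'.deriv'
  have ik := hks.continuous.integrable_of_hasCompactSupport (μ := volume) hk
  have ik'' := hk''.continuous.integrable_of_hasCompactSupport (μ := volume) hk.deriv.deriv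
  have cf := continuous_kconv_slice ik hu hub x
  have cf2 := continuous_kconv_slice ik'' hu hub x
  have cq := continuous_kconv_slice ik hq hqb x
  set G : ℝ → ℂ := fun τ => Complex.I * kconv (deriv (deriv k)) (u τ) x -
    Complex.I * kconv k (q τ) x with hG
  have cG : Continuous G := (continuous_const.mul cf2).sub (continuous_const.mul cq)
  have dG : ∀ τ, HasDerivAt (fun t => ∫ τ in s..t, G τ) (G τ) τ := fun τ =>
    intervalIntegral.integral_hasDerivAt_right (cG.intervalIntegrable _ _)
      (cG.stronglyMeasurableAtFilter _ _) cG.continuousAt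
  have cI : Continuous fun t => ∫ τ in s..t, G τ :=
    continuous_iff_continuousAt.2 fun τ => (dG τ).continuousAt
  have key := eq_of_integral_deriv_smul_eq_zero (e := fun t => kconv k (u t) x - ∫ τ in s..t, G τ)
    (cf.sub cI) (fun χ hχs hχ => ?_) s t
  · simp only [intervalIntegral.integral_same, sub_zero] at key
    rw [key]; ring
  · have hχ' : Continuous (deriv χ) := hχs.continuous_deriv (by simp)
    have e1 := h.integral_deriv_smul_kconv hu hq hχ hχs hk hks x
    have i1 : ∀ {f : ℝ → ℂ}, Continuous f → Integrable fun s => χ s • f s := fun hf =>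
      (hχs.continuous.smul hf).integrable_of_hasCompactSupport hχ.smul_right
    have i2 : ∀ {f : ℝ → ℂ}, Continuous f → Integrable fun s => deriv χ s • f s := fun hf =>
      (hχ'.smul hf).integrable_of_hasCompactSupport hχ.deriv.smul_right
    have e2 : ∫ τ, deriv χ τ • (∫ τ in s..τ, G τ) = -∫ τ, χ τ • G τ := by
      have := integral_bilinear_hasDerivAt_right_eq_neg_left_of_integrable
        (L := ContinuousLinearMap.lsmul ℝ ℝ) (u := χ) (u' := deriv χ)
        (v := fun t => ∫ τ in s..t, G τ) (v' := G)
        (fun x _ => (hχs.differentiable (by simp) x).hasDerivAt) (fun x _ => dG x) (i1 cG)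
        (i2 cI) (i1 cI)
      simp only [ContinuousLinearMap.lsmul_apply] at this
      rw [this, neg_neg]
    simp_rw [smul_sub]
    rw [integral_sub (i2 cf) (i2 cI), e2]
    have e3 : ∫ τ, χ τ • G τ = Complex.I * (∫ τ, χ τ • kconv (deriv (deriv k)) (u τ) x) -
        Complex.I * ∫ τ, χ τ • kconv k (q τ) x := by
      rw [← integral_const_mul, ← integral_const_mul,
        ← integral_sub ((i1 cf2).const_mul _) ((i1 cq).const_mul _)]
      congr 1
      funext τ
      rw [hG, smul_sub, mul_smul_comm, mul_smul_comm]
    rw [e3, ← e1]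
    linear_combination (∫ τ, deriv χ τ • kconv k (u τ) x) * Complex.I_sq

theorem tendsto_kconv_of_dominated {ι : Type*} {l : Filter ι} [l.IsCountablyGenerated]
    {k : ι → ℝ → ℝ} {k₀ D : ℝ → ℝ}
    (hk : ∀ i, Continuous (k i)) (hD : Integrable D) (hkD : ∀ᶠ i in l, ∀ z, |k i z| ≤ D z)
    (hlim : ∀ z, Filter.Tendsto (fun i => k i z) l (𝓝 (k₀ z))) {f : ℝ → ℂ}
    (hf : Continuous f) {B : ℝ} (hB : ∀ y, ‖f y‖ ≤ B) (x : ℝ) :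
    Filter.Tendsto (fun i => kconv (k i) f x) l (𝓝 (kconv k₀ f x)) := by
  unfold kconv
  refine tendsto_integral_filter_of_dominated_convergence (fun y => D (x - y) * B)
    (Filter.Eventually.of_forall fun i => ?_) ?_ ((hD.comp_sub_left x).mul_const B) ?_
  · exact (((hk i).comp (continuous_const.sub continuous_id)).smul hf).aestronglyMeasurable
  · filter_upwards [hkD] with i hi
    refine Filter.Eventually.of_forall fun y => ?_
    rw [norm_smul, Real.norm_eq_abs]
    exact mul_le_mul (hi _) (hB y) (norm_nonneg _) ((abs_nonneg _).trans (hi _))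
  · exact Filter.Eventually.of_forall fun y => (hlim (x - y)).smul_const _

/-- A smooth cutoff at scale `n`. -/
theorem exists_smooth_cutoff_approximation {ρ : ℝ → ℝ} (hρ : IsLPCutoff ρ) :
    ∃ C, 0 ≤ C ∧ ∀ k : ℝ → ℝ, ContDiff ℝ ∞ k → ∃ K : ℕ → ℝ → ℝ,
      (∀ n, ContDiff ℝ ∞ (K n)) ∧ (∀ n, HasCompactSupport (K n)) ∧
      (∀ n z, |K n z| ≤ |k z|) ∧
      (∀ n z, |deriv (deriv (K n)) z| ≤ C * (|k z| + |deriv k z| + |deriv (deriv k) z|)) ∧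
      (∀ z, Filter.Tendsto (fun n => K n z) Filter.atTop (𝓝 (k z))) ∧
      ∀ z, Filter.Tendsto (fun n => deriv (deriv (K n)) z) Filter.atTop
        (𝓝 (deriv (deriv k) z)) := by
  have hρc : HasCompactSupport ρ :=
    HasCompactSupport.intro isCompact_Icc hρ.eq_zero
  have h1s : ContDiff ℝ ∞ (deriv ρ) := hρ.smooth.deriv'
  have h2s : ContDiff ℝ ∞ (deriv (deriv ρ)) := h1s.deriv'
  obtain ⟨C1, hC1⟩ := h1s.continuous.bounded_above_of_compact_support hρc.deriv
  obtain ⟨C2, hC2⟩ := h2s.continuous.bounded_above_of_compact_support hρc.deriv.deriv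
  have hC10 : 0 ≤ C1 := (norm_nonneg _).trans (hC1 0)
  have hC20 : 0 ≤ C2 := (norm_nonneg _).trans (hC2 0)
  refine ⟨C2 + 2 * C1 + 1, by positivity, fun k hk => ?_⟩
  have hk' : ContDiff ℝ ∞ (deriv k) := hk.deriv'
  have hdiff : ∀ {f : ℝ → ℝ}, ContDiff ℝ ∞ f → ∀ y, HasDerivAt f (deriv f y) y := fun hf y =>
    (hf.differentiable (by simp) y).hasDerivAt
  set ε : ℕ → ℝ := fun n => ((n : ℝ) + 1)⁻¹ with hε
  have hε0 : ∀ n, 0 < ε n := fun n => by positivity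
  have hε1 : ∀ n, ε n ≤ 1 := fun n => inv_le_one_of_one_le₀ (by
    have : (0 : ℝ) ≤ n := n.cast_nonneg
    linarith)
  have hscale : ∀ {f : ℝ → ℝ}, ContDiff ℝ ∞ f → ∀ n z,
      HasDerivAt (fun z => f (ε n * z)) (ε n * deriv f (ε n * z)) z := fun hf n z => by
    have := (hdiff hf (ε n * z)).comp z ((hasDerivAt_id z).const_mul (ε n))
    refine this.congr_deriv ?_
    ring
  have D1 : ∀ n, deriv (fun z => ρ (ε n * z) * k z) =
      fun z => ε n * deriv ρ (ε n * z) * k z + ρ (ε n * z) * deriv k z := fun n => by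
    funext z
    exact ((hscale hρ.smooth n z).mul (hdiff hk z)).deriv
  have D2 : ∀ n z, deriv (deriv (fun z => ρ (ε n * z) * k z)) z =
      ε n * (ε n * deriv (deriv ρ) (ε n * z)) * k z + ε n * deriv ρ (ε n * z) * deriv k z +
      (ε n * deriv ρ (ε n * z) * deriv k z + ρ (ε n * z) * deriv (deriv k) z) := fun n z => by
    rw [D1]
    exact ((((hscale h1s n z).const_mul (ε n)).mul (hdiff hk z)).add
      ((hscale hρ.smooth n z).mul (hdiff hk' z))).deriv
  -- Near a fixed point the truncated kernel eventually coincides with `k`, so its derivatives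
  -- converge as well.
  have hev : ∀ z, ∀ᶠ n in Filter.atTop, (fun z => ρ (ε n * z) * k z) =ᶠ[𝓝 z] k := by
    intro z
    filter_upwards [Filter.eventually_ge_atTop ⌈|z|⌉₊] with n hn
    filter_upwards [Metric.ball_mem_nhds z one_pos] with y hy
    rw [Metric.mem_ball, Real.dist_eq] at hy
    have h1 : |z| ≤ n := Nat.ceil_le.1 hn
    have h2 : |y| ≤ n + 1 := by
      have := abs_add_le (y - z) z
      rw [sub_add_cancel] at this
      linarith
    have h3 : |ε n * y| ≤ 1 := by
      rw [abs_mul, abs_of_pos (hε0 n), hε, inv_mul_le_iff₀ (by positivity), mul_one]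
      exact h2
    rw [hρ.eq_one _ (abs_le.1 h3), one_mul]
  refine ⟨fun n z => ρ (ε n * z) * k z, fun n => ?_, fun n => ?_, fun n z => ?_, fun n z => ?_,
    fun z => ?_, fun z => ?_⟩
  · exact (hρ.smooth.comp (contDiff_const.mul contDiff_id)).mul hk
  · refine HasCompactSupport.mul_right ?_
    exact hρc.comp_homeomorph (Homeomorph.mulLeft₀ (ε n) (hε0 n).ne')
  · rw [abs_mul, abs_of_nonneg (hρ.nonneg _)]
    exact mul_le_of_le_one_left (abs_nonneg _) (hρ.le_one _)
  · rw [D2]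
    have b1 := hC1 (ε n * z)
    have b2 := hC2 (ε n * z)
    rw [Real.norm_eq_abs] at b1 b2
    have b0 : |ρ (ε n * z)| ≤ 1 := by
      rw [abs_of_nonneg (hρ.nonneg _)]; exact hρ.le_one _
    have be : |ε n| ≤ 1 := by rw [abs_of_pos (hε0 n)]; exact hε1 n
    have t1 : |ε n * (ε n * deriv (deriv ρ) (ε n * z)) * k z| ≤ 1 * (1 * C2) * |k z| := by
      rw [abs_mul, abs_mul, abs_mul]; gcongr
    have t2 : |ε n * deriv ρ (ε n * z) * deriv k z| ≤ 1 * C1 * |deriv k z| := by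
      rw [abs_mul, abs_mul]; gcongr
    have t3 : |ρ (ε n * z) * deriv (deriv k) z| ≤ 1 * |deriv (deriv k) z| := by
      rw [abs_mul]; gcongr
    have s1 := abs_add_le (ε n * (ε n * deriv (deriv ρ) (ε n * z)) * k z +
      ε n * deriv ρ (ε n * z) * deriv k z) (ε n * deriv ρ (ε n * z) * deriv k z +
        ρ (ε n * z) * deriv (deriv k) z)
    have s2 := abs_add_le (ε n * (ε n * deriv (deriv ρ) (ε n * z)) * k z)
      (ε n * deriv ρ (ε n * z) * deriv k z)
    have s3 := abs_add_le (ε n * deriv ρ (ε n * z) * deriv k z) (ρ (ε n * z) * deriv (deriv k) z)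
    have p1 : 0 ≤ (2 * C1 + 1) * |k z| := by positivity
    have p2 : 0 ≤ (C2 + 1) * |deriv k z| := by positivity
    have p3 : 0 ≤ (C2 + 2 * C1) * |deriv (deriv k) z| := by positivity
    linarith
  · refine tendsto_const_nhds.congr' ?_
    filter_upwards [hev z] with n hn
    exact hn.eq_of_nhds.symm
  · refine tendsto_const_nhds.congr' ?_
    filter_upwards [hev z] with n hn
    exact hn.deriv.deriv.eq_of_nhds.symm

/-- The Littlewood-Paley kernels are Schwartz but need not have compact support. Truncate them and
pass to the limit by dominated convergence, in space and then in time. -/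
theorem IsWeakSolution.kconv_sub_eq (h : IsWeakSolution u q) {ρ : ℝ → ℝ} (hρ : IsLPCutoff ρ)
    (hu : Continuous fun z : ℝ × ℝ => u z.1 z.2) (hq : Continuous fun z : ℝ × ℝ => q z.1 z.2)
    (hub : LocallyBoundedInTime u) (hqb : LocallyBoundedInTime q)
    {k : ℝ → ℝ} (hks : ContDiff ℝ ∞ k) (hk : Integrable k) (hk' : Integrable (deriv k))
    (hk'' : Integrable (deriv (deriv k))) (x s t : ℝ) :
    kconv k (u t) x - kconv k (u s) x = ∫ τ in s..t,
      (Complex.I * kconv (deriv (deriv k)) (u τ) x - Complex.I * kconv k (q τ) x) := by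
  obtain ⟨C, hC, hcut⟩ := exists_smooth_cutoff_approximation hρ
  obtain ⟨K, Ks, Kc, Kb, K2b, Kl, K2l⟩ := hcut k hks
  have K2s : ∀ n, Continuous (deriv (deriv (K n))) := fun n => by
    have : ContDiff ℝ ∞ (deriv (deriv (K n))) := (Ks n).deriv'.deriv'
    exact this.continuous
  have iD := ((hk.abs.add hk'.abs).add hk''.abs).const_mul C
  have iK : ∀ n, Integrable (K n) := fun n => (Ks n).continuous.integrable_of_hasCompactSupport (Kc n)
  have iK2 : ∀ n, Integrable (deriv (deriv (K n))) := fun n =>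
    (K2s n).integrable_of_hasCompactSupport (Kc n).deriv.deriv
  have l1 : ∀ {f : ℝ → ℂ}, Continuous f → (∃ B, ∀ y, ‖f y‖ ≤ B) →
      Filter.Tendsto (fun n => kconv (K n) f x) Filter.atTop (𝓝 (kconv k f x)) :=
    fun hf ⟨B, hB⟩ => tendsto_kconv_of_dominated (fun n => (Ks n).continuous) hk.abs
      (Filter.Eventually.of_forall Kb) Kl hf hB x
  have l2 : ∀ {f : ℝ → ℂ}, Continuous f → (∃ B, ∀ y, ‖f y‖ ≤ B) →
      Filter.Tendsto (fun n => kconv (deriv (deriv (K n))) f x) Filter.atTop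
        (𝓝 (kconv (deriv (deriv k)) f x)) :=
    fun hf ⟨B, hB⟩ => tendsto_kconv_of_dominated K2s iD
      (Filter.Eventually.of_forall K2b) K2l hf hB x
  have us : ∀ τ, Continuous (u τ) := fun τ => hu.comp (f := fun y : ℝ => (τ, y)) (by fun_prop)
  have qs : ∀ τ, Continuous (q τ) := fun τ => hq.comp (f := fun y : ℝ => (τ, y)) (by fun_prop)
  refine tendsto_nhds_unique (((l1 (us t) (hub.bound t)).sub (l1 (us s) (hub.bound s))).congr
    fun n => h.kconv_sub_eq_of_hasCompactSupport hu hq hub hqb (Kc n) (Ks n) x s t) ?_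
  obtain ⟨B, hB⟩ := hub (max |s| |t|)
  obtain ⟨B', hB'⟩ := hqb (max |s| |t|)
  refine intervalIntegral.tendsto_integral_filter_of_dominated_convergence
    (fun _ => (∫ z, C * (|k z| + |deriv k z| + |deriv (deriv k) z|)) * B + (∫ z, |k z|) * B')
    (Filter.Eventually.of_forall fun n => ?_) (Filter.Eventually.of_forall fun n => ?_)
    intervalIntegrable_const (Filter.Eventually.of_forall fun τ _ => ?_)
  · exact ((continuous_const.mul (continuous_kconv_slice (iK2 n) hu hub x)).sub
      (continuous_const.mul (continuous_kconv_slice (iK n) hq hqb x))).aestronglyMeasurable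
  · refine Filter.Eventually.of_forall fun τ hτ => ?_
    have hτ' : |τ| ≤ max |s| |t| := by
      have := Set.uIoc_subset_uIcc hτ
      rw [Set.mem_uIcc] at this
      rcases this with ⟨h1, h2⟩ | ⟨h1, h2⟩
      · exact abs_le_max_abs_abs h1 h2
      · rw [max_comm]; exact abs_le_max_abs_abs h1 h2
    refine (norm_sub_le _ _).trans ?_
    rw [norm_mul, norm_mul, Complex.norm_I, one_mul, one_mul]
    have B0 : 0 ≤ B := (norm_nonneg _).trans (hB τ hτ' 0)
    have B0' : 0 ≤ B' := (norm_nonneg _).trans (hB' τ hτ' 0)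
    refine add_le_add ((norm_kconv_le (iK2 n) (hB τ hτ') x).trans ?_)
      ((norm_kconv_le (iK n) (hB' τ hτ') x).trans ?_)
    · exact mul_le_mul_of_nonneg_right (integral_mono (iK2 n).abs iD (K2b n)) B0
    · exact mul_le_mul_of_nonneg_right (integral_mono (iK n).abs hk.abs (Kb n)) B0'
  · exact ((l2 (us τ) (hub.bound τ)).const_mul _).sub ((l1 (qs τ) (hqb.bound τ)).const_mul _)

theorem IsWeakSolution.hasDerivAt_kconv (h : IsWeakSolution u q) {ρ : ℝ → ℝ} (hρ : IsLPCutoff ρ)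
    (hu : Continuous fun z : ℝ × ℝ => u z.1 z.2) (hq : Continuous fun z : ℝ × ℝ => q z.1 z.2)
    (hub : LocallyBoundedInTime u) (hqb : LocallyBoundedInTime q)
    {k : ℝ → ℝ} (hks : ContDiff ℝ ∞ k) (hk : Integrable k) (hk' : Integrable (deriv k))
    (hk'' : Integrable (deriv (deriv k))) (x t : ℝ) :
    HasDerivAt (fun t => kconv k (u t) x)
      (Complex.I * kconv (deriv (deriv k)) (u t) x - Complex.I * kconv k (q t) x) t := by
  have cG : Continuous fun τ => Complex.I * kconv (deriv (deriv k)) (u τ) x -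
      Complex.I * kconv k (q τ) x :=
    (continuous_const.mul (continuous_kconv_slice hk'' hu hub x)).sub
      (continuous_const.mul (continuous_kconv_slice hk hq hqb x))
  have d := intervalIntegral.integral_hasDerivAt_right (cG.intervalIntegrable t t)
      (cG.stronglyMeasurableAtFilter _ _) cG.continuousAt
  refine (d.add_const (kconv k (u t) x)).congr_of_eventuallyEq (Filter.Eventually.of_forall
    fun τ => ?_)
  simp only
  rw [← h.kconv_sub_eq hρ hu hq hub hqb hks hk hk' hk'' x t τ]
  ring

end Weak

/-! ### Pointwise bounds from the good event and from periodicity -/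

/-- A violation at an interior time would, by continuity, hold on a nonempty open set, which has
positive measure. The times `t = ±T` follow by taking the closure, which is where `T > 0` matters.
-/
theorem norm_le_of_logWeightedNorm_le {T R γ B : ℝ} (hT : 0 < T) (hS : 3 ≤ T + R) (hB : 0 ≤ B)
    {f : ℝ → ℝ → ℂ} (hf : Continuous fun z : ℝ × ℝ => f z.1 z.2)
    (h : logWeightedNorm T R γ f ≤ ENNReal.ofReal B) {t : ℝ} (ht : t ∈ Set.Icc (-T) T) (x : ℝ) :
    ‖f t x‖ ≤ B * logWeight (T + R) x ^ γ := by
  set F : ℝ × ℝ → ℂ := fun z => ((logWeight (T + R) z.2 ^ (-γ) : ℝ) : ℂ) * f z.1 z.2 with hF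
  have hFc : Continuous F := (Complex.continuous_ofReal.comp
    ((continuous_logWeight_rpow hS (-γ)).comp continuous_snd)).mul hf
  have hae : ∀ᵐ z ∂(volume.restrict (Set.Icc (-T) T ×ˢ Set.univ) : Measure (ℝ × ℝ)),
      ‖F z‖ ≤ B := by
    have h1 : eLpNormEssSup F (volume.restrict (Set.Icc (-T) T ×ˢ Set.univ)) ≤
        ENNReal.ofReal B := by
      rw [← eLpNorm_exponent_top]; exact h
    filter_upwards [enorm_ae_le_eLpNormEssSup F
      (volume.restrict (Set.Icc (-T) T ×ˢ (Set.univ : Set ℝ)))] with z hz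
    have := hz.trans h1
    rwa [← ofReal_norm, ENNReal.ofReal_le_ofReal_iff hB] at this
  have hopen : ∀ z ∈ Set.Ioo (-T) T ×ˢ (Set.univ : Set ℝ), ‖F z‖ ≤ B := by
    by_contra hcon
    push Not at hcon
    obtain ⟨z, hz, hzB⟩ := hcon
    have hU : IsOpen ((Set.Ioo (-T) T ×ˢ (Set.univ : Set ℝ)) ∩ {z | B < ‖F z‖}) :=
      (isOpen_Ioo.prod isOpen_univ).inter (isOpen_lt continuous_const hFc.norm)
    have hpos := hU.measure_pos (volume : Measure (ℝ × ℝ)) ⟨z, hz, hzB⟩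
    rw [ae_restrict_iff' (measurableSet_Icc.prod MeasurableSet.univ)] at hae
    refine hpos.ne' (measure_mono_null (fun w hw => ?_) hae)
    simp only [Set.mem_compl_iff, Set.mem_ofPred_eq, not_forall, not_le]
    exact ⟨⟨Set.Ioo_subset_Icc_self hw.1.1, trivial⟩, hw.2⟩
  have hclosed : IsClosed {s : ℝ | ‖F (s, x)‖ ≤ B} :=
    isClosed_le (hFc.comp (f := fun s : ℝ => (s, x)) (by fun_prop)).norm continuous_const
  have hsub : closure (Set.Ioo (-T) T) ⊆ {s : ℝ | ‖F (s, x)‖ ≤ B} :=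
    closure_minimal (fun s hs => hopen (s, x) ⟨hs, trivial⟩) hclosed
  rw [closure_Ioo (by linarith)] at hsub
  have hb : ‖F (t, x)‖ ≤ B := hsub ht
  have hL : 0 < logWeight (T + R) x := one_pos.trans_le (one_le_logWeight hS x)
  rw [hF, norm_mul, Complex.norm_real, Real.norm_of_nonneg (by positivity),
    Real.rpow_neg hL.le, inv_mul_le_iff₀ (by positivity)] at hb
  linarith

theorem GoodBounds.sliceBounds {ρ : ℝ → ℝ} {g : 𝓢(ℝ, ℝ)} (hg : IsLPProfile ρ g)
    {p δ A T R : ℝ} (hA : 0 ≤ A) (hT : 0 < T) (hS : 3 ≤ T + R) {u : ℝ → ℝ → ℂ}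
    (hu : Continuous fun z : ℝ × ℝ => u z.1 z.2) (hb : LocallyBoundedInTime u)
    (h : GoodBounds ρ p δ A T R u) {t : ℝ} (ht : t ∈ Set.Icc (-T) T) :
    SliceBounds g p δ A (T + R) (u t) where
  continuous := hu.comp (f := fun y : ℝ => (t, y)) (by fun_prop)
  bounded := hb.bound t
  size := norm_le_of_logWeightedNorm_le hT hS hA hu h.1 ht
  high := fun k x => by
    have hN : (0 : ℝ) < 2 ^ k := by positivity
    have hc : 0 < ((2 : ℝ) ^ k) ^ (1 / 2 - δ) := by positivity
    have h1 := (le_iSup (fun k : ℕ => ENNReal.ofReal (((2 : ℝ) ^ k) ^ (1 / 2 - δ)) *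
      logWeightedNorm T R (1 / 2) (fun t => lpHigh ρ (2 ^ k) (u t))) k).trans h.2
    have hE : (fun t => lpHigh ρ (2 ^ k) (u t)) =
        fun t x => u t x - kconv (scaledKernel g (2 ^ k)) (u t) x := by
      funext t x
      rw [lpHigh, hg.lpLow_eq hN]
    rw [hE] at h1
    have h2 : logWeightedNorm T R (1 / 2)
        (fun t x => u t x - kconv (scaledKernel g (2 ^ k)) (u t) x) ≤
        ENNReal.ofReal (A * ((2 : ℝ) ^ k) ^ (δ - 1 / 2)) := by
      rw [← neg_sub (1 / 2 : ℝ) δ, Real.rpow_neg hN.le, ← div_eq_mul_inv, ENNReal.ofReal_div_of_pos hc,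
        ENNReal.le_div_iff_mul_le (Or.inl (by simpa using hc)) (Or.inl ENNReal.ofReal_ne_top),
        mul_comm]
      exact h1
    exact norm_le_of_logWeightedNorm_le hT hS (by positivity)
      (hu.sub (continuous_kconv_time (IsLPProfile.integrable g hN) hu hb)) h2 ht x

namespace IsPeriodicNLSSolution
variable {p L : ℝ} {φ : ℝ → ℂ} {u : ℝ → ℝ → ℂ}

/-- The only use of periodicity. The bound depends on the solution and serves convergence alone. -/
theorem locallyBoundedInTime (h : IsPeriodicNLSSolution p L φ u) (hL : 0 < L) :
    LocallyBoundedInTime u := by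
  intro T
  have hc : 0 < 2 * Real.pi * L := by positivity
  obtain ⟨B, hB⟩ := (isCompact_Icc.prod isCompact_Icc :
    IsCompact (Set.Icc (-T) T ×ˢ Set.Icc 0 (2 * Real.pi * L))).exists_bound_of_continuousOn
      h.continuous.continuousOn
  refine ⟨B, fun t ht y => ?_⟩
  obtain ⟨y', hy', he⟩ := (h.periodic t).exists_mem_Ico₀ hc y
  rw [he]
  exact hB (t, y') ⟨abs_le.1 ht, Set.Ico_subset_Icc_self hy'⟩

theorem isWeakSolution (h : IsPeriodicNLSSolution p L φ u) :
    IsWeakSolution u fun t x => powNonlin p (u t x) := h.equation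

end IsPeriodicNLSSolution

theorem LocallyBoundedInTime.powNonlin {p : ℝ} (hp : 3 ≤ p) {u : ℝ → ℝ → ℂ}
    (h : LocallyBoundedInTime u) : LocallyBoundedInTime fun t x => powNonlin p (u t x) := by
  intro T
  obtain ⟨B, hB⟩ := h T
  refine ⟨B ^ (p - 1) * B, fun t ht y => ?_⟩
  have := hB t ht y
  have h0 := norm_nonneg (u t y)
  have hB0 : 0 ≤ B := h0.trans this
  have hp1 : 0 ≤ p - 1 := by linarith
  rw [norm_powNonlin]
  gcongr

theorem LocallyBoundedInTime.sub {u v : ℝ → ℝ → ℂ} (hu : LocallyBoundedInTime u)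
    (hv : LocallyBoundedInTime v) : LocallyBoundedInTime fun t x => u t x - v t x := by
  intro T
  obtain ⟨B, hB⟩ := hu T
  obtain ⟨B', hB'⟩ := hv T
  exact ⟨B + B', fun t ht y => (norm_sub_le _ _).trans (add_le_add (hB t ht y) (hB' t ht y))⟩

theorem LocallyBoundedInTime.kconv {k : ℝ → ℝ} (hk : Integrable k) {u : ℝ → ℝ → ℂ}
    (hu : LocallyBoundedInTime u) : LocallyBoundedInTime fun t => kconv k (u t) := by
  intro T
  obtain ⟨B, hB⟩ := hu T
  exact ⟨_, fun t ht => norm_kconv_le hk (hB t ht)⟩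

theorem LocallyBoundedInTime.const_mul (c : ℂ) {u : ℝ → ℝ → ℂ}
    (hu : LocallyBoundedInTime u) : LocallyBoundedInTime fun t x => c * u t x := by
  intro T
  obtain ⟨B, hB⟩ := hu T
  refine ⟨‖c‖ * B, fun t ht y => ?_⟩
  rw [norm_mul]
  exact mul_le_mul_of_nonneg_left (hB t ht y) (norm_nonneg c)

/-! ### Differentiation of the localized mass and Gronwall's inequality -/

theorem hasDerivAt_integral_normSq_sigma {R : ℝ} (hR : 0 < R) {W W' : ℝ → ℝ → ℂ}
    (hW : Continuous fun z : ℝ × ℝ => W z.1 z.2) (hW' : Continuous fun z : ℝ × ℝ => W' z.1 z.2)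
    (hb : LocallyBoundedInTime W) (hb' : LocallyBoundedInTime W')
    (hd : ∀ t x, HasDerivAt (fun t => W t x) (W' t x) t) (t : ℝ) :
    HasDerivAt (fun t => ∫ x, ‖W t x‖ ^ 2 * sigmaWeight R x)
      (2 * ∫ x, inner ℝ (W t x) (W' t x) * sigmaWeight R x) t := by
  have sl : ∀ {f : ℝ → ℝ → ℂ}, (Continuous fun z : ℝ × ℝ => f z.1 z.2) → ∀ τ, Continuous (f τ) :=
    fun hf τ => hf.comp (f := fun y : ℝ => (τ, y)) (by fun_prop)
  have iσ := integrable_sigmaWeight hR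
  obtain ⟨B, hB⟩ := hb.eventually t
  obtain ⟨B', hB'⟩ := hb'.eventually t
  have hcσ := continuous_sigmaWeight R
  have key := hasDerivAt_integral_of_dominated_loc_of_deriv_le (μ := volume)
    (F := fun t x => ‖W t x‖ ^ 2 * sigmaWeight R x) (x₀ := t)
    (F' := fun t x => 2 * inner ℝ (W t x) (W' t x) * sigmaWeight R x)
    (bound := fun x => 2 * (B * B') * sigmaWeight R x) (hB.and hB')
    (Filter.Eventually.of_forall fun τ => (((sl hW τ).norm.pow 2).mul hcσ).aestronglyMeasurable)
    (by
      obtain ⟨B₀, hB₀⟩ := hb.bound t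
      exact integrable_sq_sigma hR (sl hW t).norm (fun x => by rw [abs_norm]; exact hB₀ x))
    ((continuous_const.mul ((sl hW t).inner (sl hW' t))).mul hcσ).aestronglyMeasurable
    (Filter.Eventually.of_forall fun x τ hτ => ?_) (iσ.const_mul _)
    (Filter.Eventually.of_forall fun x τ hτ => ((hd τ x).norm_sq).mul_const _)
  · refine key.2.congr_deriv ?_
    rw [← integral_const_mul]
    congr 1
    funext x
    ring
  · have hs := (sigmaWeight_pos R x).le
    rw [norm_mul, Real.norm_of_nonneg hs, norm_mul, Real.norm_two]
    refine mul_le_mul_of_nonneg_right (mul_le_mul_of_nonneg_left ?_ zero_le_two) hs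
    exact (abs_real_inner_le_norm _ _).trans (mul_le_mul (hτ.1 x) (hτ.2 x) (norm_nonneg _)
      ((norm_nonneg _).trans (hτ.1 x)))

theorem contDiff_scaledKernel (h : 𝓢(ℝ, ℝ)) (N : ℝ) : ContDiff ℝ ∞ (scaledKernel h N) :=
  contDiff_const.mul (h.smooth'.comp (contDiff_const.mul contDiff_id))

theorem deriv_scaledKernel (h : 𝓢(ℝ, ℝ)) (N : ℝ) : deriv (scaledKernel h N) =
    fun x => N * scaledKernel (SchwartzMap.derivCLM ℝ ℝ h) N x :=
  funext fun x => (hasDerivAt_scaledKernel h N x).deriv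

theorem deriv_deriv_scaledKernel (h : 𝓢(ℝ, ℝ)) (N : ℝ) : deriv (deriv (scaledKernel h N)) =
    fun x => N * (N * scaledKernel
      (SchwartzMap.derivCLM ℝ ℝ (SchwartzMap.derivCLM ℝ ℝ h)) N x) := by
  rw [deriv_scaledKernel]
  exact funext fun x => ((hasDerivAt_scaledKernel _ N x).const_mul N).deriv

theorem IsPeriodicNLSSolution.hasDerivAt_kconv {ρ : ℝ → ℝ} (hρ : IsLPCutoff ρ) {p L : ℝ}
    (hp : 3 ≤ p) (hL : 0 < L) {φ : ℝ → ℂ} {u : ℝ → ℝ → ℂ} (h : IsPeriodicNLSSolution p L φ u)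
    (g : 𝓢(ℝ, ℝ)) {R : ℝ} (hR : 0 < R) (x t : ℝ) :
    HasDerivAt (fun t => kconv (scaledKernel g R) (u t) x)
      (Complex.I * (R • R • kconv (scaledKernel
          (SchwartzMap.derivCLM ℝ ℝ (SchwartzMap.derivCLM ℝ ℝ g)) R) (u t) x) -
        Complex.I * kconv (scaledKernel g R) (fun y => powNonlin p (u t y)) x) t := by
  have hb := h.locallyBoundedInTime hL
  have := h.isWeakSolution.hasDerivAt_kconv hρ h.continuous
    ((continuous_powNonlin hp).comp h.continuous) hb (hb.powNonlin hp)
    (contDiff_scaledKernel g R) (IsLPProfile.integrable g hR)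
    (by rw [deriv_scaledKernel]; exact (IsLPProfile.integrable _ hR).const_mul R)
    (by
      rw [deriv_deriv_scaledKernel]
      exact ((IsLPProfile.integrable _ hR).const_mul R).const_mul R) x t
  rwa [deriv_deriv_scaledKernel, kconv_const_mul, kconv_const_mul] at this

theorem hasDerivAt_localized_mass {ρ : ℝ → ℝ} (hρ : IsLPCutoff ρ) {p L L' : ℝ}
    (hp : 3 ≤ p) (hL : 0 < L) (hL' : 0 < L') {φ φ' : ℝ → ℂ} {u v : ℝ → ℝ → ℂ}
    (hu : IsPeriodicNLSSolution p L φ u) (hv : IsPeriodicNLSSolution p L' φ' v)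
    (g : 𝓢(ℝ, ℝ)) {R : ℝ} (hR : 0 < R) (t : ℝ) :
    HasDerivAt (fun t => ∫ x, ‖kconv (scaledKernel g R) (fun y => u t y - v t y) x‖ ^ 2 *
        sigmaWeight R x)
      (2 * ((∫ x, inner ℝ (kconv (scaledKernel g R) (fun y => u t y - v t y) x)
          (Complex.I * (R • R • kconv (scaledKernel
            (SchwartzMap.derivCLM ℝ ℝ (SchwartzMap.derivCLM ℝ ℝ g)) R)
              (fun y => u t y - v t y) x)) * sigmaWeight R x) -
        ∫ x, inner ℝ (kconv (scaledKernel g R) (fun y => u t y - v t y) x)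
          (Complex.I * kconv (scaledKernel g R)
            (fun y => powNonlin p (u t y) - powNonlin p (v t y)) x) * sigmaWeight R x)) t := by
  have ub := hu.locallyBoundedInTime hL
  have vb := hv.locallyBoundedInTime hL'
  have sl : ∀ {f : ℝ → ℝ → ℂ}, (Continuous fun z : ℝ × ℝ => f z.1 z.2) → ∀ τ, Continuous (f τ) :=
    fun hf τ => hf.comp (f := fun y : ℝ => (τ, y)) (by fun_prop)
  have uc := hu.continuous
  have vc := hv.continuous
  have wc : Continuous fun z : ℝ × ℝ => u z.1 z.2 - v z.1 z.2 := uc.sub vc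
  have wb := ub.sub vb
  have Fuc : Continuous fun z : ℝ × ℝ => powNonlin p (u z.1 z.2) := (continuous_powNonlin hp).comp uc
  have Fvc : Continuous fun z : ℝ × ℝ => powNonlin p (v z.1 z.2) := (continuous_powNonlin hp).comp vc
  have Fub := ub.powNonlin hp
  have Fvb := vb.powNonlin hp
  have Fb := Fub.sub Fvb
  have Fc : Continuous fun z : ℝ × ℝ => powNonlin p (u z.1 z.2) - powNonlin p (v z.1 z.2) :=
    Fuc.sub Fvc
  have ik := IsLPProfile.integrable g hR
  set g'' := SchwartzMap.derivCLM ℝ ℝ (SchwartzMap.derivCLM ℝ ℝ g) with hg''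
  have ik'' := IsLPProfile.integrable g'' hR
  have Wc := continuous_kconv_time ik (u := fun t y => u t y - v t y) wc wb
  have Wb := wb.kconv ik
  have W2c : Continuous fun z : ℝ × ℝ => Complex.I * (R • R • kconv (scaledKernel g'' R)
      (fun y => u z.1 y - v z.1 y) z.2) := continuous_const.mul (((continuous_kconv_time ik''
    (u := fun t y => u t y - v t y) wc wb).const_smul R).const_smul R)
  have Nc : Continuous fun z : ℝ × ℝ => Complex.I * kconv (scaledKernel g R)
      (fun y => powNonlin p (u z.1 y) - powNonlin p (v z.1 y)) z.2 :=
    continuous_const.mul (continuous_kconv_time ik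
      (u := fun t y => powNonlin p (u t y) - powNonlin p (v t y)) Fc Fb)
  have W2b : LocallyBoundedInTime fun t x => Complex.I * (R • R • kconv (scaledKernel g'' R)
      (fun y => u t y - v t y) x) := by
    have := (((wb.kconv ik'').const_mul (R : ℂ)).const_mul (R : ℂ)).const_mul Complex.I
    simpa only [Complex.real_smul] using this
  have Nb := (Fb.kconv ik).const_mul Complex.I
  have key := hasDerivAt_integral_normSq_sigma hR Wc (W2c.sub Nc) Wb (W2b.sub Nb) (fun t x => by
    obtain ⟨Bu, hBu⟩ := ub.bound t
    obtain ⟨Bv, hBv⟩ := vb.bound t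
    obtain ⟨Bfu, hBfu⟩ := Fub.bound t
    obtain ⟨Bfv, hBfv⟩ := Fvb.bound t
    have d := (hu.hasDerivAt_kconv hρ hp hL g hR x t).sub (hv.hasDerivAt_kconv hρ hp hL' g hR x t)
    refine (d.congr_deriv ?_).congr_of_eventuallyEq (Filter.Eventually.of_forall fun τ => ?_)
    · rw [kconv_sub ik'' (sl uc t) (sl vc t) hBu hBv,
        kconv_sub ik (sl (f := fun t y => powNonlin p (u t y)) Fuc t)
          (sl (f := fun t y => powNonlin p (v t y)) Fvc t) hBfu hBfv, smul_sub, smul_sub]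
      ring
    · obtain ⟨Bu, hBu⟩ := ub.bound τ
      obtain ⟨Bv, hBv⟩ := vb.bound τ
      exact kconv_sub ik (sl uc τ) (sl vc τ) hBu hBv x) t
  refine key.congr_deriv ?_
  obtain ⟨BW, hBW⟩ := Wb.bound t
  obtain ⟨BW2, hBW2⟩ := W2b.bound t
  obtain ⟨BN, hBN⟩ := Nb.bound t
  have i1 := integrable_inner_sigma hR (sl (f := fun t x => kconv (scaledKernel g R)
    (fun y => u t y - v t y) x) Wc t) (sl (f := fun t x => Complex.I * (R • R •
      kconv (scaledKernel g'' R) (fun y => u t y - v t y) x)) W2c t) hBW hBW2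
  have i2 := integrable_inner_sigma hR (sl (f := fun t x => kconv (scaledKernel g R)
    (fun y => u t y - v t y) x) Wc t) (sl (f := fun t x => Complex.I * kconv (scaledKernel g R)
      (fun y => powNonlin p (u t y) - powNonlin p (v t y)) x) Nc t) hBW hBN
  rw [← integral_sub i1 i2]
  congr 2
  funext x
  rw [inner_sub_right, sub_mul]

/-- Gronwall in both time directions: `e^{-Bτ} y` is nonincreasing and `e^{Bτ} y` is nondecreasing,
which is why `|y'|` and not just `y'` is bounded. -/
theorem le_exp_mul_of_abs_deriv_le {y y' : ℝ → ℝ} {B T : ℝ} (hd : ∀ s, HasDerivAt y (y' s) s)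
    (hb : ∀ s ∈ Set.Icc (-T) T, |y' s| ≤ B * y s) {s t : ℝ} (hs : s ∈ Set.Icc (-T) T)
    (ht : t ∈ Set.Icc (-T) T) : y t ≤ Real.exp (B * |t - s|) * y s := by
  have dE : ∀ c τ : ℝ, HasDerivAt (fun τ => Real.exp (c * τ) * y τ)
      (Real.exp (c * τ) * (c * y τ + y' τ)) τ := fun c τ => by
    have := (((hasDerivAt_id τ).const_mul c).exp).mul (hd τ)
    refine this.congr_deriv ?_
    simp only [id, mul_one]
    ring
  have cE : ∀ c, Continuous fun τ => Real.exp (c * τ) * y τ := fun c =>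
    continuous_iff_continuousAt.2 fun τ => (dE c τ).continuousAt
  rcases le_total s t with hst | hst
  · have anti : AntitoneOn (fun τ => Real.exp (-B * τ) * y τ) (Set.Icc (-T) T) :=
      antitoneOn_of_deriv_nonpos (convex_Icc _ _) (cE (-B)).continuousOn
        (fun τ _ => (dE (-B) τ).differentiableAt.differentiableWithinAt) fun τ hτ => by
          rw [(dE (-B) τ).deriv]
          have := (abs_le.1 (hb τ (interior_subset hτ))).2
          exact mul_nonpos_of_nonneg_of_nonpos (Real.exp_pos _).le (by linarith)
    have := mul_le_mul_of_nonneg_left (anti hs ht hst) (Real.exp_pos (B * t)).le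
    simp only [← mul_assoc, ← Real.exp_add] at this
    rw [abs_of_nonneg (by linarith)]
    rw [show B * t + -B * t = 0 by ring, Real.exp_zero, one_mul,
      show B * t + -B * s = B * (t - s) by ring] at this
    exact this
  · have mono : MonotoneOn (fun τ => Real.exp (B * τ) * y τ) (Set.Icc (-T) T) :=
      monotoneOn_of_deriv_nonneg (convex_Icc _ _) (cE B).continuousOn
        (fun τ _ => (dE B τ).differentiableAt.differentiableWithinAt) fun τ hτ => by
          rw [(dE B τ).deriv]
          have := (abs_le.1 (hb τ (interior_subset hτ))).1
          exact mul_nonneg (Real.exp_pos _).le (by linarith)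
    have := mul_le_mul_of_nonneg_left (mono ht hs hst) (Real.exp_pos (-B * t)).le
    simp only [← mul_assoc, ← Real.exp_add] at this
    rw [abs_of_nonpos (by linarith)]
    rw [show -B * t + B * t = 0 by ring, Real.exp_zero, one_mul,
      show -B * t + B * s = B * -(t - s) by ring] at this
    exact this

theorem proposition5p3 (ρ : ℝ → ℝ) (hρ : IsLPCutoff ρ)
    (p δ A₀ : ℝ) (hp : 3 ≤ p) (hδ : 0 < δ) (hA₀ : 1 ≤ A₀) :
    ∃ A₂ : ℝ, 1 ≤ A₂ ∧
      ∀ L R T : ℝ, 10 ≤ L → 10 ≤ R → 1 ≤ T →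
      ∀ (φL φHalf : ℝ → ℂ) (uL uHalf : ℝ → ℝ → ℂ),
        IsPeriodicNLSSolution p L φL uL →
        IsPeriodicNLSSolution p (L / 2) φHalf uHalf →
        GoodEvent ρ p δ A₀ T R uL uHalf →
        ∀ t ∈ Set.Icc (-T) T, ∀ t₀ ∈ Set.Icc (-T) T,
          localMass ρ R (fun x => uL t x - uHalf t x) ≤
            Real.exp (A₂ * Real.log (T + R) ^ (2 * (p - 1) / (p + 3)) * |t - t₀|) *
              (localMass ρ R (fun x => uL t₀ x - uHalf t₀ x) +
                A₂ * R ^ (-1 + 8 * δ) * Real.log (T + R) ^ p) := by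
  have hA : 0 ≤ A₀ := by linarith
  obtain ⟨g, hg⟩ := hρ.exists_profile
  obtain ⟨C1, hC1, hdisp⟩ := exists_dispersive_energy_bound hρ hg (A := 2 * A₀) (by linarith)
  obtain ⟨C2, hC2, hnl⟩ := exists_nonlinear_energy_bound hρ hg hp hδ hA
  -- The factor `2` comes from differentiating the square; the added `1` ensures `A₂ ≥ 1`.
  refine ⟨2 * (C1 + C2) + 1, by linarith, ?_⟩
  intro L R T hL hR hT φ φ' u v hu hv hgood t ht t₀ ht₀
  set A₂ := 2 * (C1 + C2) + 1 with hA₂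
  have hA₂1 : 1 ≤ A₂ := by linarith
  have hR0 : 0 < R := by linarith
  have hT0 : 0 < T := by linarith
  have hS : 3 ≤ T + R := by linarith
  have hL0 : 0 < L := by linarith
  have hLh : 0 < L / 2 := by linarith
  have hl := one_le_log_of_three_le hS
  set l := Real.log (T + R) with hldef
  have hl0 : 0 < l := by linarith
  set a := 2 * (p - 1) / (p + 3) with ha
  have ha0 : 0 ≤ a := div_nonneg (by linarith) (by linarith)
  -- Equivalent to `p² - p - 4 ≥ 0`. It gives `2(a + 1) ≤ a + p`, so the error of the nonlinear term
  -- is at most `l^a` times `E`.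
  have hap : a + 2 ≤ p := by
    have : a ≤ p - 2 := by
      rw [ha, div_le_iff₀ (by linarith)]
      nlinarith
    linarith
  set M : ℝ → ℝ := fun t => ∫ x, ‖kconv (scaledKernel g R) (fun y => u t y - v t y) x‖ ^ 2 *
    sigmaWeight R x with hM
  have hlocal : ∀ t, localMass ρ R (fun x => u t x - v t x) = M t := fun t => by
    simp only [localMass, hM, hg.lpLow_eq hR0]
  have hM0 : ∀ t, 0 ≤ M t := fun t =>
    integral_nonneg fun x => mul_nonneg (sq_nonneg _) (sigmaWeight_pos R x).le
  rw [hlocal, hlocal]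
  have hRδ : 0 < R ^ (-1 + 8 * δ) := by positivity
  set E : ℝ := A₂ * R ^ (-1 + 8 * δ) * l ^ p with hE
  have hE0 : 0 ≤ E := by positivity
  have la1 : 1 ≤ l ^ a := Real.one_le_rpow hl ha0
  have ub := hu.locallyBoundedInTime hL0
  have vb := hv.locallyBoundedInTime hLh
  have hd := hasDerivAt_localized_mass hρ hp hL0 hLh hu hv g hR0
  have hEa : R ^ (-1 + 8 * δ) * l ^ (a + p) ≤ l ^ a * E := by
    rw [hE, Real.rpow_add hl0]
    have : 0 ≤ l ^ a * (R ^ (-1 + 8 * δ) * l ^ p) := by positivity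
    nlinarith
  -- Gronwall is applied to `M + E`, which absorbs the inhomogeneous error; the nonnegative `E` on
  -- the left is then dropped.
  have key := le_exp_mul_of_abs_deriv_le (y := fun t => M t + E) (B := A₂ * l ^ a) (T := T)
    (fun s => (hd s).add_const E) (fun s hs => ?_) ht₀ ht
  · linarith
  · have su := hgood.1.sliceBounds hg hA hT0 hS hu.continuous ub hs
    have sv := hgood.2.sliceBounds hg hA hT0 hS hv.continuous vb hs
    have h1 := hdisp (T + R) R (fun y => u s y - v s y) hS (by linarith) (by linarith)
      (su.continuous.sub sv.continuous) ((ub.sub vb).bound s) (fun y => by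
        have := su.size_half hp hA hS y
        have := sv.size_half hp hA hS y
        have := norm_sub_le (u s y) (v s y)
        linarith)
    have h2 := hnl (T + R) R (u s) (v s) hS (by linarith) (by linarith) su sv
    change _ ≤ C1 * (M s + R⁻¹ * l ^ (2 : ℝ)) at h1
    change _ ≤ C2 * (l ^ a * M s + R ^ (-1 + 4 * δ) * l ^ (2 * (a + 1))) at h2
    have e1 : R⁻¹ * l ^ (2 : ℝ) ≤ l ^ a * E := by
      refine le_trans ?_ hEa
      rw [← Real.rpow_neg_one]
      gcongr <;> linarith
    have e2 : R ^ (-1 + 4 * δ) * l ^ (2 * (a + 1)) ≤ l ^ a * E := by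
      refine le_trans ?_ hEa
      gcongr <;> linarith
    have e3 : M s ≤ l ^ a * M s := le_mul_of_one_le_left (hM0 s) la1
    have h3 : 0 ≤ l ^ a * (M s + E) := mul_nonneg (by linarith) (add_nonneg (hM0 s) hE0)
    rw [abs_mul, abs_two]
    calc _ ≤ 2 * (C1 * (M s + R⁻¹ * l ^ (2 : ℝ)) +
          C2 * (l ^ a * M s + R ^ (-1 + 4 * δ) * l ^ (2 * (a + 1)))) :=
          mul_le_mul_of_nonneg_left ((abs_sub _ _).trans (add_le_add h1 h2)) zero_le_two
      _ ≤ 2 * (C1 * (l ^ a * M s + l ^ a * E) + C2 * (l ^ a * M s + l ^ a * E)) := by gcongr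
      _ = 2 * (C1 + C2) * (l ^ a * (M s + E)) := by ring
      _ ≤ A₂ * (l ^ a * (M s + E)) := mul_le_mul_of_nonneg_right (by linarith) h3
      _ = _ := by ring
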